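/- Call a string $x$ of length $n$ $k$-cyclic periodic if $x = u_1u_2\cdots u_\ell$ for some $\ell$ with $k\ell = n$ and strings $u_1,\dots,u_\ell$ of length $k$ any two of which are cyclic rotations of each other. There is an algorithm on the word RAM that, given a string $x$ of length $n$ over an integer alphabet $\{0,\dots,\sigma-1\}$, decides for every $k$ with $1 \le k \le n$ whether $x$ is $k$-cyclic periodic, in $\mathcal{O}(n\log n)$ total time and $\mathcal{O}(n)$ space (in machine words of $\mathcal{O}(\log(n+\sigma))$ bits). The constants do not depend on $\sigma$. -/

import Mathlib

/-- A string `x` is `k`-cyclic periodic: `x = u₁ u₂ ⋯ u_ℓ` for some blocks `u₁, …, u_ℓ`, all of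
length `k`, any two of which are rotations of each other. -/
def IsCyclicPeriodic {α : Type*} (k : ℕ) (x : List α) : Prop :=
  ∃ us : List (List α), us.flatten = x ∧ (∀ u ∈ us, u.length = k) ∧
    ∀ u ∈ us, ∀ v ∈ us, List.IsRotated u v

namespace WordRAM

/-- Arithmetic operations of the machine; all of them act on natural numbers
(truncated subtraction, division rounding down). -/
inductive Op where
  | add
  | sub
  | mul
  | div

/-- The value of an arithmetic operation. -/
def Op.eval : Op → ℕ → ℕ → ℕ
  | .add, a, b => a + b
  | .sub, a, b => a - b
  | .mul, a, b => a * b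
  | .div, a, b => a / b

/-- Comparisons of machine words. -/
inductive Cmp where
  | lt
  | le
  | eq
  | ne

/-- The truth value of a comparison. -/
def Cmp.Holds : Cmp → ℕ → ℕ → Prop
  | .lt, a, b => a < b
  | .le, a, b => a ≤ b
  | .eq, a, b => a = b
  | .ne, a, b => a ≠ b

/-- Programs of the random-access machine. The arguments `d a b` are names of registers
(a program mentions only finitely many of them, independently of the input):
* `const d v`: put the constant `v` into register `d`;
* `arith o d a b`: apply `o` to the contents of registers `a`, `b`, put the result into `d`;
* `load d a`: put into `d` the content of the memory cell whose address is in register `a`;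
* `store a b`: put the content of register `b` into the memory cell whose address is in
  register `a`;
* sequencing, and branching and looping on the comparison of two registers. -/
inductive Program where
  | skip
  | const (d v : ℕ)
  | arith (o : Op) (d a b : ℕ)
  | load (d a : ℕ)
  | store (a b : ℕ)
  | seq (p q : Program)
  | ite (c : Cmp) (a b : ℕ) (p q : Program)
  | while (c : Cmp) (a b : ℕ) (p : Program)

/-- A state of the machine: the contents of the registers and of the memory cells. -/
structure State where
  reg : ℕ → ℕ
  mem : ℕ → ℕ

/-- The state after writing `v` into register `d`. -/
def State.setReg (s : State) (d v : ℕ) : State :=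
  { s with reg := Function.update s.reg d v }

/-- The state after writing `v` into the memory cell with address `i`. -/
def State.setMem (s : State) (i v : ℕ) : State :=
  { s with mem := Function.update s.mem i v }

/-- `Exec w m p s s' t`: on a machine with words of `w` bits and a memory of `m` cells
(addresses `0, …, m - 1`), the program `p`, started in state `s`, terminates in state `s'` after
exactly `t` steps. Every instruction and every evaluation of a branch or loop condition is one
step. There is no rule for writing a value that does not fit into a word, nor for accessing an
address outside the memory, so a terminating execution does neither. -/
inductive Exec (w m : ℕ) : Program → State → State → ℕ → Prop where
  | skip (s : State) : Exec w m .skip s s 1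
  | const (s : State) (d v : ℕ) (hv : v < 2 ^ w) :
      Exec w m (.const d v) s (s.setReg d v) 1
  | arith (s : State) (o : Op) (d a b : ℕ) (hv : o.eval (s.reg a) (s.reg b) < 2 ^ w) :
      Exec w m (.arith o d a b) s (s.setReg d (o.eval (s.reg a) (s.reg b))) 1
  | load (s : State) (d a : ℕ) (ha : s.reg a < m) :
      Exec w m (.load d a) s (s.setReg d (s.mem (s.reg a))) 1
  | store (s : State) (a b : ℕ) (ha : s.reg a < m) :
      Exec w m (.store a b) s (s.setMem (s.reg a) (s.reg b)) 1
  | seq {p q : Program} {s s' s'' : State} {t t' : ℕ}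
      (hp : Exec w m p s s' t) (hq : Exec w m q s' s'' t') :
      Exec w m (.seq p q) s s'' (t + t')
  | ite_true {c : Cmp} {a b : ℕ} {p q : Program} {s s' : State} {t : ℕ}
      (hc : c.Holds (s.reg a) (s.reg b)) (hp : Exec w m p s s' t) :
      Exec w m (.ite c a b p q) s s' (1 + t)
  | ite_false {c : Cmp} {a b : ℕ} {p q : Program} {s s' : State} {t : ℕ}
      (hc : ¬ c.Holds (s.reg a) (s.reg b)) (hq : Exec w m q s s' t) :
      Exec w m (.ite c a b p q) s s' (1 + t)
  | while_true {c : Cmp} {a b : ℕ} {p : Program} {s s' s'' : State} {t t' : ℕ}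
      (hc : c.Holds (s.reg a) (s.reg b)) (hp : Exec w m p s s' t)
      (hl : Exec w m (.while c a b p) s' s'' t') :
      Exec w m (.while c a b p) s s'' (1 + t + t')
  | while_false {c : Cmp} {a b : ℕ} {p : Program} {s : State}
      (hc : ¬ c.Holds (s.reg a) (s.reg b)) :
      Exec w m (.while c a b p) s s 1

/-- The initial state for an input string `x = x[1..n]` over the alphabet `{0, …, σ - 1}`:
register `0` holds the length `n`, memory cell `i` holds the letter `x[i]` for `1 ≤ i ≤ n`, and
everything else is `0`. -/
def initState {σ : ℕ} (x : List (Fin σ)) : State where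
  reg := Function.update 0 0 x.length
  mem
    | 0 => 0
    | i + 1 => (x.map Fin.val).getD i 0

end WordRAM

/-! Fix `k` dividing `n` and let `u` be the prefix of length `k`. Being rotated is an equivalence
relation, so the question is whether every block of length `k` is a rotation of `u`. If `u` has a
period `d` properly dividing `k`, the answer for `k` follows from the earlier answer for `d`
together with one comparison per block (`cycPer_iff_of_period`).

Otherwise `u` is primitive. Let `m = 2 ^ j` with `2 * m ≤ k < 4 * m`. A rotation cuts the cyclic
word `u` at one point only, so it leaves one of the two windows of length `m` at `0` and `m` intact
(`exists_intact`), and an occurrence of that window inside a block suggests a rotation. There may be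
many occurrences, but they fall into progressions whose difference `p` is a period of the window,
and successive progressions are more than `m / 2` apart (`gap_eq_period`). Hence they meet `O(n /
k)` blocks altogether (`Wins.sum_le`). In the cyclic word the window lies in a maximal stretch of
period `p`, which is finite because `u` is primitive. The part of the progression visible in a block
must stop where this stretch stops, up to one period, on at least one side (`run_ends`). So three
alignments per progression and block suffice (`rotation_found`).

An alignment is tested by two comparisons of factors. Positions are named by the first occurrence of
their factor of length `2 ^ j` (`cls`), and pairs of names of level `j` give the names of level `j +
1` in linear time. Names of the current level compare factors of length between `2 ^ j` and `4 * 2 ^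
j` in constant time. Shorter factors need names of lower levels, and storing all levels would take
too much space. But a first occurrence of a factor stays one when the factor is prolonged
(`rep_mono`). So the names form a tree: each representative remembers its level of birth and its
representative on the level before, and climbing at most `j` edges recovers every older name.

Sorting and naming take `O(n log n)`, and a divisor `k` takes `O(k + (n / k) log k)`. The sum of the
divisors is at most `n (1 + log n)`. The sum of `log k / k` over the divisors is `O(log n)`
(`exists_sum_log_div_le`): writing `log` as the divisor sum of the von Mangoldt function bounds it
by a product of two sums, each `O(√(log n))`.

The algorithm is written in a language of counted loops, whose semantics is a total function, and is
translated to the machine with constant slowdown (`exec_comp`). Letters are only compared and never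
put into a variable, so the bound on computed values depends on `n` alone. -/

namespace Loops

/-! ### A language of counted loops and its translation to the machine. -/

open WordRAM

/-- Expressions over variables `V` and arrays `A`. -/
inductive Ex (V A : Type) where
  | var (x : V)
  | lit (c : ℕ)
  | bin (o : Op) (e f : Ex V A)
  | get (b : A) (e : Ex V A)
  | cond (c : Cmp) (e f g h : Ex V A)

/-- Programs with assignments, array updates, branching and counted loops. -/
inductive Cmd (V A : Type) where
  | set (x : V) (e : Ex V A)
  | put (b : A) (e f : Ex V A)
  | seq (p q : Cmd V A)
  | ite (c : Cmp) (e f : Ex V A) (p q : Cmd V A)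
  | nop
  | loop (x : V) (e : Ex V A) (p : Cmd V A)

/-- States of a loop program: variables, arrays, a step counter, and the assertion that
no access so far was out of bounds and no computed value too large. -/
@[ext] structure St (V A : Type) where
  v : V → ℕ
  a : A → ℕ → ℕ
  t : ℕ
  ok : Prop

set_option linter.unusedSectionVars false
set_option linter.unusedSimpArgs false

variable {V A : Type} [DecidableEq V] [DecidableEq A]

/-- Assign a value to a variable. -/
def St.setV (s : St V A) (x : V) (e : ℕ) : St V A :=
  { s with v := fun y => if y = x then e else s.v y }

/-- Assign a value to an array entry. -/
def St.setA (s : St V A) (b : A) (i e : ℕ) : St V A :=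
  { s with a := fun c j => if c = b ∧ j = i then e else s.a c j }

/-- Count a step and record a safety condition. -/
def St.tick (s : St V A) (h : Prop) : St V A := { s with t := s.t + 1, ok := s.ok ∧ h }

@[simp] theorem setA_v (s : St V A) (b i e) : (s.setA b i e).v = s.v := rfl
@[simp] theorem setA_t (s : St V A) (b i e) : (s.setA b i e).t = s.t := rfl
@[simp] theorem setA_ok (s : St V A) (b i e) : (s.setA b i e).ok = s.ok := rfl
@[simp] theorem setA_a (s : St V A) (b i e c j) :
    (s.setA b i e).a c j = if c = b ∧ j = i then e else s.a c j := rfl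
@[simp] theorem tick_v (s : St V A) (h) : (s.tick h).v = s.v := rfl
@[simp] theorem tick_a (s : St V A) (h) : (s.tick h).a = s.a := rfl
@[simp] theorem tick_t (s : St V A) (h) : (s.tick h).t = s.t + 1 := rfl
@[simp] theorem tick_ok (s : St V A) (h) : (s.tick h).ok = (s.ok ∧ h) := rfl
@[simp] theorem setV_v (s : St V A) (x e y) :
    (s.setV x e).v y = if y = x then e else s.v y := rfl
@[simp] theorem setV_a (s : St V A) (x e) : (s.setV x e).a = s.a := rfl
@[simp] theorem setV_t (s : St V A) (x e) : (s.setV x e).t = s.t := rfl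
@[simp] theorem setV_ok (s : St V A) (x e) : (s.setV x e).ok = s.ok := rfl
instance (c : Cmp) (a b : ℕ) : Decidable (c.Holds a b) :=
  match c with
  | .lt => Nat.decLt a b
  | .le => Nat.decLe a b
  | .eq => Nat.decEq a b
  | .ne => inferInstanceAs (Decidable (¬ a = b))

/-- The value of an expression. -/
@[simp] def Ex.eval (s : St V A) : Ex V A → ℕ
  | var x => s.v x
  | lit c => c
  | bin o e f => o.eval (e.eval s) (f.eval s)
  | get b e => s.a b (e.eval s)
  | cond c e f g h => if c.Holds (e.eval s) (f.eval s) then g.eval s else h.eval s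

/-- Evaluating the expression stays within arrays of length `Z` and values below `C`. -/
@[simp] def Ex.safe (Z C : ℕ) (s : St V A) : Ex V A → Prop
  | var _ => True
  | lit c => c < C
  | bin o e f => e.safe Z C s ∧ f.safe Z C s ∧ o.eval (e.eval s) (f.eval s) < C
  | get _ e => e.safe Z C s ∧ e.eval s < Z
  | cond c e f g h => e.safe Z C s ∧ f.safe Z C s ∧
      (c.Holds (e.eval s) (f.eval s) → g.safe Z C s) ∧
      (¬ c.Holds (e.eval s) (f.eval s) → h.safe Z C s)

/-- The semantics of loop programs, for array length `Z` and value bound `C`. -/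
def run (Z C : ℕ) : Cmd V A → St V A → St V A
  | .set x e, s => (s.tick (e.safe Z C s ∧ e.eval s < C)).setV x (e.eval s)
  | .put b e f, s => (s.tick (e.safe Z C s ∧ f.safe Z C s ∧ e.eval s < Z)).setA b (e.eval s)
      (f.eval s)
  | .seq p q, s => run Z C q (run Z C p s)
  | .ite c e f p q, s =>
      if c.Holds (e.eval s) (f.eval s) then run Z C p (s.tick (e.safe Z C s ∧ f.safe Z C s))
      else run Z C q (s.tick (e.safe Z C s ∧ f.safe Z C s))
  | .nop, s => s.tick True
  | .loop x e p, s =>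
      Nat.rec (s.tick (e.safe Z C s ∧ e.eval s < C))
        (fun i s' => run Z C p ((s'.tick True).setV x i)) (e.eval s)

/-- The assertion `ok` is accumulated by conjunctions, so it passes from the end of a run to every
earlier state. Safety therefore has to be demanded of the final state only. -/
theorem run_ok_of_le {Z C : ℕ} (p : Cmd V A) (s : St V A) :
    ((run Z C p s).ok → s.ok) ∧ s.t ≤ (run Z C p s).t := by
  induction p generalizing s with
  | set x e => simp only [run, setV_ok, tick_ok, setV_t, tick_t]; exact ⟨fun h => h.1, by omega⟩
  | put b e f => simp only [run, setA_ok, tick_ok, setA_t, tick_t]; exact ⟨fun h => h.1, by omega⟩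
  | seq p q hp hq =>
    exact ⟨fun h => (hp s).1 ((hq _).1 h), (hp s).2.trans (hq _).2⟩
  | ite c e f p q hp hq =>
    simp only [run]
    split_ifs
    · exact ⟨fun h => ((hp _).1 h).1, le_trans (by simp) (hp _).2⟩
    · exact ⟨fun h => ((hq _).1 h).1, le_trans (by simp) (hq _).2⟩
  | nop => exact ⟨fun h => h.1, by simp [run]⟩
  | loop x e p hp =>
    simp only [run]
    generalize (e.safe Z C s ∧ e.eval s < C) = h
    induction e.eval s with
    | zero => exact ⟨fun h => h.1, by simp⟩
    | succ n ih =>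
      refine ⟨fun h => ih.1 ((hp _).1 h).1, ih.2.trans (le_trans ?_ (hp _).2)⟩
      simp

/-! ### Translation to the word RAM -/

/-- Code evaluating an expression into the register `2 * h + 1`, using only odd registers from
there on. -/
def compE (cV : V → ℕ) (cA : A → ℕ) : Ex V A → ℕ → Program
  | .var x, h => .seq (.const (2 * h + 3) 0) (.arith .add (2 * h + 1) (2 * cV x) (2 * h + 3))
  | .lit c, h => .const (2 * h + 1) c
  | .bin o e f, h => .seq (compE cV cA e h) (.seq (compE cV cA f (h + 1))
      (.arith o (2 * h + 1) (2 * h + 1) (2 * h + 3)))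
  | .get b e, h => .seq (compE cV cA e h) (.seq (.const (2 * h + 3) (cA b))
      (.seq (.arith .mul (2 * h + 3) (2 * h + 3) 1)
      (.seq (.arith .add (2 * h + 1) (2 * h + 3) (2 * h + 1)) (.load (2 * h + 1) (2 * h + 1)))))
  | .cond c e f g i, h => .seq (compE cV cA e h) (.seq (compE cV cA f (h + 1))
      (.ite c (2 * h + 1) (2 * h + 3) (compE cV cA g h) (compE cV cA i h)))

/-- A bound for the number of steps of `compE`. -/
def costE : Ex V A → ℕ
  | .var _ => 2
  | .lit _ => 1
  | .bin _ e f => costE e + (costE f + 1)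
  | .get _ e => costE e + 4
  | .cond _ e f g h => costE e + (costE f + (1 + (costE g + costE h)))

/-- Translation of a loop program; odd registers from `2 * h + 1` on are scratch. -/
def comp (cV : V → ℕ) (cA : A → ℕ) : Cmd V A → ℕ → Program
  | .set x e, h => .seq (compE cV cA e h) (.seq (.const (2 * h + 3) 0)
      (.arith .add (2 * cV x) (2 * h + 1) (2 * h + 3)))
  | .put b e f, h => .seq (compE cV cA e h) (.seq (compE cV cA f (h + 1))
      (.seq (.const (2 * h + 5) (cA b)) (.seq (.arith .mul (2 * h + 5) (2 * h + 5) 1)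
      (.seq (.arith .add (2 * h + 1) (2 * h + 5) (2 * h + 1))
        (.store (2 * h + 1) (2 * h + 3))))))
  | .seq p q, h => .seq (comp cV cA p h) (comp cV cA q h)
  | .ite c e f p q, h => .seq (compE cV cA e h) (.seq (compE cV cA f (h + 1))
      (.ite c (2 * h + 1) (2 * h + 3) (comp cV cA p h) (comp cV cA q h)))
  | .nop, _ => .skip
  | .loop x e p, h => .seq (compE cV cA e h) (.seq (.const (2 * h + 3) 0)
      (.while .lt (2 * h + 3) (2 * h + 1)
        (.seq (.const (2 * h + 5) 0) (.seq (.arith .add (2 * cV x) (2 * h + 3) (2 * h + 5))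
          (.seq (comp cV cA p (h + 2)) (.seq (.const (2 * h + 5) 1)
            (.arith .add (2 * h + 3) (2 * h + 3) (2 * h + 5))))))))

/-- Slowdown of the translation. -/
def slow : Cmd V A → ℕ
  | .set _ e => costE e + 2
  | .put _ e f => costE e + costE f + 4
  | .seq p q => slow p + slow q
  | .ite _ e f p q => costE e + costE f + 1 + slow p + slow q
  | .nop => 1
  | .loop _ e p => costE e + 7 + slow p

/-- A machine state represents a state of a loop program. -/
structure Rel (cV : V → ℕ) (cA : A → ℕ) (Z C : ℕ) (s : St V A) (m : State) : Prop where
  reg : ∀ x, m.reg (2 * cV x) = s.v x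
  lt : ∀ x, s.v x < C
  mem : ∀ b i, i < Z → m.mem (cA b * Z + i) = s.a b i
  len : m.reg 1 = Z

/-- The machine states agree except on the scratch registers from `h` on. -/
def Keeps (h : ℕ) (m m' : State) : Prop := ∀ r, r < 2 * h + 1 ∨ r % 2 = 0 → m'.reg r = m.reg r

theorem Keeps.trans {h h' : ℕ} {m m' m'' : State} (h₁ : Keeps h m m') (h₂ : Keeps h' m' m'')
    (hh : h ≤ h') : Keeps h m m'' := fun r hr => by
  rw [h₂ r (by omega), h₁ r hr]

theorem Rel.keeps {cV : V → ℕ} {cA : A → ℕ} {Z C : ℕ} {s : St V A} {m m' : State} {h : ℕ}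
    (hr : Rel cV cA Z C s m) (hk : Keeps h m m') (hh : 1 ≤ h) (hm : m'.mem = m.mem) :
    Rel cV cA Z C s m' where
  reg x := by rw [hk _ (by omega), hr.reg]
  lt := hr.lt
  mem := by rw [hm]; exact hr.mem
  len := by rw [hk _ (by omega), hr.len]

theorem Keeps.set {h r v : ℕ} {m : State} (hr : 2 * h + 1 ≤ r) (hr' : r % 2 = 1) :
    Keeps h m (m.setReg r v) := fun r' h' => by
  simp only [State.setReg]
  rw [Function.update_of_ne]
  omega

/-- The machine is large enough for the translation. -/
structure Fits {A : Type} (cA : A → ℕ) (Z C K w M : ℕ) : Prop where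
  cA_lt : ∀ b, cA b < K
  mem_le : K * Z ≤ M
  K_le : K ≤ 2 ^ w
  M_le : K * Z ≤ 2 ^ w
  C_le : C ≤ 2 ^ w

theorem Fits.addr {cA : A → ℕ} {Z C K w M : ℕ} (hf : Fits cA Z C K w M) (b : A) {i : ℕ}
    (hi : i < Z) : cA b * Z + i < K * Z := by
  have := hf.cA_lt b
  calc cA b * Z + i < cA b * Z + Z := by omega
    _ = (cA b + 1) * Z := by ring
    _ ≤ K * Z := Nat.mul_le_mul_right _ this

theorem setReg_reg (m : State) (r v r' : ℕ) :
    (m.setReg r v).reg r' = if r' = r then v else m.reg r' := by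
  simp [State.setReg, Function.update_apply]

theorem setReg_mem (m : State) (r v : ℕ) : (m.setReg r v).mem = m.mem := rfl

/-- Registers are used like a stack: a second operand is evaluated with `h + 1`, which protects the
first operand in `2 * h + 1`. The condition `1 ≤ h` protects register `1`, which holds the array
length. Only the chosen branch of a conditional expression is executed, so safety is needed of that
branch alone. -/
theorem exec_compE {cV : V → ℕ} {cA : A → ℕ} {Z C K w M : ℕ} (hf : Fits cA Z C K w M)
    {s : St V A} (e : Ex V A) (h : ℕ) (hh : 1 ≤ h) (m : State) (hr : Rel cV cA Z C s m)
    (hs : e.safe Z C s) :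
    ∃ m' t, Exec w M (compE cV cA e h) m m' t ∧ m'.mem = m.mem ∧
      m'.reg (2 * h + 1) = e.eval s ∧ Keeps h m m' ∧ t ≤ costE e := by
  induction e generalizing h m with
  | var x =>
    have h0 := hr.lt x
    have h1 := hf.C_le
    refine ⟨_, _, .seq (.const _ _ _ (by positivity)) (.arith _ _ _ _ _ ?_), rfl, ?_, ?_, le_rfl⟩
    · simp [setReg_reg, Op.eval, hr.reg, show ¬ 2 * cV x = 2 * h + 3 by omega]; omega
    · simp [setReg_reg, Op.eval, hr.reg, show ¬ 2 * cV x = 2 * h + 3 by omega]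
    · exact (Keeps.set (by omega) (by omega)).trans (Keeps.set (by omega) (by omega)) le_rfl
  | lit c =>
    refine ⟨_, _, .const _ _ _ (lt_of_lt_of_le hs hf.C_le), rfl, ?_, Keeps.set le_rfl (by omega),
      le_rfl⟩
    simp [setReg_reg]
  | bin o e f he hf' =>
    obtain ⟨m₁, t₁, e₁, q₁, v₁, k₁, c₁⟩ := he h hh m hr hs.1
    obtain ⟨m₂, t₂, e₂, q₂, v₂, k₂, c₂⟩ := hf' (h + 1) (by omega) m₁ (hr.keeps k₁ hh q₁) hs.2.1
    have v₁' : m₂.reg (2 * h + 1) = e.eval s := by rw [k₂ _ (by omega), v₁]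
    have v₂' : m₂.reg (2 * h + 3) = f.eval s := v₂
    refine ⟨_, _, .seq e₁ (.seq e₂ (.arith _ _ _ _ _ ?_)), ?_, ?_, ?_, ?_⟩
    · rw [v₁', v₂']; exact lt_of_lt_of_le hs.2.2 hf.C_le
    · rw [setReg_mem, q₂, q₁]
    · simp [setReg_reg, v₁', v₂']
    · exact (k₁.trans k₂ (by omega)).trans (Keeps.set le_rfl (by omega)) le_rfl
    · simp only [costE]; omega
  | get b e he =>
    obtain ⟨m₁, t₁, e₁, q₁, v₁, k₁, c₁⟩ := he h hh m hr hs.1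
    have r₁ := (hr.keeps k₁ hh q₁).len
    have hi := hs.2
    have ha := hf.addr b hi
    have hb := hf.cA_lt b
    have hK := hf.K_le
    have hM := hf.M_le
    have hM' := hf.mem_le
    have ne1 : ¬ 1 = 2 * h + 3 := by omega
    refine ⟨_, _, .seq e₁ (.seq (.const _ _ _ (by omega)) (.seq (.arith _ _ _ _ _ ?_)
      (.seq (.arith _ _ _ _ _ ?_) (.load _ _ _ ?_)))), ?_, ?_, ?_, ?_⟩
    · simp [setReg_reg, Op.eval, r₁, ne1]; omega
    · simp [setReg_reg, Op.eval, r₁, ne1, v₁]; omega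
    · simp [setReg_reg, Op.eval, r₁, ne1, v₁]; omega
    · simp only [setReg_mem, q₁]
    · simp [setReg_reg, Op.eval, r₁, ne1, v₁, setReg_mem, q₁, hr.mem b _ hi]
    · exact ((((k₁.trans (Keeps.set (by omega) (by omega)) le_rfl).trans
        (Keeps.set (by omega) (by omega)) le_rfl).trans
        (Keeps.set (by omega) (by omega)) le_rfl).trans (Keeps.set (by omega) (by omega)) le_rfl)
    · simp only [costE]; omega
  | cond c e f g i he hf' hg hi =>
    obtain ⟨m₁, t₁, e₁, q₁, v₁, k₁, c₁⟩ := he h hh m hr hs.1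
    obtain ⟨m₂, t₂, e₂, q₂, v₂, k₂, c₂⟩ := hf' (h + 1) (by omega) m₁ (hr.keeps k₁ hh q₁) hs.2.1
    have v₁' : m₂.reg (2 * h + 1) = e.eval s := by rw [k₂ _ (by omega), v₁]
    have v₂' : m₂.reg (2 * h + 3) = f.eval s := v₂
    have k : Keeps h m m₂ := k₁.trans k₂ (by omega)
    have r₂ := hr.keeps k hh (q₂.trans q₁)
    have hs3 := hs.2.2
    by_cases hc : c.Holds (e.eval s) (f.eval s)
    · obtain ⟨m₃, t₃, e₃, q₃, v₃, k₃, c₃⟩ := hg h hh m₂ r₂ (hs3.1 hc)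
      refine ⟨m₃, _, .seq e₁ (.seq e₂ (.ite_true (by rwa [v₁', v₂']) e₃)), by rw [q₃, q₂, q₁],
        by simp only [Ex.eval, if_pos hc, v₃], k.trans k₃ le_rfl, ?_⟩
      simp only [costE]; omega
    · obtain ⟨m₃, t₃, e₃, q₃, v₃, k₃, c₃⟩ := hi h hh m₂ r₂ (hs3.2 hc)
      refine ⟨m₃, _, .seq e₁ (.seq e₂ (.ite_false (by rwa [v₁', v₂']) e₃)), by rw [q₃, q₂, q₁],
        by simp only [Ex.eval, if_neg hc, v₃], k.trans k₃ le_rfl, ?_⟩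
      simp only [costE]; omega

/-- The machine has no copy instruction, so a register is copied by adding a register that was set
to zero. This serves both assignments and the update of loop variables. -/
theorem exec_move {cV : V → ℕ} {cA : A → ℕ} {Z C K w M : ℕ} (hf : Fits cA Z C K w M)
    (hV : Function.Injective cV) {s : St V A} (x : V) (h : ℕ) (hh : 1 ≤ h) (r r' e : ℕ)
    (hne : r' ≠ r) (hr' : r' % 2 = 1) (hb : 2 * h + 1 ≤ r')
    (m : State) (hr : Rel cV cA Z C s m) (hv : m.reg r = e) (he : e < C) :
    ∃ m₀ m', Exec w M (.const r' 0) m m₀ 1 ∧ Exec w M (.arith .add (2 * cV x) r r') m₀ m' 1 ∧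
      Rel cV cA Z C (s.setV x e) m' ∧ (∀ i, i % 2 = 1 → i ≠ r' → m'.reg i = m.reg i) := by
  have hC := hf.C_le
  refine ⟨_, _, .const _ _ _ (by positivity), .arith _ _ _ _ _ ?_, ⟨?_, ?_, ?_, ?_⟩, ?_⟩
  · simp [setReg_reg, Op.eval, hne.symm, hv]; omega
  · intro y
    by_cases hy : y = x
    · subst hy; simp [setReg_reg, Op.eval, hne.symm, hv]
    · have : cV y ≠ cV x := fun h => hy (hV h)
      simp [setReg_reg, Op.eval, hy, this, hr.reg, show ¬ 2 * cV y = r' by omega]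
  · intro y; simp only [setV_v]; split_ifs; exacts [he, hr.lt y]
  · exact hr.mem
  · simp [setReg_reg, show ¬ 1 = r' by omega, show ¬ 1 = 2 * cV x by omega, hr.len]
  · intro i hi h'
    simp [setReg_reg, h', show ¬ i = 2 * cV x by omega]

/-- The registers reserved by the enclosing program are kept. -/
def Reserved (h : ℕ) (m m' : State) : Prop := ∀ r, r < 2 * h + 1 → r % 2 = 1 → m'.reg r = m.reg r

/-- The time bound is stated as a difference of step counters multiplied by `slow p`, so that the
bounds of consecutive parts add up. A loop keeps its bound in `2 * h + 1` and its counter in `2 * h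
+ 3`, and runs its body with `h + 2`; hence the body may overwrite the loop variable without
disturbing the count, exactly as in `run`. -/
theorem exec_comp {cV : V → ℕ} {cA : A → ℕ} {Z C K w M : ℕ} (hf : Fits cA Z C K w M)
    (hV : Function.Injective cV) (hA : Function.Injective cA) (h1C : 1 < C)
    (p : Cmd V A) (h : ℕ) (hh : 1 ≤ h) (s : St V A)
    (m : State) (hr : Rel cV cA Z C s m) (hs : (run Z C p s).ok) :
    ∃ m' t, Exec w M (comp cV cA p h) m m' t ∧ Rel cV cA Z C (run Z C p s) m' ∧
      Reserved h m m' ∧ t + slow p * s.t ≤ slow p * (run Z C p s).t := by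
  induction p generalizing h s m with
  | set x e =>
    obtain ⟨m₁, u₁, e₁, q₁, v₁, k₁, d₁⟩ := exec_compE hf e h hh m hr hs.2.1
    obtain ⟨_, m₂, e₂, e₂', r₂, k₂⟩ := exec_move hf hV x h hh (2 * h + 1) (2 * h + 3) _ (by omega)
      (by omega) (by omega) m₁ (hr.keeps k₁ hh q₁) v₁ hs.2.2
    refine ⟨m₂, _, .seq e₁ (.seq e₂ e₂'), ⟨r₂.reg, r₂.lt, r₂.mem, r₂.len⟩, fun r hr hr' => ?_, ?_⟩
    · rw [k₂ r hr' (by omega), k₁ r (Or.inl hr)]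
    · simp only [run, slow, setV_t, tick_t, mul_add, mul_one]; omega
  | put b e f =>
    obtain ⟨hs₁, hs₂, hi⟩ := hs.2
    obtain ⟨m₁, u₁, e₁, q₁, v₁, k₁, d₁⟩ := exec_compE hf e h hh m hr hs₁
    obtain ⟨m₂, u₂, e₂, q₂, v₂, k₂, d₂⟩ := exec_compE hf f (h + 1) (by omega) m₁ (hr.keeps k₁ hh q₁) hs₂
    have v₁' : m₂.reg (2 * h + 1) = e.eval s := by rw [k₂ _ (by omega), v₁]
    have v₂' : m₂.reg (2 * h + 3) = f.eval s := v₂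
    have k : Keeps h m m₂ := k₁.trans k₂ (by omega)
    have r₂ := hr.keeps k hh (q₂.trans q₁)
    have r₁ := r₂.len
    have ha := hf.addr b hi
    have hb := hf.cA_lt b
    have hK := hf.K_le
    have hM := hf.M_le
    have hM' := hf.mem_le
    have ne1 : ¬ 1 = 2 * h + 5 := by omega
    refine ⟨_, _, .seq e₁ (.seq e₂ (.seq (.const _ _ _ (by omega)) (.seq (.arith _ _ _ _ _ ?_)
      (.seq (.arith _ _ _ _ _ ?_) (.store _ _ _ ?_))))), ⟨?_, hr.lt, ?_, ?_⟩, ?_, ?_⟩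
    · simp [setReg_reg, Op.eval, r₁, ne1]; omega
    · simp [setReg_reg, Op.eval, r₁, ne1, v₁']; omega
    · simp [setReg_reg, Op.eval, r₁, ne1, v₁']; omega
    · intro y
      have := r₂.reg y
      simp [State.setMem, setReg_reg, this, show ∀ z, ¬ 2 * cV y = 2 * z + 1 by omega,
        show ¬ 2 * cV y = 2 * h + 5 by omega, run]
    · intro c j hj
      simp only [State.setMem, setReg_reg, setReg_mem, q₂, q₁, run, setA_a, tick_a]
      have := hr.mem c j hj
      simp only [Op.eval, r₁, ne1, v₁', v₂', if_true, if_false, Function.update_apply,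
        show ¬ 2 * h + 3 = 2 * h + 5 by omega, show ¬ 2 * h + 1 = 2 * h + 5 by omega,
        show ¬ 2 * h + 3 = 2 * h + 1 by omega, this]
      -- Arrays occupy disjoint blocks of `Z` cells: dividing an address by `Z` recovers the number
      -- of the array.
      have key : cA c * Z + j = cA b * Z + e.eval s ↔ c = b ∧ j = e.eval s := by
        constructor
        · intro h
          have h1 : (cA c * Z + j) / Z = (cA b * Z + e.eval s) / Z := by rw [h]
          have hZ : 0 < Z := by omega
          rw [mul_comm, Nat.mul_add_div hZ, mul_comm, Nat.mul_add_div hZ, Nat.div_eq_of_lt hj,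
            Nat.div_eq_of_lt hi] at h1
          have h2 : c = b := hA (by omega)
          subst h2
          exact ⟨rfl, by omega⟩
        · rintro ⟨rfl, rfl⟩; rfl
      simp only [key]
    · simp [State.setMem, setReg_reg, r₁, show ¬ h = 0 by omega]
    · intro r hr hr'
      simp [State.setMem, setReg_reg, show ¬ r = 2 * h + 5 by omega,
        show ¬ r = 2 * h + 1 by omega, k r (Or.inl hr)]
    · simp only [run, slow, setA_t, tick_t, mul_add, mul_one]; omega
  | seq p q hp hq =>
    obtain ⟨m₁, t₁, e₁, r₁, k₁, c₁⟩ := hp h hh s m hr ((run_ok_of_le q _).1 hs)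
    obtain ⟨m₂, t₂, e₂, r₂, k₂, c₂⟩ := hq h hh _ m₁ r₁ hs
    refine ⟨m₂, _, .seq e₁ e₂, r₂, fun r h₁ h₂ => by rw [k₂ r h₁ h₂, k₁ r h₁ h₂], ?_⟩
    have t₁ := (run_ok_of_le (Z := Z) (C := C) p s).2
    have t₂ := (run_ok_of_le (Z := Z) (C := C) q (run Z C p s)).2
    simp only [run, slow]
    nlinarith [Nat.mul_le_mul_left (slow p) t₂, Nat.mul_le_mul_left (slow q) t₁]
  | ite c e f p q hp hq =>
    have hs' : e.safe Z C s ∧ f.safe Z C s := by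
      simp only [run] at hs
      split_ifs at hs
      · exact ((run_ok_of_le p _).1 hs).2
      · exact ((run_ok_of_le q _).1 hs).2
    obtain ⟨m₁, u₁, e₁, q₁, v₁, k₁, d₁⟩ := exec_compE hf e h hh m hr hs'.1
    obtain ⟨m₂, u₂, e₂, q₂, v₂, k₂, d₂⟩ := exec_compE hf f (h + 1) (by omega) m₁ (hr.keeps k₁ hh q₁) hs'.2
    have v₁' : m₂.reg (2 * h + 1) = e.eval s := by rw [k₂ _ (by omega), v₁]
    have v₂' : m₂.reg (2 * h + 3) = f.eval s := v₂
    have k : Keeps h m m₂ := k₁.trans k₂ (by omega)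
    have r₂ := hr.keeps k hh (q₂.trans q₁)
    have r₂' : Rel cV cA Z C (s.tick (e.safe Z C s ∧ f.safe Z C s)) m₂ := ⟨r₂.1, r₂.2, r₂.3, r₂.4⟩
    by_cases hc : c.Holds (e.eval s) (f.eval s)
    · simp only [run, hc, if_true] at hs ⊢
      obtain ⟨m₃, t₃, e₃, r₃, k₃, c₃⟩ := hp h hh _ m₂ r₂' hs
      refine ⟨m₃, _, .seq e₁ (.seq e₂ (.ite_true (by rwa [v₁', v₂']) e₃)), r₃,
        fun r h₁ h₂ => by rw [k₃ r h₁ h₂, k r (Or.inl h₁)], ?_⟩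
      have t₁ := (run_ok_of_le (Z := Z) (C := C) p (s.tick (e.safe Z C s ∧ f.safe Z C s))).2
      simp only [slow, tick_t] at *
      nlinarith [Nat.mul_le_mul_left (costE e + costE f + 1 + slow q) t₁]
    · simp only [run, hc, if_false] at hs ⊢
      obtain ⟨m₃, t₃, e₃, r₃, k₃, c₃⟩ := hq h hh _ m₂ r₂' hs
      refine ⟨m₃, _, .seq e₁ (.seq e₂ (.ite_false (by rwa [v₁', v₂']) e₃)), r₃,
        fun r h₁ h₂ => by rw [k₃ r h₁ h₂, k r (Or.inl h₁)], ?_⟩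
      have t₁ := (run_ok_of_le (Z := Z) (C := C) q (s.tick (e.safe Z C s ∧ f.safe Z C s))).2
      simp only [slow, tick_t] at *
      nlinarith [Nat.mul_le_mul_left (costE e + costE f + 1 + slow p) t₁]
  | nop => exact ⟨m, 1, .skip m, ⟨hr.1, hr.2, hr.3, hr.4⟩, fun _ _ _ => rfl, by simp [run, slow]; omega⟩
  | loop x e p hp =>
    simp only [run] at hs ⊢
    set s₀ := s.tick (e.safe Z C s ∧ e.eval s < C) with hs₀
    set N := e.eval s with hN
    set it : ℕ → St V A := fun k => Nat.rec s₀ (fun i s' => run Z C p ((s'.tick True).setV x i)) k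
      with hit
    have it_succ : ∀ k, it (k + 1) = run Z C p (((it k).tick True).setV x k) := fun k => rfl
    change (it N).ok at hs
    change ∃ m' t, _ ∧ Rel cV cA Z C (it N) m' ∧ _ ∧ _ ≤ _ * (it N).t
    have okit : ∀ r, ∀ i, i + r = N → (it i).ok := by
      intro r
      induction r with
      | zero => intro i hi; rw [show i = N by omega]; exact hs
      | succ r ih =>
        intro i hi
        have := ih (i + 1) (by omega)
        rw [it_succ] at this
        exact ((run_ok_of_le p _).1 this).1
    have ok0 := (okit N 0 (by omega)).2
    obtain ⟨m₁, u₁, e₁, q₁, v₁, k₁, d₁⟩ := exec_compE hf e h hh m hr ok0.1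
    have h2 : 2 ≤ 2 ^ w := by have := hf.C_le; omega
    have hNC : N < 2 ^ w := lt_of_lt_of_le ok0.2 hf.C_le
    -- Induction on the number `r` of rounds still to come; the extra step on the right pays for the
    -- last, failing test of the loop condition.
    have main : ∀ r i m, i + r = N → Rel cV cA Z C (it i) m → m.reg (2 * h + 1) = N →
        m.reg (2 * h + 3) = i →
        ∃ m' t, Exec w M (.while .lt (2 * h + 3) (2 * h + 1)
        (.seq (.const (2 * h + 5) 0) (.seq (.arith .add (2 * cV x) (2 * h + 3) (2 * h + 5))
          (.seq (comp cV cA p (h + 2)) (.seq (.const (2 * h + 5) 1)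
            (.arith .add (2 * h + 3) (2 * h + 3) (2 * h + 5))))))) m m' t ∧
          Rel cV cA Z C (it N) m' ∧ Reserved h m m' ∧
          t + slow (.loop x e p) * (it i).t ≤ slow (.loop x e p) * (it N).t + 1 := by
      intro r
      induction r with
      | zero =>
        intro i m hi hr hm hm'
        obtain rfl : i = N := by omega
        refine ⟨m, _, .while_false ?_, hr, fun _ _ _ => rfl, by omega⟩
        simp [Cmp.Holds, hm, hm']
      | succ r ih =>
        intro i m hi hr hm hm'
        have hic : i < C := lt_trans (by omega) ok0.2
        have hr' : Rel cV cA Z C ((it i).tick True) m := ⟨hr.1, hr.2, hr.3, hr.4⟩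
        obtain ⟨_, m₂, e₂, e₂', r₂, k₂⟩ := exec_move hf hV x h hh (2 * h + 3) (2 * h + 5) i (by omega)
          (by omega) (by omega) m hr' hm' hic
        have hok := okit r (i + 1) (by omega)
        rw [it_succ] at hok
        obtain ⟨m₃, t₃, e₃, r₃, k₃, c₃⟩ := hp (h + 2) (by omega) _ m₂ r₂ hok
        rw [← it_succ] at r₃ c₃
        have w₁ : m₃.reg (2 * h + 1) = N := by
          rw [k₃ _ (by omega) (by omega), k₂ _ (by omega) (by omega), hm]
        have w₃ : m₃.reg (2 * h + 3) = i := by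
          rw [k₃ _ (by omega) (by omega), k₂ _ (by omega) (by omega), hm']
        have e₄ : Exec w M (.seq (.const (2 * h + 5) 1)
            (.arith .add (2 * h + 3) (2 * h + 3) (2 * h + 5))) m₃
            ((m₃.setReg (2 * h + 5) 1).setReg (2 * h + 3) (i + 1)) (1 + 1) := by
          have := Exec.arith (w := w) (m := M) (m₃.setReg (2 * h + 5) 1) .add (2 * h + 3)
            (2 * h + 3) (2 * h + 5) (by simp [setReg_reg, Op.eval, w₃]; omega)
          simp only [setReg_reg, Op.eval, w₃, if_true,
            show ¬ 2 * h + 3 = 2 * h + 5 by omega, if_false] at this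
          exact .seq (.const _ _ _ (by omega)) this
        have kk : Keeps h m₃ ((m₃.setReg (2 * h + 5) 1).setReg (2 * h + 3) (i + 1)) :=
          (Keeps.set (by omega) (by omega)).trans (Keeps.set (by omega) (by omega)) le_rfl
        obtain ⟨m₅, t₅, e₅, r₅, k₅, c₅⟩ := ih (i + 1) _ (by omega) (r₃.keeps kk hh rfl)
          (by simp [setReg_reg, w₁]) (by simp [setReg_reg])
        refine ⟨m₅, _, .while_true ?_ (.seq e₂ (.seq e₂' (.seq e₃ e₄))) e₅, r₅, ?_, ?_⟩
        · simp only [Cmp.Holds, hm, hm']; omega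
        · intro r h₁ h₂
          rw [k₅ r h₁ h₂, kk r (Or.inl h₁), k₃ r (by omega) h₂, k₂ r h₂ (by omega)]
        · have t₁ := (run_ok_of_le (Z := Z) (C := C) p (((it i).tick True).setV x i)).2
          rw [← it_succ] at t₁
          simp only [slow, setV_t, tick_t] at *
          nlinarith [Nat.mul_le_mul_left (costE e + 7) t₁]
    obtain ⟨m₂, t₂, e₂, r₂, k₂, c₂⟩ := main N 0 (m₁.setReg (2 * h + 3) 0) (by omega)
      (by
        have := hr.keeps (k₁.trans (Keeps.set (h := h) (r := 2 * h + 3) (v := 0) (by omega)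
          (by omega)) le_rfl) hh q₁
        exact ⟨this.1, this.2, this.3, this.4⟩)
      (by simp [setReg_reg, v₁, hN]) (by simp [setReg_reg])
    refine ⟨m₂, _, .seq e₁ (.seq (.const _ _ _ (by omega)) e₂), r₂, ?_, ?_⟩
    · intro r h₁ h₂
      rw [k₂ r h₁ h₂]
      exact (k₁.trans (Keeps.set (by omega) (by omega)) le_rfl) r (Or.inl h₁)
    · have : (it 0).t = s.t + 1 := rfl
      rw [this] at c₂
      simp only [slow] at *
      nlinarith

/-! ### Notation, framing and a program logic with costs. -/

instance : Add (Ex V A) := ⟨.bin .add⟩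
instance : Sub (Ex V A) := ⟨.bin .sub⟩
instance : Mul (Ex V A) := ⟨.bin .mul⟩
instance : Div (Ex V A) := ⟨.bin .div⟩

infixr:60 " ;; " => Cmd.seq

section simps
variable (s : St V A) (e f : Ex V A) (Z C : ℕ)
@[simp] theorem eval_add : (e + f).eval s = e.eval s + f.eval s := rfl
@[simp] theorem eval_sub : (e - f).eval s = e.eval s - f.eval s := rfl
@[simp] theorem eval_mul : (e * f).eval s = e.eval s * f.eval s := rfl
@[simp] theorem eval_div : (e / f).eval s = e.eval s / f.eval s := rfl
@[simp] theorem safe_add : (e + f).safe Z C s =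
    (e.safe Z C s ∧ f.safe Z C s ∧ e.eval s + f.eval s < C) := rfl
@[simp] theorem safe_sub : (e - f).safe Z C s =
    (e.safe Z C s ∧ f.safe Z C s ∧ e.eval s - f.eval s < C) := rfl
@[simp] theorem safe_mul : (e * f).safe Z C s =
    (e.safe Z C s ∧ f.safe Z C s ∧ e.eval s * f.eval s < C) := rfl
@[simp] theorem safe_div : (e / f).safe Z C s =
    (e.safe Z C s ∧ f.safe Z C s ∧ e.eval s / f.eval s < C) := rfl
@[simp] theorem op_add (a b : ℕ) : Op.add.eval a b = a + b := rfl
@[simp] theorem op_sub (a b : ℕ) : Op.sub.eval a b = a - b := rfl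
@[simp] theorem op_mul (a b : ℕ) : Op.mul.eval a b = a * b := rfl
@[simp] theorem op_div (a b : ℕ) : Op.div.eval a b = a / b := rfl
@[simp] theorem holds_lt (a b : ℕ) : Cmp.lt.Holds a b = (a < b) := rfl
@[simp] theorem holds_le (a b : ℕ) : Cmp.le.Holds a b = (a ≤ b) := rfl
@[simp] theorem holds_eq (a b : ℕ) : Cmp.eq.Holds a b = (a = b) := rfl
variable (x : V) (b : A) (p q : Cmd V A)
theorem run_set : run Z C (.set x e) s =
    (s.tick (e.safe Z C s ∧ e.eval s < C)).setV x (e.eval s) := rfl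
theorem run_seq : run Z C (p ;; q) s = run Z C q (run Z C p s) := rfl
theorem run_nop : run Z C .nop s = s.tick True := rfl
theorem run_ite (c : Cmp) : run Z C (.ite c e f p q) s =
    if c.Holds (e.eval s) (f.eval s) then run Z C p (s.tick (e.safe Z C s ∧ f.safe Z C s))
      else run Z C q (s.tick (e.safe Z C s ∧ f.safe Z C s)) := rfl
end simps

/-- Whether a program may write a variable. -/
def Cmd.wV : Cmd V A → V → Bool
  | .set x _, y => decide (y = x)
  | .put _ _ _, _ => false
  | .seq p q, y => p.wV y || q.wV y
  | .ite _ _ _ p q, y => p.wV y || q.wV y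
  | .nop, _ => false
  | .loop x _ p, y => decide (y = x) || p.wV y

/-- Whether a program may write an array. -/
def Cmd.wA : Cmd V A → A → Bool
  | .set _ _, _ => false
  | .put b _ _, c => decide (c = b)
  | .seq p q, y => p.wA y || q.wA y
  | .ite _ _ _ p q, y => p.wA y || q.wA y
  | .nop, _ => false
  | .loop _ _ p, y => p.wA y

/-- Since `Cmd.wV` is computable, the hypothesis is closed by `rfl` for concrete programs; this is
how all later proofs carry facts across subprograms. -/
theorem run_v {Z C : ℕ} (p : Cmd V A) (s : St V A) {y : V} (h : p.wV y = false) :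
    (run Z C p s).v y = s.v y := by
  induction p generalizing s with
  | set x e => simp only [Cmd.wV, decide_eq_false_iff_not] at h; simp [run, h]
  | put b e f => rfl
  | seq p q hp hq =>
    simp only [Cmd.wV, Bool.or_eq_false_iff] at h
    rw [run_seq, hq _ h.2, hp _ h.1]
  | ite c e f p q hp hq =>
    simp only [Cmd.wV, Bool.or_eq_false_iff] at h
    rw [run_ite]; split_ifs
    · rw [hp _ h.1]; rfl
    · rw [hq _ h.2]; rfl
  | nop => rfl
  | loop x e p hp =>
    simp only [Cmd.wV, Bool.or_eq_false_iff, decide_eq_false_iff_not] at h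
    simp only [run]
    generalize (e.safe Z C s ∧ e.eval s < C) = h'
    induction e.eval s with
    | zero => rfl
    | succ n ih => simp only; rw [hp _ h.2]; simpa [h.1] using ih

theorem run_a {Z C : ℕ} (p : Cmd V A) (s : St V A) {b : A} (h : p.wA b = false) :
    (run Z C p s).a b = s.a b := by
  induction p generalizing s with
  | set x e => rfl
  | put c e f =>
    simp only [Cmd.wA, decide_eq_false_iff_not] at h
    funext j; simp [run, h]
  | seq p q hp hq =>
    simp only [Cmd.wA, Bool.or_eq_false_iff] at h
    rw [run_seq, hq _ h.2, hp _ h.1]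
  | ite c e f p q hp hq =>
    simp only [Cmd.wA, Bool.or_eq_false_iff] at h
    rw [run_ite]; split_ifs
    · rw [hp _ h.1]; rfl
    · rw [hq _ h.2]; rfl
  | nop => rfl
  | loop x e p hp =>
    simp only [Cmd.wA] at h
    simp only [run]
    generalize (e.safe Z C s ∧ e.eval s < C) = h'
    induction e.eval s with
    | zero => rfl
    | succ n ih => simp only; rw [hp _ h]; exact ih

/-- The variables and arrays not written by `p` agree in the two states. -/
structure Frame (p : Cmd V A) (s s' : St V A) : Prop where
  v : ∀ y, p.wV y = false → s'.v y = s.v y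
  a : ∀ b, p.wA b = false → s'.a b = s.a b

theorem frame_run {Z C : ℕ} (p : Cmd V A) (s : St V A) : Frame p s (run Z C p s) :=
  ⟨fun _ h => run_v p s h, fun _ h => run_a p s h⟩

/-- `p` started in `s` does nothing illegal and takes at most `c` steps. -/
def Safe (Z C : ℕ) (p : Cmd V A) (s : St V A) (c : ℕ) : Prop :=
  s.ok → (run Z C p s).ok ∧ (run Z C p s).t ≤ s.t + c

theorem Safe.seq {Z C : ℕ} {p q : Cmd V A} {s : St V A} {c d : ℕ} (hp : Safe Z C p s c)
    (hq : Safe Z C q (run Z C p s) d) : Safe Z C (p ;; q) s (c + d) := fun h => by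
  have h₁ := hp h
  have h₂ := hq h₁.1
  rw [run_seq]
  exact ⟨h₂.1, by omega⟩

theorem Safe.mono {Z C : ℕ} {p : Cmd V A} {s : St V A} {c d : ℕ} (hp : Safe Z C p s c)
    (h : c ≤ d) : Safe Z C p s d := fun h' => ⟨(hp h').1, (hp h').2.trans (by omega)⟩

theorem Safe.set {Z C : ℕ} {x : V} {e : Ex V A} {s : St V A} (h : e.safe Z C s)
    (h' : e.eval s < C) : Safe Z C (.set x e) s 1 := fun ok => ⟨⟨ok, h, h'⟩, le_rfl⟩

theorem Safe.put {Z C : ℕ} {b : A} {e f : Ex V A} {s : St V A} (h : e.safe Z C s)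
    (h' : f.safe Z C s) (hZ : e.eval s < Z) : Safe Z C (.put b e f) s 1 :=
  fun ok => ⟨⟨ok, h, h', hZ⟩, le_rfl⟩

theorem Safe.nop {Z C : ℕ} {s : St V A} : Safe Z C .nop s 1 := fun ok => ⟨⟨ok, trivial⟩, le_rfl⟩

/-- Invariant rule for loops, with a bound for the cost of each round. -/
theorem run_loop_sum {Z C : ℕ} {x : V} {e : Ex V A} {p : Cmd V A} {s₀ : St V A}
    (I : ℕ → St V A → Prop) (c : ℕ → ℕ)
    (hs : e.safe Z C s₀) (hC : e.eval s₀ < C) (h₀ : I 0 s₀)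
    (step : ∀ i < e.eval s₀, ∀ s, Frame (.loop x e p) s₀ s → s.v x = i → I i s →
      Safe Z C p s (c i) ∧ I (i + 1) (run Z C p s))
    (hI : ∀ i s w h, I i s → I i ((s.tick h).setV x w) := by intro _ _ _ _ h; exact h) :
    Safe Z C (.loop x e p) s₀ (1 + ∑ i ∈ Finset.range (e.eval s₀), (c i + 1)) ∧
      I (e.eval s₀) (run Z C (.loop x e p) s₀) := by
  -- Before the first round the state has been ticked but the loop variable has not been set, while
  -- `hI` covers only a tick followed by an assignment. This is the reason for the second
  -- alternative; it is removed by assigning to `x` the value it already has.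
  have key : ∀ k ≤ e.eval s₀, ∀ s' : St V A,
      s' = Nat.rec (s₀.tick (e.safe Z C s₀ ∧ e.eval s₀ < C))
        (fun i s' => run Z C p ((s'.tick True).setV x i)) k →
      Frame (.loop x e p) s₀ s' ∧ (I k s' ∨ (k = 0 ∧ s' = s₀.tick (e.safe Z C s₀ ∧ e.eval s₀ < C)))
        ∧ (s₀.ok → s'.ok ∧ s'.t ≤ s₀.t + (1 + ∑ i ∈ Finset.range k, (c i + 1))) := by
    intro k
    induction k with
    | zero =>
      rintro - s' rfl
      exact ⟨⟨fun _ _ => rfl, fun _ _ => rfl⟩, Or.inr ⟨rfl, rfl⟩, fun h => ⟨⟨h, hs, hC⟩, by simp⟩⟩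
    | succ k ih =>
      rintro hk s' rfl
      obtain ⟨hf, hi, ht⟩ := ih (by omega) _ rfl
      set s₁ : St V A := Nat.rec (s₀.tick (e.safe Z C s₀ ∧ e.eval s₀ < C))
        (fun i s' => run Z C p ((s'.tick True).setV x i)) k with hs₁
      have hi' : I k ((s₁.tick True).setV x k) := by
        rcases hi with hi | ⟨rfl, hi⟩
        · exact hI _ _ _ _ hi
        · rw [hi]
          have := hI 0 s₀ 0 True h₀
          exact hI 0 ((s₀.tick (e.safe Z C s₀ ∧ e.eval s₀ < C))) 0 True (by
            have h2 := hI 0 s₀ (s₀.v x) (e.safe Z C s₀ ∧ e.eval s₀ < C) h₀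
            convert h2 using 1
            ext y
            · simp only [setV_v, tick_v]; split_ifs with h; rw [h]; rfl
            all_goals rfl)
      have hf' : Frame (.loop x e p) s₀ ((s₁.tick True).setV x k) := by
        refine ⟨fun y hy => ?_, hf.a⟩
        have : y ≠ x := by rintro rfl; simp [Cmd.wV] at hy
        simp [this, hf.v y hy]
      obtain ⟨h1, h2⟩ := step k (by omega) _ hf' (by simp) hi'
      refine ⟨⟨fun y hy => ?_, fun b hb => ?_⟩, Or.inl h2, fun ok => ?_⟩
      · rw [run_v p _ (by simp [Cmd.wV] at hy; exact hy.2), hf'.v y hy]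
      · rw [run_a p _ (by simpa [Cmd.wA] using hb), hf'.a b hb]
      · obtain ⟨a, b⟩ := ht ok
        have := h1 ⟨a, trivial⟩
        simp only [setV_t, tick_t] at this
        rw [Finset.sum_range_succ]
        refine ⟨this.1, ?_⟩
        change (run Z C p ((s₁.tick True).setV x k)).t ≤ _
        omega
  obtain ⟨-, h1, h2⟩ := key _ le_rfl _ rfl
  refine ⟨h2, ?_⟩
  rcases h1 with h1 | ⟨h1, h3⟩
  · exact h1
  · simp only [run]
    rw [h3, h1]
    have h4 := hI 0 s₀ (s₀.v x) (e.safe Z C s₀ ∧ e.eval s₀ < C) h₀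
    convert h4 using 1
    ext y
    · simp only [setV_v, tick_v]; split_ifs with h; rw [h]; rfl
    · rw [h1]; rfl
    · rfl
    · rw [h1]; rfl

/-- Invariant rule for loops, with a uniform bound for the cost of a round. -/
theorem run_loop {Z C : ℕ} {x : V} {e : Ex V A} {p : Cmd V A} {s₀ : St V A}
    (I : ℕ → St V A → Prop) (N c : ℕ) (hN : e.eval s₀ = N)
    (hs : e.safe Z C s₀) (hC : N < C) (h₀ : I 0 s₀)
    (step : ∀ i < N, ∀ s, Frame (.loop x e p) s₀ s → s.v x = i → I i s →
      Safe Z C p s c ∧ I (i + 1) (run Z C p s))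
    (hI : ∀ i s w h, I i s → I i ((s.tick h).setV x w) := by intro _ _ _ _ h; exact h) :
    Safe Z C (.loop x e p) s₀ (1 + N * (c + 1)) ∧ I N (run Z C (.loop x e p) s₀) := by
  subst hN
  have := run_loop_sum I (fun _ => c) hs hC h₀ step hI
  simpa using this

/-! ### Specifications -/

/-- `p` started in `s` is safe, takes at most `c` steps and establishes `Q`. -/
def WP (Z C : ℕ) (p : Cmd V A) (s : St V A) (c : ℕ) (Q : St V A → Prop) : Prop :=
  Safe Z C p s c ∧ Q (run Z C p s)

section WP
variable {Z C : ℕ} {s : St V A} {p q : Cmd V A} {c d : ℕ} {Q R : St V A → Prop}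

theorem WP.mono (h : WP Z C p s c R) (hc : c ≤ d)
    (hQ : ∀ s', Frame p s s' → R s' → Q s') : WP Z C p s d Q :=
  ⟨h.1.mono hc, hQ _ (frame_run p s) h.2⟩

theorem WP.cost (h : WP Z C p s c Q) (hc : c ≤ d) : WP Z C p s d Q := ⟨h.1.mono hc, h.2⟩

theorem WP.seq (h : WP Z C p s c R) (hq : ∀ s', Frame p s s' → R s' → WP Z C q s' d Q) :
    WP Z C (p ;; q) s (c + d) Q :=
  have := hq _ (frame_run p s) h.2
  ⟨h.1.seq this.1, this.2⟩

theorem WP.nop (h : ∀ s', s'.v = s.v → s'.a = s.a → Q s') : WP Z C .nop s 1 Q :=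
  ⟨.nop, h _ rfl rfl⟩

theorem WP.set {x : V} {e : Ex V A} (h : e.safe Z C s ∧ e.eval s < C)
    (hQ : ∀ s', s'.v x = e.eval s → (∀ y, y ≠ x → s'.v y = s.v y) → s'.a = s.a → Q s') :
    WP Z C (.set x e) s 1 Q :=
  ⟨.set h.1 h.2, hQ _ (by simp [run]) (fun y hy => by simp [run, hy]) rfl⟩

theorem WP.put {b : A} {e f : Ex V A} (h : e.safe Z C s ∧ f.safe Z C s ∧ e.eval s < Z)
    (hQ : ∀ s', s'.v = s.v → s'.a b = Function.update (s.a b) (e.eval s) (f.eval s) →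
      (∀ b', b' ≠ b → s'.a b' = s.a b') → Q s') : WP Z C (.put b e f) s 1 Q :=
  ⟨.put h.1 h.2.1 h.2.2, hQ _ rfl (by funext j; simp [run, Function.update_apply])
    (fun c hc => by funext j; simp [run, hc])⟩

theorem WP.set_seq {x : V} {e : Ex V A} (h : e.safe Z C s ∧ e.eval s < C)
    (hQ : ∀ s', s'.v x = e.eval s → (∀ y, y ≠ x → s'.v y = s.v y) → s'.a = s.a →
      WP Z C q s' d Q) : WP Z C (.set x e ;; q) s (1 + d) Q :=
  WP.seq (WP.set (Q := fun s' => s'.v x = e.eval s ∧ (∀ y, y ≠ x → s'.v y = s.v y) ∧ s'.a = s.a)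
    h fun _ a b c => ⟨a, b, c⟩) fun s' _ h => hQ s' h.1 h.2.1 h.2.2

theorem WP.put_seq {b : A} {e f : Ex V A} (h : e.safe Z C s ∧ f.safe Z C s ∧ e.eval s < Z)
    (hQ : ∀ s', s'.v = s.v → s'.a b = Function.update (s.a b) (e.eval s) (f.eval s) →
      (∀ b', b' ≠ b → s'.a b' = s.a b') → WP Z C q s' d Q) : WP Z C (.put b e f ;; q) s (1 + d) Q :=
  WP.seq (WP.put (Q := fun s' => s'.v = s.v ∧
      s'.a b = Function.update (s.a b) (e.eval s) (f.eval s) ∧ (∀ b', b' ≠ b → s'.a b' = s.a b'))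
    h fun _ a b c => ⟨a, b, c⟩) fun s' _ h => hQ s' h.1 h.2.1 h.2.2

theorem WP.ite {o : Cmp} {e f : Ex V A} (h : e.safe Z C s ∧ f.safe Z C s)
    (hp : o.Holds (e.eval s) (f.eval s) → ∀ s', s'.v = s.v → s'.a = s.a → WP Z C p s' c Q)
    (hq : ¬ o.Holds (e.eval s) (f.eval s) → ∀ s', s'.v = s.v → s'.a = s.a → WP Z C q s' c Q) :
    WP Z C (.ite o e f p q) s (1 + c) Q := by
  by_cases hc : o.Holds (e.eval s) (f.eval s)
  · have := hp hc (s.tick (e.safe Z C s ∧ f.safe Z C s)) rfl rfl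
    refine ⟨fun ok => ?_, ?_⟩
    · rw [run_ite, if_pos hc]
      have h2 := this.1 ⟨ok, h⟩
      simp only [tick_t] at h2
      exact ⟨h2.1, by omega⟩
    · rw [run_ite, if_pos hc]; exact this.2
  · have := hq hc (s.tick (e.safe Z C s ∧ f.safe Z C s)) rfl rfl
    refine ⟨fun ok => ?_, ?_⟩
    · rw [run_ite, if_neg hc]
      have h2 := this.1 ⟨ok, h⟩
      simp only [tick_t] at h2
      exact ⟨h2.1, by omega⟩
    · rw [run_ite, if_neg hc]; exact this.2

theorem WP.loop_sum {x : V} {e : Ex V A} (I : ℕ → St V A → Prop) (N : ℕ) (c : ℕ → ℕ)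
    (hN : e.eval s = N) (hs : e.safe Z C s) (hC : N < C) (h₀ : I 0 s)
    (step : ∀ i < N, ∀ s', Frame (.loop x e p) s s' → s'.v x = i → I i s' →
      WP Z C p s' (c i) (I (i + 1)))
    (hI : ∀ i s w h, I i s → I i ((s.tick h).setV x w) := by intro _ _ _ _ h; exact h) :
    WP Z C (.loop x e p) s (1 + ∑ i ∈ Finset.range N, (c i + 1)) (I N) := by
  subst hN
  exact run_loop_sum I c hs hC h₀ step hI

theorem WP.loop {x : V} {e : Ex V A} (I : ℕ → St V A → Prop) (N c : ℕ)
    (hN : e.eval s = N) (hs : e.safe Z C s) (hC : N < C) (h₀ : I 0 s)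
    (step : ∀ i < N, ∀ s', Frame (.loop x e p) s s' → s'.v x = i → I i s' →
      WP Z C p s' c (I (i + 1)))
    (hI : ∀ i s w h, I i s → I i ((s.tick h).setV x w) := by intro _ _ _ _ h; exact h) :
    WP Z C (.loop x e p) s (1 + N * (c + 1)) (I N) :=
  run_loop I N c hN hs hC h₀ step hI

end WP

end Loops

namespace Loops

/-! ### Factors of a sequence -/

/-- The factors of length `L` at `p` and `q` coincide. -/
def Agree (X : ℕ → ℕ) (p q L : ℕ) : Prop := ∀ i < L, X (p + i) = X (q + i)

section Agree
variable {X : ℕ → ℕ} {p q r L : ℕ}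

theorem Agree.refl (X : ℕ → ℕ) (p L : ℕ) : Agree X p p L := fun _ _ => rfl

theorem Agree.symm (h : Agree X p q L) : Agree X q p L := fun i hi => (h i hi).symm

theorem Agree.trans (h : Agree X p q L) (h' : Agree X q r L) : Agree X p r L :=
  fun i hi => (h i hi).trans (h' i hi)

theorem Agree.mono {L' : ℕ} (h : Agree X p q L) (hL : L' ≤ L) : Agree X p q L' :=
  fun i hi => h i (by omega)

theorem agree_add {L M : ℕ} :
    Agree X p q (L + M) ↔ Agree X p q L ∧ Agree X (p + L) (q + L) M := by
  refine ⟨fun h => ⟨h.mono (by omega), fun i hi => ?_⟩, fun h i hi => ?_⟩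
  · have := h (L + i) (by omega)
    simpa [add_assoc] using this
  · by_cases hL : i < L
    · exact h.1 i hL
    · have := h.2 (i - L) (by omega)
      rwa [show p + L + (i - L) = p + i by omega, show q + L + (i - L) = q + i by omega] at this

theorem agree_two_pow_succ {j : ℕ} : Agree X p q (2 ^ (j + 1)) ↔
    Agree X p q (2 ^ j) ∧ Agree X (p + 2 ^ j) (q + 2 ^ j) (2 ^ j) := by
  rw [← agree_add, pow_succ, mul_two]

/-- Two overlapping pieces cover a factor. -/
theorem agree_iff_cover {M : ℕ} (h₁ : M ≤ L) (h₂ : L ≤ 2 * M) : Agree X p q L ↔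
    Agree X p q M ∧ Agree X (p + (L - M)) (q + (L - M)) M := by
  refine ⟨fun h => ⟨h.mono h₁, fun i hi => ?_⟩, fun h i hi => ?_⟩
  · have := h (L - M + i) (by omega)
    simpa [add_assoc] using this
  · by_cases hL : i < M
    · exact h.1 i hL
    · have := h.2 (i - (L - M)) (by omega)
      rwa [show p + (L - M) + (i - (L - M)) = p + i by omega,
        show q + (L - M) + (i - (L - M)) = q + i by omega] at this

end Agree

/-- The first position of the factor of length `2 ^ j` at `p`. -/
noncomputable def cls (X : ℕ → ℕ) (j p : ℕ) : ℕ :=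
  open Classical in Nat.find (⟨p, Agree.refl X p (2 ^ j)⟩ : ∃ q, Agree X q p (2 ^ j))

section cls
variable (X : ℕ → ℕ) {i j p q : ℕ}

theorem cls_agree (j p : ℕ) : Agree X (cls X j p) p (2 ^ j) := by
  classical
  exact Nat.find_spec (⟨p, Agree.refl X p (2 ^ j)⟩ : ∃ q, Agree X q p (2 ^ j))

variable {X}

theorem cls_le_of_agree (h : Agree X q p (2 ^ j)) : cls X j p ≤ q := by
  classical
  exact Nat.find_min' (⟨p, Agree.refl X p (2 ^ j)⟩ : ∃ q, Agree X q p (2 ^ j)) h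

theorem cls_le : cls X j p ≤ p := cls_le_of_agree (Agree.refl _ _ _)

theorem cls_eq_iff : cls X j p = cls X j q ↔ Agree X p q (2 ^ j) := by
  refine ⟨fun h => (cls_agree X j p).symm.trans (h ▸ cls_agree X j q), fun h => ?_⟩
  exact le_antisymm (cls_le_of_agree ((cls_agree X j q).trans h.symm))
    (cls_le_of_agree ((cls_agree X j p).trans h))

theorem cls_eq_of_le (h : i ≤ j) : cls X i (cls X j p) = cls X i p :=
  cls_eq_iff.2 ((cls_agree X j p).mono (Nat.pow_le_pow_right (by norm_num) h))

theorem cls_mono (h : i ≤ j) : cls X i p ≤ cls X j p := by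
  rw [← cls_eq_of_le h]; exact cls_le

/-- First occurrences can only move to the right when the factor is prolonged. Representatives are
thus born at some level and persist from then on, which makes the history of the names a tree. -/
theorem rep_mono (h : i ≤ j) (hp : cls X i p = p) : cls X j p = p :=
  le_antisymm cls_le (hp.ge.trans (cls_mono h))

theorem cls_succ_eq_iff : cls X (j + 1) p = cls X (j + 1) q ↔
    cls X j p = cls X j q ∧ cls X j (p + 2 ^ j) = cls X j (q + 2 ^ j) := by
  simp only [cls_eq_iff, agree_two_pow_succ]

theorem cls_zero_eq_iff : cls X 0 p = cls X 0 q ↔ X p = X q := by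
  rw [cls_eq_iff]
  exact ⟨fun h => h 0 (by norm_num), fun h i hi => by
    obtain rfl : i = 0 := by simpa using hi
    exact h⟩

/-- A least position with the value of `cls` at `p`. -/
theorem cls_unique {c : ℕ} (h : cls X j c = cls X j p) (hm : ∀ q < c, cls X j q ≠ cls X j p) :
    cls X j p = c := by
  apply le_antisymm
  · rw [← h]; exact cls_le
  · by_contra hlt
    exact hm _ (not_le.1 hlt) (cls_eq_of_le le_rfl)

end cls

/-- `X` is a word of length `n`, padded by zeros. -/
def IsWord (X : ℕ → ℕ) (n : ℕ) : Prop := ∀ i, X i = 0 ↔ n ≤ i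

section IsWord
variable {X : ℕ → ℕ} {n j p q L : ℕ} (hX : IsWord X n)
include hX

/-- Past the end only padding is read, and no position before `n` starts with the padding symbol. So
`n` names all positions out of range. -/
theorem IsWord.cls_of_le (h : n ≤ p) : cls X j p = n := by
  apply cls_unique
  · rw [cls_eq_iff]; intro i hi
    rw [(hX _).2 (by omega), (hX _).2 (by omega)]
  · intro q hq h'
    have := cls_eq_iff.1 h' 0 (by positivity)
    simp only [add_zero] at this
    rw [(hX p).2 h, hX] at this
    omega

/-- A factor inside the word contains no padding, so neither does any of its occurrences. -/
theorem IsWord.add_le_of_agree (h : Agree X p q L) (hp : p + L ≤ n) (hL : 0 < L) : q + L ≤ n := by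
  have := h (L - 1) (by omega)
  by_contra hc
  rw [(hX (q + (L - 1))).2 (by omega), hX] at this
  omega

end IsWord

/-! ### Periods -/

/-- Euclid's algorithm for periods of a finite factor. -/
theorem period_gcd (Y : ℕ → ℕ) (m p q : ℕ) (hp : 0 < p) (hq : 0 < q) (h : p + q ≤ m)
    (h₁ : ∀ i, i + p < m → Y i = Y (i + p)) (h₂ : ∀ i, i + q < m → Y i = Y (i + q)) :
    ∀ i, i + Nat.gcd p q < m → Y i = Y (i + Nat.gcd p q) := by
  induction hs : p + q using Nat.strong_induction_on generalizing p q with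
  | _ s ih =>
    rcases lt_trichotomy p q with hlt | rfl | hlt
    · have h3 : ∀ i, i + (q - p) < m → Y i = Y (i + (q - p)) := by
        intro i hi
        by_cases hi' : i + q < m
        · have a := h₂ i hi'
          have b := h₁ (i + (q - p)) (by omega)
          rw [show i + (q - p) + p = i + q by omega] at b
          rw [a, b]
        -- Too close to the right end for a step of `q`, hence far enough from the left end to step
        -- back by `p` first, because `p + q ≤ m`.
        · have a := h₁ (i - p) (by omega)
          have b := h₂ (i - p) (by omega)
          rw [show i - p + p = i by omega] at a
          rw [show i - p + q = i + (q - p) by omega] at b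
          rw [← a, b]
      have := ih (p + (q - p)) (by omega) p (q - p) hp (by omega) (by omega) h₁ h3 rfl
      rwa [Nat.gcd_sub_self_right hlt.le] at this
    · simpa using h₁
    · have h3 : ∀ i, i + (p - q) < m → Y i = Y (i + (p - q)) := by
        intro i hi
        by_cases hi' : i + p < m
        · have a := h₁ i hi'
          have b := h₂ (i + (p - q)) (by omega)
          rw [show i + (p - q) + q = i + p by omega] at b
          rw [a, b]
        · have a := h₂ (i - q) (by omega)
          have b := h₁ (i - q) (by omega)
          rw [show i - q + q = i by omega] at a
          rw [show i - q + p = i + (p - q) by omega] at b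
          rw [← a, b]
      have := ih ((p - q) + q) (by omega) (p - q) q (by omega) hq (by omega) h3 h₂ rfl
      rwa [Nat.gcd_sub_self_left hlt.le] at this

/-- Close consecutive occurrences of a factor are at the distance of a short period. -/
theorem gap_eq_period {X : ℕ → ℕ} {t m p g : ℕ} (hp : 0 < p) (hpg : p ≤ g) (hm : p + g ≤ m)
    (hper : Agree X t (t + p) (m - p)) (hocc : Agree X t (t + g) m)
    (hno : ∀ u, t < u → u < t + g → ¬ Agree X t u m) : g = p := by
  have h₁ : ∀ i, i + p < m → X (t + i) = X (t + (i + p)) := fun i hi => by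
    have := hper i (by omega)
    rw [this]; congr 1; omega
  have h₂ : ∀ i, i + g < m → X (t + i) = X (t + (i + g)) := fun i hi => by
    have := hocc i (by omega)
    rw [this]; congr 1; omega
  have h₃ := period_gcd (fun i => X (t + i)) m p g hp (by omega) hm h₁ h₂
  set c := Nat.gcd p g with hc
  have hcp : c ∣ p := Nat.gcd_dvd_left _ _
  have hcg : c ∣ g := Nat.gcd_dvd_right _ _
  have hc0 : 0 < c := Nat.gcd_pos_of_pos_left _ hp
  have hmul : ∀ k i, i + c * k < m → X (t + i) = X (t + (i + c * k)) := by
    intro k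
    induction k with
    | zero => intro i _; simp
    | succ k ih =>
      intro i hi
      rw [mul_add, mul_one] at *
      rw [ih i (by omega), h₃ _ (by omega)]
      congr 1; omega
  by_contra hne
  have hcle : c ≤ p := Nat.le_of_dvd hp hcp
  -- The gcd `c` is a period too. If `g ≠ p`, then `c ≤ p < g`, and an occurrence at `t + c`
  -- contradicts that `t` and `t + g` are consecutive.
  refine hno (t + c) (by omega) (by omega) fun i hi => ?_
  by_cases hi' : i + c < m
  · have := h₃ i hi'
    rw [this]; congr 1; omega
  -- Beyond the end of the first occurrence the letter is read in the second one, and the remaining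
  -- shift `g - c` is a multiple of the period `c`.
  · have a := hocc (i + c - g) (by omega)
    rw [show t + c + i = t + g + (i + c - g) by omega, ← a]
    obtain ⟨k, hk⟩ : c ∣ g - c := Nat.dvd_sub hcg dvd_rfl
    have b := hmul k (i + c - g) (by omega)
    rw [b]; congr 1; omega

/-- If a cyclic word is rotated so that the run of period `p` around the position `W` is visible
between `A` and `A + k`, then an end of the visible run is (almost) an end of the run. -/
theorem run_ends {U : ℕ → ℕ} {k m p W A l r Tf Tl : ℕ} (hU : ∀ j, U (j + k) = U j)
    (hp : 0 < p) (hpm : p ≤ m) (hW : 2 * k ≤ W) (hl : l < k)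
    (hr' : U (W + m + r) ≠ U (W + m + r - p)) (hr : ∀ d < r, U (W + m + d) = U (W + m + d - p))
    (hl' : U (W - 1 - l) ≠ U (W - 1 - l + p)) (hl'' : ∀ d < l, U (W - 1 - d) = U (W - 1 - d + p))
    (hw : ∀ i, i + p < m → U (W + i) = U (W + i + p))
    (hfW : Tf ≤ W) (hWl : W ≤ Tl)
    (hdf : p ∣ W - Tf) (hdl : p ∣ Tl - W)
    (hch : ∀ j, Tf ≤ j → j + p < Tl + m → U j = U (j + p))
    (hmin : A + p ≤ Tf → ∃ i < m, U (Tf - p + i) ≠ U (Tf + i))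
    (hmax : Tl + p + m ≤ A + k → ∃ i < m, U (Tl + i) ≠ U (Tl + p + i)) :
    Tf = W - p * (l / p) ∨ Tf = W - p * (l / p) + p ∨ Tl = W + p * (r / p) := by
  have per : ∀ j, W - l ≤ j → j + p < W + m + r → U j = U (j + p) := by
    intro j h1 h2
    by_cases h3 : j < W
    · have := hl'' (W - 1 - j) (by omega)
      rwa [show W - 1 - (W - 1 - j) = j by omega] at this
    · by_cases h4 : j + p < W + m
      · have := hw (j - W) (by omega)
        rwa [show W + (j - W) = j by omega] at this
      · have := hr (j + p - W - m) (by omega)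
        rw [show W + m + (j + p - W - m) = j + p by omega, show j + p - p = j by omega] at this
        exact this.symm
  have hA : W - Tf ≤ l := by
    by_contra hc
    exact hl' (hch _ (by omega) (by omega))
  have hB : Tl - W ≤ r := by
    by_contra hc
    have := hch (W + m + r - p) (by omega) (by omega)
    rw [show W + m + r - p + p = W + m + r by omega] at this
    exact hr' this.symm
  obtain ⟨c, hc⟩ := hdf
  obtain ⟨d, hd⟩ := hdl
  have hc1 : c ≤ l / p := (Nat.le_div_iff_mul_le hp).2 (by rw [mul_comm, ← hc]; exact hA)
  have hd1 : d ≤ r / p := (Nat.le_div_iff_mul_le hp).2 (by rw [mul_comm, ← hd]; exact hB)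
  have hlp : p * (l / p) ≤ l := Nat.mul_div_le _ _
  have hrp : p * (r / p) ≤ r := Nat.mul_div_le _ _
  rcases hc1.eq_or_lt with rfl | hc2
  · left; omega
  rcases hd1.eq_or_lt with rfl | hd2
  · right; right; omega
  have hc3 : p * c + p ≤ p * (l / p) := by
    rw [← mul_add_one]; exact Nat.mul_le_mul_left _ hc2
  have hd3 : p * d + p ≤ p * (r / p) := by
    rw [← mul_add_one]; exact Nat.mul_le_mul_left _ hd2
  -- From here on the visible chain falls short of the run on both sides. Since the run continues,
  -- it must be the block boundary that cuts the chain off, on the left here and on the right in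
  -- `hAl`.
  have hAf : Tf < A + p := by
    by_contra hcon
    obtain ⟨i, hi, hne⟩ := hmin (by omega)
    have := per (Tf - p + i) (by omega) (by omega)
    rw [show Tf - p + i + p = Tf + i by omega] at this
    exact hne this
  have hAl : A + k < Tl + p + m := by
    by_contra hcon
    obtain ⟨i, hi, hne⟩ := hmax (by omega)
    have := per (Tl + i) (by omega) (by omega)
    rw [show Tl + i + p = Tl + p + i by omega] at this
    exact hne this
  -- The break to the left of the run reappears after `k` letters, and the run cannot contain this
  -- copy; this bounds its length.
  have hbr : m + r + l + 1 ≤ k + p := by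
    by_contra hcon
    have := per (W - 1 - l + k) (by omega) (by omega)
    rw [hU, show W - 1 - l + k + p = W - 1 - l + p + k by omega, hU] at this
    exact hl' this
  -- The chain nearly fills the block, and the run is only about one period longer than the block.
  -- If at least one period is missing on the right, then less than two periods are missing on the
  -- left, so exactly one occurrence is lost there.
  right; left
  have h5 : p * (l / p) < p * (c + 2) := by rw [mul_add]; omega
  have h6 : l / p < c + 2 := lt_of_mul_lt_mul_left h5 (Nat.zero_le _)
  have h7 : l / p = c + 1 := by omega
  rw [h7, mul_add, mul_one] at *
  omega

end Loops

namespace Loops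

/-! ### Cyclic periodicity of sequences -/

/-- The factor of length `k` at `s` is a rotation of the prefix of length `k`. -/
def RotAt (X : ℕ → ℕ) (k s : ℕ) : Prop := ∃ a < k, ∀ i < k, X (s + i) = X ((a + i) % k)

/-- `k`-cyclic periodicity of the word of length `n` with the letters `X i`. -/
def CycPer (X : ℕ → ℕ) (n k : ℕ) : Prop := k ∣ n ∧ ∀ q < n / k, RotAt X k (q * k)

/-- A rotation wraps around once, so testing it amounts to two comparisons of factors. One of them
may be short, and this is where the logarithmic factor of the running time comes from. -/
theorem agree_rot_iff {X : ℕ → ℕ} {k s a : ℕ} (ha : a < k) :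
    (∀ i < k, X (s + i) = X ((a + i) % k)) ↔
      Agree X s a (k - a) ∧ Agree X (s + (k - a)) 0 a := by
  constructor
  · refine fun h => ⟨fun i hi => ?_, fun i hi => ?_⟩
    · rw [h i (by omega), Nat.mod_eq_of_lt (by omega)]
    · rw [add_assoc, h _ (by omega), show a + (k - a + i) = i + k by omega, Nat.add_mod_right,
        Nat.mod_eq_of_lt (by omega), zero_add]
  · rintro ⟨h₁, h₂⟩ i hi
    by_cases hc : i < k - a
    · rw [h₁ i hc, Nat.mod_eq_of_lt (by omega)]
    · have := h₂ (i - (k - a)) (by omega)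
      rw [show s + (k - a) + (i - (k - a)) = s + i by omega] at this
      rw [this, show a + i = (i - (k - a)) + k by omega, Nat.add_mod_right,
        Nat.mod_eq_of_lt (by omega), zero_add]

theorem mod_of_agree {X : ℕ → ℕ} {s d k : ℕ} (hd : 0 < d) (h : Agree X s (s + d) (k - d)) :
    ∀ i < k, X (s + i) = X (s + i % d) := by
  intro i
  induction i using Nat.strong_induction_on with
  | _ i ih =>
    intro hi
    by_cases hid : i < d
    · rw [Nat.mod_eq_of_lt hid]
    · have := h (i - d) (by omega)
      rw [show s + d + (i - d) = s + i by omega] at this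
      rw [← this, ih (i - d) (by omega) (by omega), ← Nat.mod_eq_sub_mod (by omega)]

/-- Reduction of `k`-cyclic periodicity to a period `d` of the prefix of length `k`. -/
theorem cycPer_iff_of_period {X : ℕ → ℕ} {n k d : ℕ} (hn : k ∣ n) (hk : 0 < k) (hd : 0 < d)
    (hdk : d ∣ k) (h : Agree X 0 d (k - d)) :
    CycPer X n k ↔ CycPer X n d ∧ ∀ q < n / k, Agree X (q * k) (q * k + d) (k - d) := by
  have h0 : ∀ i < k, X i = X (i % d) := by
    have := mod_of_agree (X := X) (s := 0) (k := k) hd (by simpa using h)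
    simpa using this
  obtain ⟨e, rfl⟩ := hdk
  obtain ⟨N, rfl⟩ := hn
  have he : 0 < e := Nat.pos_of_mul_pos_left hk
  have hNk : d * e * N / (d * e) = N := Nat.mul_div_cancel_left _ hk
  have hNd : d * e * N / d = e * N := by rw [mul_assoc, Nat.mul_div_cancel_left _ hd]
  simp only [CycPer, hNk, hNd]
  constructor
  · rintro ⟨-, hr⟩
    -- The prefix of length `k` is a power of its prefix of length `d`, so every rotation of it is
    -- read off by indices modulo `d`.
    have key : ∀ q < N, ∃ a, ∀ i < d * e, X (q * (d * e) + i) = X ((a + i) % d) := by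
      intro q hq
      obtain ⟨a, ha, hai⟩ := hr q hq
      refine ⟨a, fun i hi => ?_⟩
      rw [hai i hi, h0 _ (Nat.mod_lt _ hk), Nat.mod_mod_of_dvd _ (Dvd.intro _ rfl)]
    refine ⟨⟨by rw [mul_assoc]; exact Dvd.intro _ rfl, fun q hq => ?_⟩, fun q hq i hi => ?_⟩
    · obtain ⟨a, ha⟩ := key (q / e) (by rw [Nat.div_lt_iff_lt_mul he, mul_comm]; exact hq)
      refine ⟨a % d, Nat.mod_lt _ hd, fun i hi => ?_⟩
      have hlt : q % e * d + i < d * e := by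
        have := Nat.mod_lt q he
        calc q % e * d + i < q % e * d + d := by omega
          _ = (q % e + 1) * d := by ring
          _ ≤ e * d := Nat.mul_le_mul_right _ this
          _ = d * e := mul_comm _ _
      have := ha _ hlt
      have e1 : q / e * (d * e) + (q % e * d + i) = q * d + i := by
        conv_rhs => rw [← Nat.div_add_mod q e]
        ring
      rw [e1] at this
      rw [this, Nat.mod_add_mod, show a + (q % e * d + i) = a + i + d * (q % e) by ring,
        Nat.add_mul_mod_self_left]
    · obtain ⟨a, ha⟩ := key q hq
      rw [ha i (by omega), add_assoc, ha (d + i) (by omega),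
        show a + (d + i) = a + i + d by ring, Nat.add_mod_right]
  · rintro ⟨⟨-, hr⟩, hp⟩
    refine ⟨Dvd.intro _ rfl, fun q hq => ?_⟩
    obtain ⟨a, ha, hai⟩ := hr (q * e) (by rw [mul_comm]; exact Nat.mul_lt_mul_of_pos_left hq he)
    rw [show q * e * d = q * (d * e) by ring] at hai
    refine ⟨a, lt_of_lt_of_le ha (Nat.le_mul_of_pos_right _ he), fun i hi => ?_⟩
    rw [mod_of_agree hd (hp q hq) i hi, hai _ (Nat.mod_lt _ hd), h0 _ (Nat.mod_lt _ hk),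
      Nat.mod_mod_of_dvd _ (Dvd.intro _ rfl), Nat.add_mod_mod]

/-- A cyclic word with a period shorter than its length has a period dividing its length. -/
theorem exists_dvd_period {X : ℕ → ℕ} {k p : ℕ} (hp : 0 < p) (hpk : p < k)
    (h : ∀ j, X (j % k) = X ((j + p) % k)) :
    ∃ d, d ∣ k ∧ 0 < d ∧ d < k ∧ Agree X 0 d (k - d) := by
  have hg := Nat.gcd_pos_of_pos_left k hp
  have hgp : Nat.gcd p k ≤ p := Nat.gcd_le_left _ hp
  refine ⟨Nat.gcd p k, Nat.gcd_dvd_right _ _, hg, by omega, fun i hi => ?_⟩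
  -- Modulo `k`, some multiple of the cyclic shift `p` is the shift by the gcd of `p` and `k`.
  obtain ⟨c, -, hc⟩ := Nat.exists_mul_mod_eq_gcd (n := p) (k := k) (by omega)
  have hmul : ∀ c j, X (j % k) = X ((j + p * c) % k) := by
    intro c
    induction c with
    | zero => intro j; simp
    | succ c ih => intro j; rw [ih, h, mul_add, mul_one, add_assoc]
  have := hmul c i
  rw [← Nat.add_mod_mod, hc, Nat.mod_eq_of_lt (by omega), Nat.mod_eq_of_lt (by omega)] at this
  rw [zero_add, this, add_comm]

/-- The cut at `a` cannot lie inside both of the disjoint windows at `0` and `m`. The first survives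
if `m ≤ a`, the second otherwise. -/
theorem exists_intact {a k m : ℕ} (ha : a < k) (hm : 2 * m ≤ k) (hm0 : 0 < m) :
    ∃ i < 2, ∃ o, o + m ≤ k ∧ (a + o) % k = i * m := by
  by_cases h : m ≤ a
  · exact ⟨0, by omega, k - a, by omega, by rw [show a + (k - a) = k by omega]; simp⟩
  · exact ⟨1, by omega, m - a, by omega, by
      rw [show a + (m - a) = m by omega, one_mul, Nat.mod_eq_of_lt (by omega)]⟩

/-- The first element of the progression `f, f + p, …` that is at least `s`. -/
def apFirst (f p s : ℕ) : ℕ := if s ≤ f then f else f + (s - f + p - 1) / p * p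

/-- The last element of the progression `f, f + p, …, l` that is at most `e`. -/
def apLast (f l p e : ℕ) : ℕ := if l ≤ e then l else f + (e - f) / p * p

theorem apFirst_spec {f p s : ℕ} (hp : 0 < p) : s ≤ apFirst f p s ∧ f ≤ apFirst f p s ∧
    p ∣ apFirst f p s - f ∧ (apFirst f p s = f ∨ apFirst f p s < s + p) := by
  unfold apFirst
  split_ifs with h
  · simp [h]
  · have h1 := Nat.div_add_mod (s - f + p - 1) p
    have h2 := Nat.mod_lt (s - f + p - 1) hp
    rw [mul_comm] at h1
    refine ⟨by omega, by omega, ?_, by right; omega⟩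
    rw [Nat.add_sub_cancel_left]; exact Dvd.intro_left _ rfl

theorem apLast_spec {f l p e : ℕ} (hp : 0 < p) (hf : f ≤ e) (hl : f ≤ l) (hpl : p ∣ l - f) :
    apLast f l p e ≤ e ∧ f ≤ apLast f l p e ∧ apLast f l p e ≤ l ∧
    p ∣ apLast f l p e - f ∧ (apLast f l p e = l ∨ e < apLast f l p e + p) := by
  unfold apLast
  split_ifs with h
  · simp [h, hl, hpl]
  · have h1 := Nat.div_add_mod (e - f) p
    have h2 := Nat.mod_lt (e - f) hp
    rw [mul_comm] at h1
    refine ⟨by omega, by omega, by omega, ?_, by right; omega⟩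
    rw [Nat.add_sub_cancel_left]; exact Dvd.intro_left _ rfl

/-- A maximal progression, of difference `p`, of occurrences of the factor of length `m` at `w`. -/
structure IsRun (X : ℕ → ℕ) (w m p f l : ℕ) : Prop where
  le : f ≤ l
  dvd : p ∣ l - f
  occ : ∀ t, f ≤ t → t ≤ l → p ∣ t - f → Agree X w t m
  pre : ∀ t, t + p = f → ¬ Agree X w t m
  post : ¬ Agree X w (l + p) m

/-- `l` and `r` count the steps from the window of length `m` at `w` to the ends of its run of
period `p` in the cyclic word given by the prefix of length `k`. -/
structure IsCycRun (X : ℕ → ℕ) (k w m p l r : ℕ) : Prop where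
  l_lt : l < k
  r_ne : X ((w + m + r) % k) ≠ X ((w + m + r - p) % k)
  r_eq : ∀ d < r, X ((w + m + d) % k) = X ((w + m + d - p) % k)
  l_ne : X ((w + k - 1 - l) % k) ≠ X ((w + k - 1 - l + p) % k)
  l_eq : ∀ d < l, X ((w + k - 1 - d) % k) = X ((w + k - 1 - d + p) % k)

/-- One of three alignments finds the rotation. -/
theorem rotation_found {X : ℕ → ℕ} {k m p w l r a o s f e : ℕ} (hp : 0 < p) (hpm : p ≤ m)
    (hwm : w + m ≤ k) (hper : Agree X w (w + p) (m - p)) (hc : IsCycRun X k w m p l r)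
    (ha : a < k) (hs : ∀ i < k, X (s + i) = X ((a + i) % k)) (hok : o + m ≤ k)
    (how : (a + o) % k = w) (hR : IsRun X w m p f e) (hfo : f ≤ s + o) (hoe : s + o ≤ e)
    (hdvd : p ∣ s + o - f) :
    a = (w + k - p * (l / p) + k - (apFirst f p s - s)) % k ∨
    a = (w + k - p * (l / p) + p + k - (apFirst f p s - s)) % k ∨
    a = (w + p * (r / p) + k - (apLast f e p (s + k - m) - s)) % k := by
  obtain ⟨f1, f2, f3, f4⟩ := apFirst_spec (f := f) (s := s) hp
  obtain ⟨e1, e2, e3, e4, e5⟩ := apLast_spec (f := f) (l := e) (e := s + k - m) hp (by omega) hR.le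
    hR.dvd
  set tf := apFirst f p s with htf
  set tl := apLast f e p (s + k - m) with htl
  have hstep : ∀ t t', f ≤ t → f ≤ t' → p ∣ t - f → p ∣ t' - f → t' < t + p → t' ≤ t := by
    intro t t' h1 h2 ⟨c, h3⟩ ⟨c', h4⟩ h5
    have h6 : p * c' < p * (c + 1) := by rw [mul_add]; omega
    have h7 : c' ≤ c := Nat.le_of_lt_succ (lt_of_mul_lt_mul_left h6 (Nat.zero_le _))
    have := Nat.mul_le_mul_left p h7
    omega
  have hfo' : tf ≤ s + o := hstep _ _ hfo f2 hdvd f3 (by omega)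
  have hoe' : s + o ≤ tl := hstep _ _ e2 hfo e4 hdvd (by omega)
  have hsub : ∀ t t', f ≤ t → t ≤ t' → p ∣ t - f → p ∣ t' - f → p ∣ t' - t := by
    intro t t' h1 h2 h3 h4
    rw [show t' - t = (t' - f) - (t - f) by omega]
    exact Nat.dvd_sub h4 h3
  -- The cyclic word is unrolled and the window moved by two turns, so that no truncated subtraction
  -- interferes. In these coordinates the block starts at `A`, which is congruent to `a` modulo `k`.
  set W := w + 2 * k with hW
  set A := W - o with hA
  have hAa : A % k = a := by
    have : (A + o) ≡ (a + o) [MOD k] := by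
      rw [show A + o = w + k * 2 by omega]
      simp only [Nat.ModEq, how, Nat.add_mul_mod_self_left]
      rw [← how, Nat.mod_mod]
    have := Nat.ModEq.add_right_cancel' o this
    rw [this, Nat.mod_eq_of_lt ha]
  set U : ℕ → ℕ := fun j => X (j % k) with hU
  have hUA : ∀ j, A ≤ j → j < A + k → U j = X (s + (j - A)) := by
    intro j h1 h2
    rw [hs _ (by omega), ← hAa, Nat.mod_add_mod, show A + (j - A) = j by omega]
  have hperiod : ∀ t, Agree X w t m → ∀ i, i + p < m → X (t + i) = X (t + p + i) := by
    intro t ht i hi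
    rw [← ht i (by omega), hper i (by omega), add_assoc, ht _ (by omega), add_assoc]
  have hshift : ∀ c j, U (j + k * c) = U j := fun c j => by
    simp only [hU, Nat.add_mul_mod_self_left]
  -- Neighbouring occurrences of the progression overlap or touch, as `p ≤ m`, so the period extends
  -- over their whole union.
  have hch : ∀ y, tf ≤ y → y + p < tl + m → X y = X (y + p) := by
    intro y h1 h2
    by_cases h3 : tl ≤ y
    · have := hperiod tl (hR.occ _ e2 e3 e4) (y - tl) (by omega)
      rwa [show tl + (y - tl) = y by omega, show tl + p + (y - tl) = y + p by omega] at this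
    · have h4 := Nat.div_add_mod (y - f) p
      have h5 := Nat.mod_lt (y - f) hp
      set c := (y - f) / p with hcc
      have d1 : p ∣ f + p * c - f := by rw [Nat.add_sub_cancel_left]; exact Dvd.intro _ rfl
      have d2 : p ∣ f + p * c + p - f := by
        rw [show f + p * c + p - f = p * (c + 1) by rw [mul_add]; omega]; exact Dvd.intro _ rfl
      have h6 : f + p * c + p ≤ tl := hstep _ _ e2 (by omega) e4 d2 (by omega)
      have g1 := hR.occ (f + p * c) (by omega) (by omega) d1 ((y - f) % p) (by omega)
      have g2 := hR.occ (f + p * c + p) (by omega) (by omega) d2 ((y - f) % p) (by omega)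
      rw [g1, show f + p * c + (y - f) % p = y by omega,
        show f + p * c + p + (y - f) % p = y + p by omega] at g2
      exact g2
  have main := run_ends (U := U) (k := k) (m := m) (p := p) (W := W) (A := A) (l := l) (r := r)
    (Tf := A + (tf - s)) (Tl := A + (tl - s)) (fun j => by simpa using hshift 1 j) hp hpm (by omega)
    hc.l_lt ?_ ?_ ?_ ?_ ?_ (by omega) (by omega) ?_ ?_ ?_ ?_ ?_
  · have hlp : p * (l / p) ≤ l := Nat.mul_div_le _ _
    have hl := hc.l_lt
    rcases main with h | h | h
    · left; rw [← hAa]; congr 1; omega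
    · right; left; rw [← hAa]; congr 1; omega
    · right; right
      rw [← hAa, show A = w + p * (r / p) + k - (tl - s) + k by omega, Nat.add_mod_right]
  · rw [show W + m + r = w + m + r + k * 2 by omega,
      show w + m + r + k * 2 - p = w + m + r - p + k * 2 by omega, hshift, hshift]
    exact hc.r_ne
  · intro d hd
    rw [show W + m + d = w + m + d + k * 2 by omega,
      show w + m + d + k * 2 - p = w + m + d - p + k * 2 by omega, hshift, hshift]
    exact hc.r_eq d hd
  · have hl := hc.l_lt
    rw [show W - 1 - l = w + k - 1 - l + k * 1 by omega,
      show w + k - 1 - l + k * 1 + p = w + k - 1 - l + p + k * 1 by omega, hshift, hshift]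
    exact hc.l_ne
  · intro d hd
    have hl := hc.l_lt
    rw [show W - 1 - d = w + k - 1 - d + k * 1 by omega,
      show w + k - 1 - d + k * 1 + p = w + k - 1 - d + p + k * 1 by omega, hshift, hshift]
    exact hc.l_eq d hd
  · intro i hi
    rw [show W + i = w + i + k * 2 by omega,
      show w + i + k * 2 + p = w + i + p + k * 2 by omega, hshift, hshift]
    simp only [hU]
    rw [Nat.mod_eq_of_lt (by omega), Nat.mod_eq_of_lt (by omega), hper i (by omega)]
    congr 1; omega
  · rw [show W - (A + (tf - s)) = s + o - tf by omega]
    exact hsub _ _ f2 hfo' f3 hdvd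
  · rw [show A + (tl - s) - W = tl - (s + o) by omega]
    exact hsub _ _ hfo hoe' hdvd e4
  · intro j h1 h2
    rw [hUA _ (by omega) (by omega), hUA _ (by omega) (by omega), hch _ (by omega) (by omega)]
    congr 1; omega
  · intro h1
    -- If one more step to the left stays inside the block, then the progression was not clipped at
    -- `s`, and maximality of the run excludes a further occurrence.
    have h2 : tf = f := by omega
    have h3 := hR.pre (tf - p) (by omega)
    simp only [Agree, not_forall] at h3
    obtain ⟨i, hi, h4⟩ := h3
    refine ⟨i, hi, ?_⟩
    rw [hUA _ (by omega) (by omega), hUA _ (by omega) (by omega)]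
    rw [show s + (A + (tf - s) - p + i - A) = tf - p + i by omega,
      show s + (A + (tf - s) + i - A) = tf + i by omega,
      ← hR.occ tf f2 (by omega) f3 i hi]
    exact fun h => h4 h.symm
  · intro h1
    have h2 : tl = e := by omega
    have h3 := hR.post
    simp only [Agree, not_forall] at h3
    obtain ⟨i, hi, h4⟩ := h3
    refine ⟨i, hi, ?_⟩
    rw [hUA _ (by omega) (by omega), hUA _ (by omega) (by omega)]
    rw [show s + (A + (tl - s) + p + i - A) = e + p + i by omega,
      show s + (A + (tl - s) + i - A) = tl + i by omega,
      ← hR.occ tl e2 (by omega) e4 i hi]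
    exact h4

/-- A cyclic word without a proper period dividing its length has no break-free step. -/
theorem exists_break {X : ℕ → ℕ} {k p b : ℕ} (hp : 0 < p) (hpk : p < k)
    (hprim : ∀ d, d ∣ k → 0 < d → d < k → ¬ Agree X 0 d (k - d)) :
    ∃ d < k, X ((b + d) % k) ≠ X ((b + d + p) % k) := by
  by_contra! hcon
  obtain ⟨d, h1, h2, h3, h4⟩ := exists_dvd_period (X := X) hp hpk (fun j => by
    have := hcon ((j + (k - b % k)) % k) (Nat.mod_lt _ (by omega))
    have e : (b + (j + (k - b % k)) % k) % k = j % k := by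
      have h5 := Nat.mod_lt b (show 0 < k by omega)
      have h6 := Nat.div_add_mod b k
      rw [Nat.add_mod_mod, show b + (j + (k - b % k)) = j + k * (b / k + 1) by
        rw [mul_add]; omega, Nat.add_mul_mod_self_left]
    rw [e, ← Nat.mod_add_mod (b + _), e, Nat.mod_add_mod] at this
    exact this)
  exact hprim d h1 h2 h3 h4

end Loops

namespace Loops

/-! ### Cyclic periodicity of lists -/

/-- The padded sequence of the letters of a word. -/
def letters {σ : ℕ} (x : List (Fin σ)) (i : ℕ) : ℕ := if h : i < x.length then (x[i] : ℕ) + 1 else 0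

/-- Letters are increased by one, so that zero marks exactly the padding. -/
theorem isWord_letters {σ : ℕ} (x : List (Fin σ)) : IsWord (letters x) x.length := fun i => by
  unfold letters; split_ifs with h <;> simp [h]; omega

theorem getElem_flatten_blocks {α : Type*} {k : ℕ} (us : List (List α))
    (hu : ∀ u ∈ us, u.length = k) : us.flatten.length = us.length * k ∧
    ∀ q (hq : q < us.length) i, i < k → us.flatten[q * k + i]? = us[q][i]? := by
  induction us with
  | nil => simp
  | cons u us ih =>
    have h1 := hu u (by simp)
    obtain ⟨h2, h3⟩ := ih (fun v hv => hu v (by simp [hv]))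
    refine ⟨by simp [h1, h2]; ring, fun q hq i hi => ?_⟩
    rw [List.flatten_cons]
    cases q with
    | zero => simp [List.getElem?_append_left (show i < u.length by omega)]
    | succ q =>
      rw [List.getElem?_append_right (by rw [h1]; nlinarith), h1,
        show (q + 1) * k + i - k = q * k + i by rw [add_mul]; omega]
      simpa using h3 q (by simpa using hq) i hi

theorem exists_blocks {α : Type*} {k : ℕ} (c : ℕ) (x : List α) (hx : x.length = c * k) :
    ∃ us : List (List α), us.flatten = x ∧ us.length = c ∧ ∀ u ∈ us, u.length = k := by
  induction c generalizing x with
  | zero => exact ⟨[], by simp_all [eq_comm]⟩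
  | succ c ih =>
    obtain ⟨us, h1, h2, h3⟩ := ih (x.drop k) (by simp [hx, add_mul])
    refine ⟨x.take k :: us, by simp [h1], by simp [h2], ?_⟩
    simp only [List.mem_cons, forall_eq_or_imp, List.length_take]
    exact ⟨by rw [hx]; apply min_eq_left; nlinarith, h3⟩

/-- Rotation is an equivalence relation, so comparing every block with the first one replaces
comparing all pairs. The bounds on `k` guarantee that there is a first block. -/
theorem isCyclicPeriodic_iff {σ : ℕ} (x : List (Fin σ)) {k : ℕ} (hk : 1 ≤ k)
    (hkn : k ≤ x.length) : IsCyclicPeriodic k x ↔ CycPer (letters x) x.length k := by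
  have hlet : ∀ us : List (List (Fin σ)), us.flatten = x → (∀ u ∈ us, u.length = k) →
      ∀ q (hq : q < us.length) i (hi : i < (us[q]).length),
        letters x (q * k + i) = ((us[q])[i] : ℕ) + 1 := by
    rintro us rfl hu q hq i hi
    have hl := hu _ (List.getElem_mem hq)
    obtain ⟨h1, h2⟩ := getElem_flatten_blocks us hu
    have h3 := h2 q hq i (by omega)
    have h4 : q * k + i < us.flatten.length := by
      rw [h1]
      calc q * k + i < (q + 1) * k := by rw [add_mul]; omega
        _ ≤ _ := Nat.mul_le_mul_right _ hq
    rw [List.getElem?_eq_getElem h4, List.getElem?_eq_getElem hi, Option.some_inj] at h3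
    unfold letters
    rw [dif_pos h4, h3]
  have hlen : ∀ us : List (List (Fin σ)), us.flatten = x → (∀ u ∈ us, u.length = k) →
      x.length = us.length * k := by
    rintro us rfl hu
    exact (getElem_flatten_blocks us hu).1
  have hrot : ∀ us : List (List (Fin σ)), us.flatten = x → ∀ hu : (∀ u ∈ us, u.length = k),
      ∀ (h0 : 0 < us.length) q (hq : q < us.length),
        (us[0] ~r us[q] ↔ RotAt (letters x) k (q * k)) := by
    intro us hx hu h0 q hq
    have l0 := hu _ (List.getElem_mem h0)
    have lq := hu _ (List.getElem_mem hq)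
    have e0 := hlet us hx hu 0 h0
    have eq := hlet us hx hu q hq
    simp only [zero_mul, zero_add] at e0
    constructor
    · rintro ⟨a, ha⟩
      refine ⟨a % k, Nat.mod_lt _ hk, fun i hi => ?_⟩
      rw [eq i (by omega), Nat.mod_add_mod, e0 _ (by rw [l0]; exact Nat.mod_lt _ hk)]
      simp only [← ha, List.getElem_rotate, l0, add_comm]
    · rintro ⟨a, ha, h⟩
      refine ⟨a, List.ext_getElem (by simp [l0, lq]) fun i h1 h2 => ?_⟩
      have := h i (by omega)
      rw [eq i h2, e0 _ (by rw [l0]; exact Nat.mod_lt _ hk)] at this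
      rw [List.getElem_rotate]
      apply Fin.ext
      simp only [l0, add_comm i a]
      omega
  constructor
  · rintro ⟨us, hx, hu, hr⟩
    have hl := hlen us hx hu
    have h0 : 0 < us.length := by
      rcases Nat.eq_zero_or_pos us.length with h | h
      · rw [h] at hl; omega
      · exact h
    refine ⟨⟨us.length, by rw [hl, mul_comm]⟩, fun q hq => ?_⟩
    rw [hl, Nat.mul_div_cancel _ hk] at hq
    exact (hrot us hx hu h0 q hq).1 (hr _ (List.getElem_mem _) _ (List.getElem_mem _))
  · rintro ⟨⟨c, hc⟩, hr⟩
    obtain ⟨us, hx, hl, hu⟩ := exists_blocks (k := k) c x (by rw [hc, mul_comm])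
    have h0 : 0 < us.length := by
      rw [hl]; rcases Nat.eq_zero_or_pos c with h | h
      · subst h; omega
      · exact h
    have key : ∀ u ∈ us, us[0] ~r u := by
      intro u hu'
      obtain ⟨q, hq, rfl⟩ := List.getElem_of_mem hu'
      refine (hrot us hx hu h0 q hq).2 (hr q ?_)
      rw [hc, Nat.mul_div_cancel_left _ hk]; omega
    exact ⟨us, hx, hu, fun u h1 v h2 => (key u h1).symm.trans (key v h2)⟩

end Loops

namespace Loops

open WordRAM

set_option linter.unusedSimpArgs false

/-! ### Variables and arrays of the algorithm -/

/-- The order matters at one place: `vn` has index zero, so it lives in register `0`, where the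
machine receives the length. -/
inductive Var where
  | vn | vlg | vlev | vm | vo | vu | vwd | vwd2 | vlo | vmid | vhi | vpi | vpj | vc | va | vb | vi
  | vw | vg | vp | vhas | vprev | vcnt | vt | vep | veq | vel | vres | ve0 | ve1 | ve2
  | vk | vd | vp0 | vok | vq | vrr | vrl | vff | vfl | vr | vs | vtf | vtl | val | vout
  deriving DecidableEq

/-- `aX` has index zero and so occupies the cells from address `0` on, where the input is found and
the answers are expected. There are 17 arrays. -/
inductive Arr where
  | aX | aA | aB | aCLS | aNEW | aPAR | aBIR | aHEAD | aNXT | aSTAMP | aVAL | aF | aL | aRR | aPP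
  | aGOOD | aANS
  deriving DecidableEq

/-- A variable as an expression. -/
abbrev Var.e (x : Var) : Ex Var Arr := .var x

/-- A literal as an expression. -/
abbrev lit (c : ℕ) : Ex Var Arr := .lit c

/-- An array entry as an expression. -/
abbrev Arr.at (b : Arr) (e : Ex Var Arr) : Ex Var Arr := .get b e

/-- The array length and value bound suffice for inputs of length `n`. -/
structure Dim (n Z C : ℕ) : Prop where
  len : 4 * (n + 2) ≤ Z
  sq : Z * Z ≤ C

/-- The checks against overflow rest on this linear bound. -/
theorem Dim.lin {n Z C : ℕ} (h : Dim n Z C) : 8 * Z ≤ C :=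
  le_trans (Nat.mul_le_mul_right _ (by have := h.len; omega)) h.sq

/-- The state holds the word `X` of length `n`. -/
structure Inp (X : ℕ → ℕ) (n : ℕ) (s : St Var Arr) : Prop where
  len : s.v .vn = n
  val : ∀ p < n, s.a .aX (p + 1) + 1 = X p

theorem Inp.frame {X : ℕ → ℕ} {n : ℕ} {s s' : St Var Arr} (h : Inp X n s)
    (hn : s'.v .vn = s.v .vn) (hX : s'.a .aX = s.a .aX) : Inp X n s' :=
  ⟨hn.trans h.len, fun p hp => by rw [hX]; exact h.val p hp⟩

open Var Arr

/-! ### Computing the number of levels -/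

def lgProg : Cmd Var Arr :=
  .set vwd (lit 1) ;; .set vlg (lit 0) ;;
  .loop vu vn.e (.ite .lt vwd.e vn.e (.set vwd (lit 2 * vwd.e) ;; .set vlg (vlg.e + lit 1)) .nop)

/-- A counted loop cannot stop early, so doubling is offered `n` times and declined once the power
reaches `n`. If it is never declined, the power is `2 ^ n`, which is larger than `n`. -/
theorem lgProg_spec {n Z C : ℕ} (hD : Dim n Z C) (s : St Var Arr) (hn : s.v .vn = n) :
    Safe Z C lgProg s (3 + n * 4) ∧ n ≤ 2 ^ (run Z C lgProg s).v vlg ∧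
      ((run Z C lgProg s).v vlg = 0 ∨ 2 ^ (run Z C lgProg s).v vlg < 2 * n) := by
  have hZ := hD.len
  have hC := hD.lin
  set s₁ := run Z C (.set vlg (lit 0)) (run Z C (.set vwd (lit 1)) s) with hs₁
  have key := run_loop (Z := Z) (C := C) (x := vu) (e := vn.e)
    (p := .ite .lt vwd.e vn.e (.set vwd (lit 2 * vwd.e) ;; .set vlg (vlg.e + lit 1)) .nop) (s₀ := s₁)
    (fun i s => s.v vwd = 2 ^ s.v vlg ∧ (s.v vlg = 0 ∨ s.v vwd < 2 * n) ∧ s.v vlg ≤ i ∧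
      (n ≤ s.v vwd ∨ s.v vlg = i))
    n 3 (by simp [hs₁, run_set, hn]) (by simp) (by omega) (by simp [hs₁, run_set])
    (by
      rintro i hi s hf hu ⟨h1, h2, h3, h4⟩
      have hsn : s.v .vn = n := by rw [hf.v .vn rfl]; simp [hs₁, run_set, hn]
      by_cases h : s.v vwd < n
      · have hlt : s.v vlg < n := by omega
        constructor
        · rintro ok
          simp [run_ite, run_seq, run_set, h, hsn, ok]
          omega
        · simp [run_ite, run_seq, run_set, h, hsn, ← h1, pow_succ]
          omega
      · constructor
        · rintro ok
          simp [run_ite, run_nop, h, hsn, ok]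
        · simp [run_ite, run_nop, h, hsn]
          omega)
  obtain ⟨k1, k2, k3, k4, k5⟩ := key
  refine ⟨(Safe.seq (c := 1) (Safe.set (by simp; omega) (by simp; omega)) (Safe.seq (c := 1)
    (Safe.set (by simp; omega) (by simp; omega)) k1)).mono (by omega), ?_, ?_⟩
  · change n ≤ 2 ^ ((run Z C _ s₁).v vlg)
    rw [← k2]
    rcases k5 with h | h
    · exact h
    · rw [k2, h]; exact Nat.lt_two_pow_self.le
  · change (run Z C _ s₁).v vlg = 0 ∨ 2 ^ ((run Z C _ s₁).v vlg) < 2 * n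
    rw [← k2]
    exact k3

end Loops

namespace Loops

open WordRAM Var Arr

set_option linter.unusedSimpArgs false

/-! ### Merge sort of the positions by their letters -/

/-- The aligned blocks of length `w` of `A` are sorted lists of the positions in the block. -/
structure SortedBlocks (K : ℕ → ℕ) (n w : ℕ) (A : ℕ → ℕ) : Prop where
  range : ∀ b i, b * w ≤ i → i < b * w + w → i < n → b * w ≤ A i ∧ A i < b * w + w ∧ A i < n
  sorted : ∀ b i i', b * w ≤ i → i < i' → i' < b * w + w → i' < n → K (A i) < K (A i')

/-- The state of merging pairs of blocks of `A` into the first `o` entries of `B`. -/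
structure MergeInv (K : ℕ → ℕ) (n w : ℕ) (A B : ℕ → ℕ) (o pi pj : ℕ) : Prop where
  range : ∀ b i, b * (2 * w) ≤ i → i < b * (2 * w) + 2 * w → i < o →
    b * (2 * w) ≤ B i ∧ B i < b * (2 * w) + 2 * w ∧ B i < n
  sorted : ∀ b i i', b * (2 * w) ≤ i → i < i' → i' < b * (2 * w) + 2 * w → i' < o →
    K (B i) < K (B i')
  ptr : ∀ b lo, lo = b * (2 * w) → lo < o → o < lo + 2 * w → o < n →
    lo ≤ pi ∧ pi ≤ min (lo + w) n ∧ min (lo + w) n ≤ pj ∧ pj ≤ min (lo + 2 * w) n ∧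
    pi + pj = o + min (lo + w) n ∧ ∀ t, lo ≤ t → t < o →
      (∀ i, pi ≤ i → i < min (lo + w) n → K (B t) < K (A i)) ∧
      (∀ i, pj ≤ i → i < min (lo + 2 * w) n → K (B t) < K (A i))

/-- The output position `o` determines the pair of blocks being merged, and the two pointers are
reset whenever `o` enters a new pair. Thus all pairs are merged by a single loop over `o`. The last
two claims are the two possible moves. -/
theorem MergeInv.step {K : ℕ → ℕ} {n w : ℕ} {A B : ℕ → ℕ} {o pi pj : ℕ} (hw : 0 < w)
    (hA : SortedBlocks K n w A) (h : MergeInv K n w A B o pi pj) (ho : o < n) (lo pi' pj' : ℕ)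
    (hlo : lo = o / (2 * w) * (2 * w)) (hpi : pi' = if o = lo then lo else pi)
    (hpj : pj' = if o = lo then min (lo + w) n else pj) :
    pi' + pj' = o + min (lo + w) n ∧ pi' ≤ min (lo + w) n ∧ pj' ≤ min (lo + 2 * w) n ∧
    min (lo + w) n ≤ pj' ∧ lo ≤ pi' ∧
    (∀ i j, pi' ≤ i → i < min (lo + w) n → pj' ≤ j → j < min (lo + 2 * w) n → A i < A j ∧ A j < n) ∧
    (pi' < min (lo + w) n → (pj' < min (lo + 2 * w) n → K (A pi') < K (A pj')) →
      MergeInv K n w A (fun i => if i = o then A pi' else B i) (o + 1) (pi' + 1) pj') ∧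
    (pj' < min (lo + 2 * w) n → (pi' < min (lo + w) n → K (A pj') < K (A pi')) →
      MergeInv K n w A (fun i => if i = o then A pj' else B i) (o + 1) pi' (pj' + 1)) := by
  set b := o / (2 * w) with hb
  have h2w : 0 < 2 * w := by omega
  have hdm := Nat.div_add_mod o (2 * w)
  have hml := Nat.mod_lt o h2w
  rw [mul_comm (2 * w), ← hb, ← hlo] at hdm
  have hlo1 : lo = (2 * b) * w := by rw [hlo]; ring
  have hlo2 : lo + w = (2 * b + 1) * w := by rw [hlo]; ring
  have P : lo ≤ pi' ∧ pi' ≤ min (lo + w) n ∧ min (lo + w) n ≤ pj' ∧ pj' ≤ min (lo + 2 * w) n ∧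
    pi' + pj' = o + min (lo + w) n ∧ ∀ t, lo ≤ t → t < o →
      (∀ i, pi' ≤ i → i < min (lo + w) n → K (B t) < K (A i)) ∧
      (∀ i, pj' ≤ i → i < min (lo + 2 * w) n → K (B t) < K (A i)) := by
    by_cases e : o = lo
    · rw [if_pos e] at hpi hpj
      refine ⟨by omega, by omega, by omega, by omega, by omega, fun t h1 h2 => by omega⟩
    · rw [if_neg e] at hpi hpj
      subst hpi hpj
      exact h.ptr b lo hlo (by omega) (by omega) ho
  obtain ⟨p1, p2, p3, p4, p5, p6⟩ := P
  have rA : ∀ i, lo ≤ i → i < min (lo + w) n → lo ≤ A i ∧ A i < lo + w ∧ A i < n := by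
    intro i h1 h2
    have := hA.range (2 * b) i (by omega) (by omega) (by omega)
    rwa [← hlo1] at this
  have rB : ∀ i, min (lo + w) n ≤ i → i < min (lo + 2 * w) n →
      lo + w ≤ A i ∧ A i < lo + 2 * w ∧ A i < n := by
    intro i h1 h2
    have := hA.range (2 * b + 1) i (by omega) (by omega) (by omega)
    rw [← hlo2] at this
    omega
  have sA : ∀ i i', lo ≤ i → i < i' → i' < min (lo + w) n → K (A i) < K (A i') :=
    fun i i' h1 h2 h3 => hA.sorted (2 * b) i i' (by omega) h2 (by omega) (by omega)
  have sB : ∀ i i', min (lo + w) n ≤ i → i < i' → i' < min (lo + 2 * w) n → K (A i) < K (A i') :=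
    fun i i' h1 h2 h3 => hA.sorted (2 * b + 1) i i' (by omega) h2 (by omega) (by omega)
  have uniq : ∀ b', b' * (2 * w) ≤ o → o < b' * (2 * w) + 2 * w → b' = b := by
    intro b' h1 h2
    have h3 : b' * (2 * w) < (b + 1) * (2 * w) := by rw [add_mul, ← hlo]; omega
    have h4 : b * (2 * w) < (b' + 1) * (2 * w) := by rw [add_mul, ← hlo]; omega
    have := lt_of_mul_lt_mul_right h3 (Nat.zero_le _)
    have := lt_of_mul_lt_mul_right h4 (Nat.zero_le _)
    omega
  -- The common part of both moves: the new entry `v` exceeds everything already output for this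
  -- pair and is below everything still waiting.
  have fin : ∀ v p q, lo ≤ v → v < lo + 2 * w → v < n → lo ≤ p → p ≤ min (lo + w) n →
      min (lo + w) n ≤ q → q ≤ min (lo + 2 * w) n → p + q = o + 1 + min (lo + w) n →
      pi' ≤ p → pj' ≤ q →
      (∀ t, lo ≤ t → t < o → K (B t) < K v) →
      (∀ i, p ≤ i → i < min (lo + w) n → K v < K (A i)) →
      (∀ i, q ≤ i → i < min (lo + 2 * w) n → K v < K (A i)) →
      MergeInv K n w A (fun i => if i = o then v else B i) (o + 1) p q := by
    intro v p q v1 v2 v3 q1 q2 q3 q4 q5 q6 q7 g1 g2 g3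
    refine ⟨?_, ?_, ?_⟩
    · intro b' i h1 h2 h3
      by_cases e : i = o
      · subst e
        obtain rfl := uniq b' h1 h2
        simp only [if_true]
        rw [← hlo]; exact ⟨v1, v2, v3⟩
      · simp only [e, if_false]
        exact h.range b' i h1 h2 (by omega)
    · intro b' i i' h1 h2 h3 h4
      have e : i ≠ o := by omega
      simp only [e, if_false]
      by_cases e' : i' = o
      · subst e'
        obtain rfl := uniq b' (by omega) h3
        simp only [if_true]
        exact g1 i (by omega) h2
      · simp only [e', if_false]
        exact h.sorted b' i i' h1 h2 h3 (by omega)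
    · intro b' lo' h1 h2 h3 h4
      obtain rfl := uniq b' (by omega) (by omega)
      obtain rfl : lo = lo' := by omega
      refine ⟨q1, q2, q3, q4, q5, fun t t1 t2 => ?_⟩
      by_cases e : t = o
      · simp only [e, if_true]
        exact ⟨g2, g3⟩
      · simp only [e, if_false]
        have := p6 t t1 (by omega)
        exact ⟨fun i i1 => this.1 i (by omega), fun i i1 => this.2 i (by omega)⟩
  refine ⟨p5, p2, p4, p3, p1, ?_, ?_, ?_⟩
  · intro i j h1 h2 h3 h4
    have := rA i (by omega) h2
    have := rB j (by omega) h4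
    omega
  · intro h1 h2
    have r := rA pi' p1 h1
    refine fin _ _ _ (by omega) (by omega) (by omega) (by omega) (by omega) (by omega) (by omega)
      (by omega) (by omega) le_rfl ?_ ?_ ?_
    · exact fun t t1 t2 => (p6 t t1 t2).1 _ le_rfl h1
    · exact fun i i1 i2 => sA _ _ p1 i1 i2
    · intro i i1 i2
      rcases i1.eq_or_lt with rfl | i1
      · exact h2 i2
      · exact lt_trans (h2 (by omega)) (sB _ _ p3 i1 i2)
  · intro h1 h2
    have r := rB pj' p3 h1
    refine fin _ _ _ (by omega) (by omega) (by omega) (by omega) (by omega) (by omega) (by omega)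
      (by omega) le_rfl (by omega) ?_ ?_ ?_
    · exact fun t t1 t2 => (p6 t t1 t2).2 _ le_rfl h1
    · intro i i1 i2
      rcases i1.eq_or_lt with rfl | i1
      · exact h2 i2
      · exact lt_trans (h2 (by omega)) (sA _ _ p1 i1 i2)
    · exact fun i i1 i2 => sB _ _ p3 i1 i2

/-- Sorting key: letters first, positions second. -/
def skey (X : ℕ → ℕ) (n a : ℕ) : ℕ := X a * (n + 1) + a

/-- The key is never computed by the machine, since letters may be large. Ties are broken by
position, which a stable merge respects by itself: positions in the left block are smaller. -/
theorem skey_lt {X : ℕ → ℕ} {n a b : ℕ} (ha : a < n) (hb : b < n) :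
    skey X n a < skey X n b ↔ X a < X b ∨ (X a = X b ∧ a < b) := by
  unfold skey
  rcases lt_trichotomy (X a) (X b) with h | h | h
  · have : (X a + 1) * (n + 1) ≤ X b * (n + 1) := Nat.mul_le_mul_right _ h
    rw [add_mul] at this
    exact ⟨fun _ => Or.inl h, fun _ => by omega⟩
  · rw [h]
    exact ⟨fun h' => Or.inr ⟨rfl, by omega⟩, fun h' => by omega⟩
  · have : (X b + 1) * (n + 1) ≤ X a * (n + 1) := Nat.mul_le_mul_right _ h
    rw [add_mul] at this
    exact ⟨fun _ => by omega, fun _ => by omega⟩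

/-- Output the smaller head of the current pair of blocks. -/
def mergeStep : Cmd Var Arr :=
  .set vlo (vo.e / vwd2.e * vwd2.e) ;;
  .set vmid (.cond .lt (vlo.e + vwd.e) vn.e (vlo.e + vwd.e) vn.e) ;;
  .set vhi (.cond .lt (vlo.e + vwd2.e) vn.e (vlo.e + vwd2.e) vn.e) ;;
  .set vpi (.cond .eq vo.e vlo.e vlo.e vpi.e) ;;
  .set vpj (.cond .eq vo.e vlo.e vmid.e vpj.e) ;;
  .set vc (.cond .lt vpi.e vmid.e (.cond .le vhi.e vpj.e (lit 1)
    (.cond .le (aX.at (aA.at vpi.e + lit 1)) (aX.at (aA.at vpj.e + lit 1)) (lit 1) (lit 0)))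
    (lit 0)) ;;
  .put aB vo.e (.cond .eq vc.e (lit 1) (aA.at vpi.e) (aA.at vpj.e)) ;;
  .set vpi (vpi.e + vc.e) ;; .set vpj (vpj.e + lit 1 - vc.e)

theorem ite_lt_of {P : Prop} [Decidable P] {a b c : ℕ} (ha : a < c) (hb : b < c) :
    (if P then a else b) < c := by split_ifs <;> assumption

set_option maxHeartbeats 800000 in
theorem mergeStep_spec {X : ℕ → ℕ} {n Z C w : ℕ} (hD : Dim n Z C) (s : St Var Arr)
    (hX : Inp X n s) (hw : 0 < w) (hw2 : w < 2 * n) (hs1 : s.v vwd = w) (hs2 : s.v vwd2 = 2 * w)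
    {o : ℕ} (hs3 : s.v vo = o) (ho : o < n)
    (hA : SortedBlocks (skey X n) n w (s.a aA))
    (hM : MergeInv (skey X n) n w (s.a aA) (s.a aB) o (s.v vpi) (s.v vpj)) :
    WP Z C mergeStep s 9 fun s' =>
      MergeInv (skey X n) n w (s'.a aA) (s'.a aB) (o + 1) (s'.v vpi) (s'.v vpj) := by
  have hZ := hD.len
  have hC := hD.lin
  have hn := hX.len
  have hlo : o / (2 * w) * (2 * w) ≤ o := Nat.div_mul_le_self _ _
  have hdv : o / (2 * w) ≤ o := Nat.div_le_self _ _
  have key := fun pi pj => hM.step hw hA ho (o / (2 * w) * (2 * w)) pi pj rfl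
  have hob : o < o / (2 * w) * (2 * w) + 2 * w := Nat.lt_div_mul_add (by omega)
  generalize hl : o / (2 * w) * (2 * w) = lo at *
  refine .cost (.set_seq (by simp [*]; omega) fun s₁ a₁ b₁ c₁ => ?_)
    (le_refl (1 + (1 + (1 + (1 + (1 + (1 + (1 + (1 + 1)))))))))
  have d₁ : s₁.v vlo = lo := by rw [a₁]; simp [*]
  clear a₁
  refine .set_seq (by simp [*]; split_ifs <;> omega) fun s₂ a₂ b₂ c₂ => ?_
  have d₂ : s₂.v vmid = min (lo + w) n := by rw [a₂]; simp [*]; split_ifs <;> omega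
  clear a₂
  refine .set_seq (by simp [*]; split_ifs <;> omega) fun s₃ a₃ b₃ c₃ => ?_
  have d₃ : s₃.v vhi = min (lo + 2 * w) n := by rw [a₃]; simp [*]; split_ifs <;> omega
  clear a₃
  obtain ⟨pi, hpi⟩ : ∃ pi, pi = if o = lo then lo else s.v vpi := ⟨_, rfl⟩
  obtain ⟨pj, hpj⟩ : ∃ pj, pj = if o = lo then min (lo + w) n else s.v vpj := ⟨_, rfl⟩
  obtain ⟨k1, k2, k3, k4, k5, k6, k7, k8⟩ := key pi pj hpi hpj
  clear key
  have e₄ : (Ex.cond .eq vo.e vlo.e vlo.e vpi.e).eval s₃ = pi := by simp [*]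
  refine .set_seq ⟨by simp, by rw [e₄]; omega⟩ fun s₄ a₄ b₄ c₄ => ?_
  rw [e₄] at a₄
  clear e₄
  have e₅ : (Ex.cond .eq vo.e vlo.e vmid.e vpj.e).eval s₄ = pj := by simp [*]
  refine .set_seq ⟨by simp, by rw [e₅]; omega⟩ fun s₅ a₅ b₅ c₅ => ?_
  rw [e₅] at a₅
  clear e₅ hpi hpj
  -- The value `1` means that the left head is output; equal letters go to the left, which keeps the
  -- merge stable.
  obtain ⟨v, hv⟩ : ∃ v, v = if pi < min (lo + w) n ∧ (pj < min (lo + 2 * w) n →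
      X (s.a aA pi) ≤ X (s.a aA pj)) then 1 else 0 := ⟨_, rfl⟩
  have x1 : pi < min (lo + w) n → pj < min (lo + 2 * w) n → (s.a aX (s.a aA pi + 1) ≤
      s.a aX (s.a aA pj + 1) ↔ X (s.a aA pi) ≤ X (s.a aA pj)) := by
    intro h1 h2
    have := k6 pi pj le_rfl h1 le_rfl h2
    rw [← hX.val _ this.2, ← hX.val _ (by omega)]; omega
  have x2 : pi < min (lo + w) n → pj < min (lo + 2 * w) n → s.a aA pi < n ∧ s.a aA pj < n := by
    intro h1 h2
    have := k6 pi pj le_rfl h1 le_rfl h2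
    omega
  have e₆ : s₅.v vpi = pi ∧ s₅.v vpj = pj ∧ s₅.v vmid = min (lo + w) n ∧
      s₅.v vhi = min (lo + 2 * w) n ∧ s₅.a = s.a ∧ s₅.v vo = o := by simp [*]
  clear * - hZ hC e₆ x1 x2 hv k1 k2 k3 k4 k5 k6 k7 k8 ho hob
  obtain ⟨f1, f2, f3, f4, f5, f6⟩ := e₆
  refine .set_seq ⟨?_, ?_⟩ fun s₆ a₆ b₆ c₆ => ?_
  · simp [f1, f2, f3, f4, f5]
    clear k6 k7 k8 x1 hv
    refine ⟨fun h1 h1' => ⟨fun _ => by omega, fun h2 h3 => ?_⟩, fun _ => by omega⟩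
    have := x2 (by omega) (by omega)
    omega
  · have h1 : 1 < C := by omega
    have h0 : 0 < C := by omega
    exact ite_lt_of (ite_lt_of h1 (ite_lt_of h1 h0)) h0
  have d₆ : s₆.v vc = v := by
    rw [a₆, hv]
    simp only [Ex.eval, f1, f2, f3, f4, f5, holds_lt, holds_le, eval_add, op_add]
    clear k6 k7 k8 a₆
    by_cases h1 : pi < min (lo + w) n
    · by_cases h2 : pj < min (lo + 2 * w) n
      · have := x1 h1 h2
        by_cases h3 : X (s.a aA pi) ≤ X (s.a aA pj)
        · rw [if_pos h1, if_neg (by omega), if_pos (this.2 h3), if_pos ⟨h1, fun _ => h3⟩]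
        · rw [if_pos h1, if_neg (by omega), if_neg (fun h => h3 (this.1 h)),
            if_neg fun h => h3 (h.2 h2)]
      · rw [if_pos h1, if_pos (by omega), if_pos ⟨h1, fun h => absurd h h2⟩]
    · rw [if_neg h1, if_neg fun h => h1 h.1]
  clear a₆
  have hv1 : v ≤ 1 := by rw [hv]; split_ifs <;> omega
  have hlt : pi < n ∧ pj ≤ n := by omega
  refine .put_seq ?_ fun s₇ b₇ a₇ c₇ => ?_
  · simp [b₆, f1, f2, f6, d₆]; omega
  refine .set_seq ?_ fun s₈ a₈ b₈ c₈ => ?_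
  · simp [b₆, b₇, f1, d₆]; omega
  refine .set ?_ fun s₉ a₉ b₉ c₉ => ?_
  · simp [b₆, b₇, b₈, f1, f2, d₆]; omega
  have q1 : s₉.v vpi = pi + v := by simp [a₉, b₉, a₈, b₈, b₇, b₆, f1, d₆]
  have q2 : s₉.v vpj = pj + 1 - v := by simp [a₉, b₉, a₈, b₈, b₇, b₆, f2, d₆]
  have q3 : s₉.a aA = s.a aA := by simp [c₉, c₈, c₇, c₆, f5]
  have q4 : s₉.a aB = fun i => if i = o then (if v = 1 then s.a aA pi else s.a aA pj)
      else s.a aB i := by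
    funext i
    simp [c₉, c₈, a₇, c₆, f5, b₆, f1, f2, f6, d₆, Function.update_apply]
  rw [q1, q2, q3, q4]
  split_ifs at hv with h
  · subst hv
    simp only [if_true, Nat.add_sub_cancel]
    refine k7 h.1 fun h2 => ?_
    rw [skey_lt (x2 h.1 h2).1 (x2 h.1 h2).2]
    have := (k6 pi pj le_rfl h.1 le_rfl h2).1
    have := h.2 h2
    omega
  · subst hv
    simp only [zero_ne_one, if_false, Nat.sub_zero, Nat.add_zero]
    have h2 : pj < min (lo + 2 * w) n := by
      by_contra h2
      exact h ⟨by omega, fun h3 => absurd h3 h2⟩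
    refine k8 h2 fun h1 => ?_
    rw [skey_lt (x2 h1 h2).2 (x2 h1 h2).1]
    exact Or.inl (not_le.1 fun h3 => h ⟨h1, fun _ => h3⟩)

/-- One round of merging all pairs of blocks. -/
def mergePass : Cmd Var Arr :=
  .set vwd2 (vwd.e + vwd.e) ;; .loop vo vn.e mergeStep ;;
  .loop vo vn.e (.put aA vo.e (aB.at vo.e)) ;; .set vwd vwd2.e

theorem mergePass_spec {X : ℕ → ℕ} {n Z C w : ℕ} (hD : Dim n Z C) (s : St Var Arr)
    (hX : Inp X n s) (hw : 0 < w) (hw2 : w < 2 * n) (hs1 : s.v vwd = w)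
    (hA : SortedBlocks (skey X n) n w (s.a aA)) :
    WP Z C mergePass s (12 * n + 4) fun s' =>
      SortedBlocks (skey X n) n (2 * w) (s'.a aA) ∧ s'.v vwd = 2 * w := by
  have hZ := hD.len
  have hC := hD.lin
  have hn := hX.len
  refine .cost (.set_seq (by simp [hs1]; omega) fun s₁ a₁ b₁ c₁ => .seq (.loop
    (fun o s' => MergeInv (skey X n) n w (s.a aA) (s'.a aB) o (s'.v vpi) (s'.v vpj)) n 9
    (by simp [b₁, hn]) (by simp) (by omega) ⟨?_, ?_, ?_⟩ ?_) fun s₂ F₂ h₂ => .seq (.loop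
    (fun o s' => ∀ i < o, s'.a aA i = s₂.a aB i) n 1 ?_ (by simp) (by omega) ?_ ?_)
    fun s₃ F₃ h₃ => .set ?_ fun s₄ a₄ b₄ c₄ => ⟨⟨?_, ?_⟩, ?_⟩)
    (?_ : 1 + (1 + n * (9 + 1) + (1 + n * (1 + 1) + 1)) ≤ _)
  · intros; omega
  · intros; omega
  · intros; omega
  · intro o ho s₂ F₂ q₂ h₂
    have hA2 : s₂.a aA = s.a aA := by rw [F₂.a aA rfl, c₁]
    refine (mergeStep_spec hD s₂ (hX.frame ?_ ?_) hw hw2 ?_ ?_ q₂ ho ?_ ?_).mono le_rfl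
      fun s' F h => ?_
    · rw [F₂.v vn rfl, b₁ _ (by simp)]
    · rw [F₂.a aX rfl, c₁]
    · rw [F₂.v vwd rfl, b₁ _ (by simp), hs1]
    · rw [F₂.v vwd2 rfl, a₁]; simp [hs1]; omega
    · rw [hA2]; exact hA
    · rw [hA2]; exact h₂
    · rwa [F.a aA rfl, hA2] at h
  · simp [F₂.v vn rfl, b₁, hn]
  · intros; omega
  · intro o ho s₃ F₃ q₃ h₃
    refine .put (by simp [q₃]; omega) fun s₄ b₄ a₄ c₄ i hi => ?_
    rw [a₄]
    by_cases e : i = o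
    · subst e; simp [q₃, F₃.a aB rfl]
    · simp [q₃, Function.update_apply, e, h₃ i (by omega)]
  · simp [F₃.v vwd2 rfl, F₂.v vwd2 rfl, a₁, hs1]; omega
  · intro b i h1 h2 h3
    rw [c₄, h₃ i h3]
    exact h₂.range b i h1 h2 h3
  · intro b i i' h1 h2 h3 h4
    rw [c₄, h₃ i (by omega), h₃ i' h4]
    exact h₂.sorted b i i' h1 h2 h3 h4
  · rw [a₄]; simp [F₃.v vwd2 rfl, F₂.v vwd2 rfl, a₁, hs1]; omega
  · omega

/-- Sort the positions by their letters. -/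
def sortProg : Cmd Var Arr :=
  .loop vi vn.e (.put aA vi.e vi.e) ;; .set vwd (lit 1) ;; .loop vlev vlg.e mergePass

theorem sortProg_spec {X : ℕ → ℕ} {n Z C l : ℕ} (hD : Dim n Z C) (s : St Var Arr)
    (hX : Inp X n s) (hl : s.v vlg = l) (hl1 : n ≤ 2 ^ l) (hl2 : l = 0 ∨ 2 ^ l < 2 * n) :
    WP Z C sortProg s (3 + n * 2 + l * (12 * n + 5)) fun s' =>
      (∀ i < n, s'.a aA i < n) ∧
      ∀ i j, i < j → j < n → skey X n (s'.a aA i) < skey X n (s'.a aA j) := by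
  have hZ := hD.len
  have hC := hD.lin
  have hn := hX.len
  have hlC : l < C := by
    rcases hl2 with h | h
    · omega
    · have := Nat.lt_two_pow_self (n := l); omega
  refine .cost (.seq (.loop (fun o s' => ∀ i < o, s'.a aA i = i) n 1 (by simp [hn]) (by simp)
    (by omega) (by omega) ?_) fun s₁ F₁ h₁ => .set_seq (by simp; omega) fun s₂ a₂ b₂ c₂ =>
    .mono (.loop (fun o s' => SortedBlocks (skey X n) n (2 ^ o) (s'.a aA) ∧ s'.v vwd = 2 ^ o)
      l (12 * n + 4) ?_ (by simp) hlC ?_ ?_) le_rfl ?_)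
    (?_ : 1 + n * (1 + 1) + (1 + (1 + l * (12 * n + 4 + 1))) ≤ _)
  · intro o ho s₁ F₁ q₁ h₁
    refine .put (by simp [q₁]; omega) fun s₂ b₂ a₂ c₂ i hi => ?_
    rw [a₂]
    by_cases e : i = o
    · subst e; simp [q₁]
    · simp [q₁, Function.update_apply, e, h₁ i (by omega)]
  · simp [b₂, F₁.v vlg rfl, hl]
  · refine ⟨⟨?_, ?_⟩, by simp [a₂]⟩
    · intro b i h1 h2 h3
      rw [c₂, h₁ i h3]; omega
    · intros; omega
  · rintro o ho s₃ F₃ q₃ ⟨h₃, g₃⟩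
    have : 2 ^ (o + 1) ≤ 2 ^ l := Nat.pow_le_pow_right (by omega) ho
    rw [pow_succ] at this
    rw [pow_succ, mul_comm (2 ^ o)]
    refine mergePass_spec hD s₃ (hX.frame ?_ ?_) (by positivity) (by omega) g₃ h₃
    · rw [F₃.v vn rfl, b₂ _ (by simp), F₁.v vn rfl]
    · rw [F₃.a aX rfl, c₂, F₁.a aX rfl]
  · rintro s' - ⟨h, -⟩
    refine ⟨fun i hi => (h.range 0 i (by omega) (by omega) hi).2.2,
      fun i j h1 h2 => h.sorted 0 i j (by omega) h1 (by omega) h2⟩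
  · rw [add_assoc (12 * n)]; omega

/-! ### Naming the letters -/

/-- The array of classes of level `j`. -/
def ClsInv (X : ℕ → ℕ) (n j : ℕ) (f : ℕ → ℕ) : Prop := ∀ p ≤ n, f p = cls X j p

/-- Name the positions by the first occurrence of their letters. -/
def nameProg : Cmd Var Arr :=
  .put aCLS vn.e vn.e ;;
  .loop vi vn.e (.put aCLS (aA.at vi.e) (.cond .eq vi.e (lit 0) (aA.at vi.e)
    (.cond .eq (aX.at (aA.at vi.e + lit 1)) (aX.at (aA.at (vi.e - lit 1) + lit 1))
      (aCLS.at (aA.at (vi.e - lit 1))) (aA.at vi.e))))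

theorem exists_index_of_sorted {n : ℕ} {A K : ℕ → ℕ} (h : ∀ i < n, A i < n)
    (hs : ∀ i j, i < j → j < n → K (A i) < K (A j)) {p : ℕ} (hp : p < n) : ∃ i < n, A i = p := by
  have inj : Function.Injective (fun i : Fin n => (⟨A i, h i i.2⟩ : Fin n)) := by
    intro i j hij
    simp only [Fin.mk.injEq] at hij
    by_contra hne
    rcases lt_or_gt_of_ne (fun h => hne (Fin.ext h) : (i : ℕ) ≠ j) with h1 | h1
    · have := hs _ _ h1 j.2; rw [hij] at this; omega
    · have := hs _ _ h1 i.2; rw [hij] at this; omega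
  obtain ⟨i, hi⟩ := Finite.surjective_of_injective inj ⟨p, hp⟩
  exact ⟨i, i.2, by simpa using hi⟩

/-- In the sorted order equal letters are adjacent and the leftmost position comes first, so a name
is either inherited from the predecessor or new. -/
theorem cls_zero_sorted {X : ℕ → ℕ} {n : ℕ} {A : ℕ → ℕ}
    (h : ∀ i < n, A i < n)
    (hs : ∀ i j, i < j → j < n → skey X n (A i) < skey X n (A j)) {i : ℕ} (hi : i < n) :
    cls X 0 (A i) = if i = 0 then A i else
      if X (A i) = X (A (i - 1)) then cls X 0 (A (i - 1)) else A i := by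
  have key : (i ≠ 0 → X (A i) ≠ X (A (i - 1))) → cls X 0 (A i) = A i := by
    intro hne
    refine cls_unique rfl fun q hq hc => ?_
    rw [cls_zero_eq_iff] at hc
    have hAi := h i hi
    obtain ⟨i', hi', rfl⟩ := exists_index_of_sorted h hs (show q < n by omega)
    rcases lt_trichotomy i' i with hlt | rfl | hlt
    · have h1 := hne (by omega)
      have h2 := hs (i - 1) i (by omega) hi
      rw [skey_lt (h _ (by omega)) hAi] at h2
      have h3 : X (A i') ≤ X (A (i - 1)) := by
        rcases Nat.lt_or_ge i' (i - 1) with h4 | h4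
        · have := hs i' (i - 1) h4 (by omega)
          rw [skey_lt (h _ hi') (h _ (by omega))] at this
          omega
        · rw [show i' = i - 1 by omega]
      omega
    · omega
    · have := hs i i' hlt hi'
      rw [skey_lt hAi (h _ hi')] at this
      omega
  split_ifs with h1 h2
  · exact key fun h => absurd h1 h
  · rw [cls_zero_eq_iff, h2]
  · exact key fun _ => h2

theorem nameProg_spec {X : ℕ → ℕ} {n Z C : ℕ} (hD : Dim n Z C) (hW : IsWord X n) (s : St Var Arr)
    (hX : Inp X n s) (hA : ∀ i < n, s.a aA i < n)
    (hs : ∀ i j, i < j → j < n → skey X n (s.a aA i) < skey X n (s.a aA j)) :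
    WP Z C nameProg s (2 + n * 2) fun s' => ClsInv X n 0 (s'.a aCLS) := by
  have hZ := hD.len
  have hC := hD.lin
  have hn := hX.len
  refine .cost (.put_seq (by simp [hn]; omega) fun s₁ b₁ a₁ c₁ => .mono (.loop
    (fun i s' => s'.a aCLS n = n ∧ ∀ t < i, s'.a aCLS (s.a aA t) = cls X 0 (s.a aA t))
    n 1 (by simp [b₁, hn]) (by simp) (by omega) ⟨by simp [a₁, hn], by simp⟩ ?_) le_rfl ?_)
    (?_ : 1 + (1 + n * (1 + 1)) ≤ _)
  · rintro i hi s₂ F₂ q₂ ⟨h₂, g₂⟩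
    have eA : s₂.a aA = s.a aA := by rw [F₂.a aA rfl, c₁ _ (by simp)]
    have eX : s₂.a aX = s.a aX := by rw [F₂.a aX rfl, c₁ _ (by simp)]
    have hi' := hA i hi
    have hi'' := hA (i - 1) (by omega)
    refine .put ?_ fun s₃ b₃ a₃ c₃ => ?_
    · simp [q₂, eA, eX]; omega
    have e : s₃.a aCLS = Function.update (s₂.a aCLS) (s.a aA i) (cls X 0 (s.a aA i)) := by
      rw [a₃, cls_zero_sorted hA hs hi]
      simp only [Ex.eval, q₂, eA, eX, holds_eq, op_add, op_sub, eval_add, eval_sub]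
      congr 1
      split_ifs with h1 h2 h3 h3
      · rfl
      · exact g₂ _ (by omega)
      · exact absurd (by rw [← hX.val _ hi', ← hX.val _ hi'', h2]) h3
      · rw [← hX.val _ hi', ← hX.val _ hi''] at h3; exact absurd (by simpa using h3) h2
      · rfl
    rw [e]
    refine ⟨by rw [Function.update_of_ne (by omega), h₂], fun t ht => ?_⟩
    by_cases h : t = i
    · rw [h]; simp
    · by_cases h' : s.a aA t = s.a aA i
      · rw [h']; simp
      · rw [Function.update_of_ne h', g₂ t (by omega)]
  · rintro s' - ⟨h1, h2⟩ p hp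
    rcases hp.eq_or_lt with rfl | hp
    · rw [h1, hW.cls_of_le le_rfl]
    · obtain ⟨i, hi, rfl⟩ := exists_index_of_sorted hA hs hp
      exact h2 i hi
  · omega

/-! ### Refining the classes -/

/-- `q` is the first position of class `a` from `lo` on. -/
structure IsNext (X : ℕ → ℕ) (n j a lo q : ℕ) : Prop where
  le : q ≤ n
  lo_le : q < n → lo ≤ q
  cls_eq : q < n → cls X j q = a
  min : ∀ r, lo ≤ r → r < q → r < n → cls X j r ≠ a

/-- The history of the classes: `bir` is the first level on which a representative is its own
representative, and `par` its representative on the level before. -/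
def TreeInv (X : ℕ → ℕ) (n J : ℕ) (bir par : ℕ → ℕ) : Prop :=
  ∀ r < n, cls X J r = r → (∀ i ≤ J, cls X i r = r ↔ bir r ≤ i) ∧
    (0 < bir r → par r = cls X (bir r - 1) r)

/-- Chain the positions of each class. -/
def chainProg : Cmd Var Arr :=
  .loop va (vn.e + lit 1) (.put aHEAD va.e vn.e ;; .put aSTAMP va.e (lit 0)) ;;
  .loop vi vn.e (.put aNXT (vn.e - lit 1 - vi.e) (aHEAD.at (aCLS.at (vn.e - lit 1 - vi.e))) ;;
    .put aHEAD (aCLS.at (vn.e - lit 1 - vi.e)) (vn.e - lit 1 - vi.e))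

/-- Positions are put in front of their chains from right to left, so each chain is increasing; `n`
ends a chain. -/
theorem chainProg_spec {X : ℕ → ℕ} {n j Z C : ℕ} (hD : Dim n Z C) (s : St Var Arr) (hn : s.v vn = n) (hcls : ClsInv X n j (s.a aCLS)) :
    WP Z C chainProg s (5 + n * 6) fun s' => (∀ a ≤ n, IsNext X n j a 0 (s'.a aHEAD a)) ∧
      (∀ p < n, IsNext X n j (cls X j p) (p + 1) (s'.a aNXT p)) ∧
      ∀ a ≤ n, s'.a aSTAMP a = 0 := by
  have hZ := hD.len
  have hC := hD.lin
  refine .cost (.seq (.loop (fun i s' => ∀ a < i, s'.a aHEAD a = n ∧ s'.a aSTAMP a = 0)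
    (n + 1) 2 (by simp [hn]) (by simp [hn]; omega) (by omega) (by simp) ?_) fun s₁ F₁ h₁ =>
    .mono (.loop (fun i s' => (∀ a ≤ n, IsNext X n j a (n - i) (s'.a aHEAD a)) ∧
      (∀ p < n, n - i ≤ p → IsNext X n j (cls X j p) (p + 1) (s'.a aNXT p)))
      n 2 (by simp [F₁.v vn rfl, hn]) (by simp) (by omega) ?_ ?_) le_rfl ?_)
    (?_ : 1 + (n + 1) * (2 + 1) + (1 + n * (2 + 1)) ≤ _)
  · intro i hi s₁ F₁ q₁ h₁
    refine .cost (.put_seq (by simp [q₁]; omega) fun s₂ b₂ a₂ c₂ => .put (by simp [b₂, q₁]; omega)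
      fun s₃ b₃ a₃ c₃ a ha => ?_) le_rfl
    have hn' : s₁.v vn = n := by rw [F₁.v vn rfl, hn]
    rw [a₃, c₃ _ (by simp), a₂]
    by_cases e : a = i
    · subst e; simp [b₂, q₁, hn']
    · simp [b₂, q₁, c₂, e, h₁ a (by omega)]
  · refine ⟨fun a ha => ?_, fun p h1 h2 => by omega⟩
    rw [(h₁ a (by omega)).1]
    exact ⟨le_rfl, fun h => by omega, fun h => by omega, fun r h1 h2 h3 => by omega⟩
  · rintro i hi s₂ F₂ q₂ ⟨h₂, g₂⟩
    have hn' : s₂.v vn = n := by rw [F₂.v vn rfl, F₁.v vn rfl, hn]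
    have hc : s₂.a aCLS (n - 1 - i) = cls X j (n - 1 - i) := by
      rw [F₂.a aCLS rfl, F₁.a aCLS rfl, hcls _ (by omega)]
    have hle : cls X j (n - 1 - i) ≤ n - 1 - i := cls_le
    obtain ⟨p, hp⟩ : ∃ p, p = n - 1 - i := ⟨_, rfl⟩
    have hpi : n - i = p + 1 := by omega
    have hpi' : n - (i + 1) = p := by omega
    rw [← hp] at hc hle
    rw [hpi] at h₂ g₂
    refine .cost (.put_seq (by simp [q₂, hn', ← hp, hc]; omega) fun s₃ b₃ a₃ c₃ =>
      .put (by simp [b₃, q₂, hn', ← hp, hc, c₃]; omega) fun s₄ b₄ a₄ c₄ => ?_) le_rfl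
    have e1 : s₄.a aHEAD = Function.update (s₂.a aHEAD) (cls X j p) p := by
      rw [a₄]; simp [b₃, q₂, hn', ← hp, hc, c₃]
    have e2 : s₄.a aNXT = Function.update (s₂.a aNXT) p (s₂.a aHEAD (cls X j p)) := by
      rw [c₄ _ (by simp), a₃]; simp [b₃, q₂, hn', ← hp, hc, c₃]
    rw [hpi', e1, e2]
    refine ⟨fun a ha => ?_, fun q h1 h2 => ?_⟩
    · by_cases e : a = cls X j p
      · subst e; rw [Function.update_self]
        exact ⟨by omega, fun _ => le_rfl, fun _ => rfl, fun r h1 h2 => by omega⟩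
      · rw [Function.update_of_ne e]
        have := h₂ a ha
        refine ⟨this.le, fun h => by have := this.lo_le h; omega, this.cls_eq, fun r h1 h2 h3 => ?_⟩
        rcases h1.eq_or_lt with rfl | h1
        · exact fun h => e h.symm
        · exact this.min r h1 h2 h3
    · by_cases e : q = p
      · subst e; rw [Function.update_self]
        exact h₂ _ (by omega)
      · rw [Function.update_of_ne e]
        exact g₂ q h1 (by omega)
  · rintro s' F ⟨h1, h2⟩
    refine ⟨by simpa using h1, fun p hp => h2 p hp (by omega), fun a ha => ?_⟩
    rw [F.a aSTAMP rfl]; exact (h₁ a (by omega)).2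
  · omega

/-- Visit the position `vp` of the class `va`. -/
def visitProg : Cmd Var Arr :=
  .set vb (aCLS.at (.cond .lt (vp.e + vm.e) vn.e (vp.e + vm.e) vn.e)) ;;
  .set vc (.cond .eq (aSTAMP.at vb.e) (va.e + lit 1) (aVAL.at vb.e) vp.e) ;;
  .put aNEW vp.e vc.e ;; .put aSTAMP vb.e (va.e + lit 1) ;; .put aVAL vb.e vc.e ;;
  .put aPAR vp.e (.cond .eq vp.e va.e (aPAR.at vp.e) va.e) ;;
  .put aBIR vp.e (.cond .eq vp.e va.e (aBIR.at vp.e) (vlev.e + lit 1)) ;;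
  .set vp (aNXT.at vp.e)

/-- What is known about the visited positions `V` when refining level `j`. -/
structure VisitInv (X : ℕ → ℕ) (j : ℕ) (bir₀ par₀ : ℕ → ℕ) (V : Finset ℕ)
    (new bir par : ℕ → ℕ) : Prop where
  new : ∀ q ∈ V, new q = cls X (j + 1) q
  bir : ∀ q, bir q = if q ∈ V ∧ cls X j q ≠ q then j + 1 else bir₀ q
  par : ∀ q, par q = if q ∈ V ∧ cls X j q ≠ q then cls X j q else par₀ q

/-- The stamps mark the pairs of classes seen with first class `a`. -/
structure StampInv (X : ℕ → ℕ) (n j a p : ℕ) (stamp val : ℕ → ℕ) : Prop where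
  le : ∀ b ≤ n, stamp b ≤ a + 1
  seen : ∀ q < p, q < n → cls X j q = a → stamp (cls X j (q + 2 ^ j)) = a + 1 ∧
    val (cls X j (q + 2 ^ j)) = cls X (j + 1) q
  stamped : ∀ b ≤ n, stamp b = a + 1 → ∃ q < p, q < n ∧ cls X j q = a ∧ cls X j (q + 2 ^ j) = b

/-- The positions visited before position `p` of class `a`. -/
noncomputable def visited (X : ℕ → ℕ) (n j a p : ℕ) : Finset ℕ :=
  (Finset.range n).filter fun q => cls X j q < a ∨ (cls X j q = a ∧ q < p)

theorem visited_insert {X : ℕ → ℕ} {n j a p p' : ℕ} (hp : p < n) (hc : cls X j p = a)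
    (hN : IsNext X n j a (p + 1) p') :
    p ∉ visited X n j a p ∧ visited X n j a p' = insert p (visited X n j a p) := by
  refine ⟨by simp [visited, hc], ?_⟩
  ext q
  simp only [visited, Finset.mem_filter, Finset.mem_range, Finset.mem_insert]
  constructor
  · rintro ⟨h1, h2 | ⟨h2, h3⟩⟩
    · exact Or.inr ⟨h1, Or.inl h2⟩
    · by_cases h4 : q < p
      · exact Or.inr ⟨h1, Or.inr ⟨h2, h4⟩⟩
      · by_cases h5 : q = p
        · exact Or.inl h5
        · exact absurd h2 (hN.min q (by omega) h3 h1)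
  · have h6 : p < p' := by
      rcases hN.le.eq_or_lt with h | h
      · omega
      · have := hN.lo_le h; omega
    rintro (rfl | ⟨h1, h2 | ⟨h2, h3⟩⟩)
    · exact ⟨hp, Or.inr ⟨hc, h6⟩⟩
    · exact ⟨h1, Or.inl h2⟩
    · exact ⟨h1, Or.inr ⟨h2, by omega⟩⟩

theorem visited_succ {X : ℕ → ℕ} {n j a p' : ℕ} (hN : IsNext X n j (a + 1) 0 p') :
    visited X n j (a + 1) p' = visited X n j a n := by
  ext q
  simp only [visited, Finset.mem_filter, Finset.mem_range]
  constructor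
  · rintro ⟨h1, h2 | ⟨h2, h3⟩⟩
    · exact ⟨h1, by omega⟩
    · exact absurd h2 (hN.min q (by omega) h3 h1)
  · rintro ⟨h1, h2⟩
    exact ⟨h1, by omega⟩

-- The name on level `j + 1` depends on the pair of names at `p` and `p + 2 ^ j`. While class `a` is
-- traversed, the stamp `a + 1` on `b` says that the pair of `a` and `b` has been met, and the value
-- stored with it is the position where this happened first. Classes come in increasing order, so
-- old stamps need no clearing. Positions of a class come in increasing order, so the stored value
-- is the first occurrence.
set_option maxHeartbeats 1000000 in
theorem visitProg_spec {X : ℕ → ℕ} {n j a p Z C : ℕ} (hD : Dim n Z C) (hW : IsWord X n)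
    (s : St Var Arr) (hn : s.v vn = n) (hj : s.v vlev = j) (hm : s.v vm = 2 ^ j)
    (hjn : 2 ^ j < 2 * n)
    (hcls : ClsInv X n j (s.a aCLS)) (hp : s.v vp = p) (ha : s.v va = a) (hpn : p < n)
    (hpa : cls X j p = a) {bir par : ℕ → ℕ}
    (hnxt : IsNext X n j a (p + 1) (s.a aNXT p))
    (hV : VisitInv X j bir par (visited X n j a p) (s.a aNEW) (s.a aBIR) (s.a aPAR))
    (hS : StampInv X n j a p (s.a aSTAMP) (s.a aVAL)) :
    WP Z C visitProg s 8 fun s' => s'.v vp = s.a aNXT p ∧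
      VisitInv X j bir par (visited X n j a (s'.v vp)) (s'.a aNEW) (s'.a aBIR) (s'.a aPAR) ∧
      StampInv X n j a (s'.v vp) (s'.a aSTAMP) (s'.a aVAL) := by
  have hZ := hD.len
  have hC := hD.lin
  have hj' : j < 2 ^ j := Nat.lt_two_pow_self
  have hap : a ≤ p := hpa ▸ cls_le
  obtain ⟨b, hb⟩ : ∃ b, b = cls X j (p + 2 ^ j) := ⟨_, rfl⟩
  -- All positions from `n` on have the name `n`, so an index out of range may be replaced by `n`.
  have hmin : s.a aCLS (if p + 2 ^ j < n then p + 2 ^ j else n) = b := by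
    split_ifs with h
    · rw [hcls _ (by omega), hb]
    · rw [hcls _ le_rfl, hW.cls_of_le le_rfl, hb, hW.cls_of_le (by omega)]
  have hix : (if p + 2 ^ j < n then p + 2 ^ j else n) ≤ n := by split_ifs <;> omega
  have hbn : b ≤ n := by
    rw [hb]
    rcases Nat.lt_or_ge (p + 2 ^ j) n with h | h
    · exact cls_le.trans h.le
    · rw [hW.cls_of_le h]
  have hval : (if s.a aSTAMP b = a + 1 then s.a aVAL b else p) = cls X (j + 1) p := by
    split_ifs with h
    · obtain ⟨q, h1, h2, h3, h4⟩ := hS.stamped b hbn h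
      rw [← h4, (hS.seen q h1 h2 h3).2, cls_succ_eq_iff]
      exact ⟨h3.trans hpa.symm, h4.trans hb⟩
    · refine (cls_unique rfl fun q hq hc => h ?_).symm
      rw [cls_succ_eq_iff] at hc
      have := (hS.seen q hq (by omega) (hc.1.trans hpa)).1
      rwa [hc.2, ← hb] at this
  have hcp : cls X (j + 1) p ≤ p := cls_le
  have hle := hnxt.le
  refine .cost (.set_seq (by simp [hn, hm, hp, hmin]; omega) fun s₁ a₁ b₁ c₁ => ?_)
    (le_refl (1 + (1 + (1 + (1 + (1 + (1 + (1 + 1))))))))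
  have d₁ : s₁.v vb = b := by rw [a₁]; simp [hn, hm, hp, hmin]
  have e₂ : (Ex.cond .eq (aSTAMP.at vb.e) (va.e + lit 1) (aVAL.at vb.e) vp.e).eval s₁ =
      cls X (j + 1) p := by simp [d₁, b₁, c₁, ha, hp, hval]
  refine .set_seq ⟨by simp [d₁, b₁, ha]; omega, by rw [e₂]; omega⟩ fun s₂ a₂ b₂ c₂ => ?_
  rw [e₂] at a₂
  have v₂ : s₂.v vb = b ∧ s₂.v vp = p ∧ s₂.v va = a ∧ s₂.v vlev = j ∧ s₂.a = s.a := by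
    simp [b₂, b₁, c₁, c₂, d₁, hp, ha, hj]
  clear e₂ b₂ b₁ c₁ c₂ d₁ a₁
  obtain ⟨f1, f2, f3, f4, f5⟩ := v₂
  refine .put_seq (by simp [f2]; omega) fun s₃ b₃ a₃ c₃ => ?_
  refine .put_seq (by simp [b₃, f1, f3]; omega) fun s₄ b₄ a₄ c₄ => ?_
  refine .put_seq (by simp [b₄, b₃, f1]; omega) fun s₅ b₅ a₅ c₅ => ?_
  refine .put_seq (by simp [b₅, b₄, b₃, f2, f3]; omega) fun s₆ b₆ a₆ c₆ => ?_
  refine .put_seq (by simp [b₆, b₅, b₄, b₃, f2, f3, f4]; omega) fun s₇ b₇ a₇ c₇ => ?_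
  refine .set (by simp [b₇, b₆, b₅, b₄, b₃, f2, c₇, c₆, c₅, c₄, c₃, f5]; omega)
    fun s₈ a₈ b₈ c₈ => ?_
  have g1 : s₈.v vp = s.a aNXT p := by
    rw [a₈]; simp [b₇, b₆, b₅, b₄, b₃, f2, c₇, c₆, c₅, c₄, c₃, f5]
  have g2 : s₈.a aNEW = Function.update (s.a aNEW) p (cls X (j + 1) p) := by
    simp [c₈, c₇, c₆, c₅, c₄, a₃, f2, f5, a₂]
  have g3 : s₈.a aSTAMP = Function.update (s.a aSTAMP) b (a + 1) := by
    simp [c₈, c₇, c₆, c₅, a₄, c₃, f2, f5, f1, f3, b₃]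
  have g4 : s₈.a aVAL = Function.update (s.a aVAL) b (cls X (j + 1) p) := by
    simp [c₈, c₇, c₆, a₅, c₄, c₃, f1, f5, a₂, b₄, b₃]
  have g5 : s₈.a aPAR = Function.update (s.a aPAR) p (if p = a then s.a aPAR p else a) := by
    simp [c₈, c₇, a₆, c₅, c₄, c₃, f2, f3, f5, b₅, b₄, b₃]
  have g6 : s₈.a aBIR = Function.update (s.a aBIR) p (if p = a then s.a aBIR p else j + 1) := by
    simp [c₈, a₇, c₆, c₅, c₄, c₃, f2, f3, f4, f5, b₆, b₅, b₄, b₃]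
  clear a₈ b₈ c₈ a₇ b₇ c₇ a₆ b₆ c₆ a₅ b₅ c₅ a₄ b₄ c₄ a₃ b₃ c₃ f1 f2 f3 f4 f5
  obtain ⟨hv1, hv2⟩ := visited_insert hpn hpa hnxt
  have hpp : p < s.a aNXT p := by
    rcases hle.eq_or_lt with h | h
    · omega
    · have := hnxt.lo_le h; omega
  rw [g1, g2, g3, g4, g5, g6, hv2]
  refine ⟨rfl, ⟨fun q hq => ?_, fun q => ?_, fun q => ?_⟩, ⟨fun c hc => ?_, fun q h1 h2 h3 => ?_,
    fun c h1 h2 => ?_⟩⟩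
  · by_cases e : q = p
    · subst e; simp
    · rw [Function.update_of_ne e]
      exact hV.new q (by simpa [e] using hq)
  · by_cases e : q = p
    · subst e
      have := hV.bir q
      rw [if_neg (fun h => hv1 h.1)] at this
      rw [Function.update_self, hpa, this]
      by_cases e' : q = a
      · simp [e']
      · simp [e', Ne.symm e']
    · rw [Function.update_of_ne e, hV.bir q]
      simp [e]
  · by_cases e : q = p
    · subst e
      have := hV.par q
      rw [if_neg (fun h => hv1 h.1)] at this
      rw [Function.update_self, hpa, this]
      by_cases e' : q = a
      · simp [e']
      · simp [e', Ne.symm e']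
    · rw [Function.update_of_ne e, hV.par q]
      simp [e]
  · by_cases e : c = b
    · subst e; simp
    · rw [Function.update_of_ne e]; exact hS.le c hc
  · have hqp : q ≤ p := by
      by_contra h
      exact hnxt.min q (by omega) h1 h2 h3
    by_cases e : cls X j (q + 2 ^ j) = b
    · rw [e]
      simp only [Function.update_self, true_and]
      rw [cls_succ_eq_iff]
      exact ⟨hpa.trans h3.symm, by rw [e, hb]⟩
    · rw [Function.update_of_ne e, Function.update_of_ne e]
      refine hS.seen q (lt_of_le_of_ne hqp ?_) h2 h3
      rintro rfl
      exact e hb.symm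
  · by_cases e : c = b
    · exact ⟨p, hpp, hpn, hpa, by rw [e, hb]⟩
    · rw [Function.update_of_ne e] at h2
      obtain ⟨q, k1, k2, k3, k4⟩ := hS.stamped c h1 h2
      exact ⟨q, by omega, k2, k3, k4⟩

/-- Compute the classes of level `vlev + 1`. -/
def refineProg : Cmd Var Arr :=
  chainProg ;; .set va (lit 0) ;; .set vp (aHEAD.at (lit 0)) ;;
  .loop vu (vn.e + vn.e) (.ite .lt vp.e vn.e visitProg
    (.set va (va.e + lit 1) ;; .set vp (aHEAD.at va.e))) ;;
  .loop vi vn.e (.put aCLS vi.e (aNEW.at vi.e))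

/-- The state of the traversal of the chains after `i` steps. -/
structure TravInv (X : ℕ → ℕ) (n j : ℕ) (bir par : ℕ → ℕ) (i : ℕ) (s : St Var Arr) : Prop where
  a_le : s.v va ≤ n
  p_le : s.v vp ≤ n
  cls_p : s.v vp < n → cls X j (s.v vp) = s.v va
  count : s.v va + (visited X n j (s.v va) (s.v vp)).card = i
  vis : VisitInv X j bir par (visited X n j (s.v va) (s.v vp)) (s.a aNEW) (s.a aBIR) (s.a aPAR)
  stamp : StampInv X n j (s.v va) (s.v vp) (s.a aSTAMP) (s.a aVAL)

/-- Positions that are not yet representatives are overwritten on every level. When one becomes a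
representative, its entries are those of the level just before, and they are frozen from then on. -/
theorem TreeInv.succ {X : ℕ → ℕ} {n j : ℕ} {bir par bir' par' new : ℕ → ℕ}
    (h : TreeInv X n j bir par) (hV : VisitInv X j bir par (Finset.range n) new bir' par') :
    TreeInv X n (j + 1) bir' par' := by
  intro r hr hc
  rw [hV.bir r, hV.par r]
  by_cases e : cls X j r = r
  · obtain ⟨h1, h2⟩ := h r hr e
    have h3 := (h1 j le_rfl).1 e
    simp only [e, ne_eq, not_true, and_false, if_false]
    refine ⟨fun i hi => ?_, h2⟩
    rcases hi.eq_or_lt with rfl | hi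
    · exact ⟨fun _ => by omega, fun _ => hc⟩
    · exact h1 i (by omega)
  · simp only [Finset.mem_range, hr, ne_eq, e, not_false_eq_true, and_true, if_true]
    refine ⟨fun i hi => ?_, fun _ => rfl⟩
    rcases hi.eq_or_lt with rfl | hi
    · exact ⟨fun _ => by omega, fun _ => hc⟩
    · exact ⟨fun h => absurd (rep_mono (by omega) h) e, fun h => by omega⟩

-- Every round of the traversal either visits a position or moves on to the next class. Hence the
-- class number plus the number of visited positions counts the rounds, and after `n + n` rounds
-- both are `n`.
set_option maxHeartbeats 600000 in
theorem refineProg_spec {X : ℕ → ℕ} {n j Z C : ℕ} (hD : Dim n Z C) (hW : IsWord X n)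
    (s : St Var Arr) (hn : s.v vn = n) (hj : s.v vlev = j) (hm : s.v vm = 2 ^ j)
    (hjn : 2 ^ j < 2 * n) (hcls : ClsInv X n j (s.a aCLS))
    (hT : TreeInv X n j (s.a aBIR) (s.a aPAR)) :
    WP Z C refineProg s (9 + n * 28) fun s' =>
      ClsInv X n (j + 1) (s'.a aCLS) ∧ TreeInv X n (j + 1) (s'.a aBIR) (s'.a aPAR) := by
  have hZ := hD.len
  have hC := hD.lin
  refine .cost (.seq (chainProg_spec hD s hn hcls) fun s₁ F₁ ⟨k1, k2, k3⟩ =>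
    .set_seq (by simp; omega) fun s₂ a₂ b₂ c₂ => .set_seq
    (by simp [c₂]; have := (k1 0 (by omega)).le; omega) fun s₃ a₃ b₃ c₃ => .seq (.loop
    (TravInv X n j (s.a aBIR) (s.a aPAR)) (n + n) 9
    (by simp [b₃, b₂, F₁.v vn rfl, hn]) (by simp [b₃, b₂, F₁.v vn rfl, hn]; omega) (by omega) ?_ ?_
    (fun _ _ _ _ h => ⟨h.1, h.2, h.3, h.4, h.5, h.6⟩)) fun s₄ F₄ h₄ =>
    .mono (.loop (fun i s' => ∀ q ≤ n, s'.a aCLS q = if q < i then s₄.a aNEW q else s₄.a aCLS q)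
      n 1 ?_ (by simp) (by omega) (by simp) ?_) le_rfl ?_)
    (?_ : (5 + n * 6) + (1 + (1 + ((1 + (n + n) * (9 + 1)) + (1 + n * (1 + 1))))) ≤ _)
  · have h0 := k1 0 (by omega)
    have ep : s₃.v vp = s₁.a aHEAD 0 := by rw [a₃]; simp [c₂]
    have ea : s₃.v va = 0 := by rw [b₃ _ (by simp), a₂]; simp
    have e : visited X n j 0 (s₁.a aHEAD 0) = ∅ := by
      ext q
      simp only [visited, Finset.mem_filter, Finset.mem_range, Finset.notMem_empty, iff_false]
      rintro ⟨h1, h2 | ⟨h2, h3⟩⟩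
      · omega
      · exact h0.min q (by omega) h3 h1 h2
    refine ⟨by rw [ea]; omega, by rw [ep]; exact h0.le, by rw [ep, ea]; exact h0.cls_eq, ?_, ?_, ?_⟩
    · rw [ea, ep, e]; rfl
    · rw [ea, ep, e]
      refine ⟨by simp, ?_, ?_⟩
      · simp [c₃, c₂, F₁.a aBIR rfl]
      · simp [c₃, c₂, F₁.a aPAR rfl]
    · rw [ea, ep, c₃, c₂]
      refine ⟨fun b hb => by rw [k3 b hb]; omega, fun q h1 h2 h3 => ?_, fun b hb h => ?_⟩
      · exact absurd h3 (h0.min q (by omega) h1 h2)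
      · rw [k3 b hb] at h; omega
  · intro i hi s₄ F₄ q₄ I
    have hn₄ : s₄.v vn = n := by rw [F₄.v vn rfl, b₃ _ (by simp), b₂ _ (by simp), F₁.v vn rfl, hn]
    have hj₄ : s₄.v vlev = j := by
      rw [F₄.v vlev rfl, b₃ _ (by simp), b₂ _ (by simp), F₁.v vlev rfl, hj]
    have hm₄ : s₄.v vm = 2 ^ j := by
      rw [F₄.v vm rfl, b₃ _ (by simp), b₂ _ (by simp), F₁.v vm rfl, hm]
    have hH : s₄.a aHEAD = s₁.a aHEAD := by rw [F₄.a aHEAD rfl, c₃, c₂]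
    have hN : s₄.a aNXT = s₁.a aNXT := by rw [F₄.a aNXT rfl, c₃, c₂]
    have hc₄ : s₄.a aCLS = s.a aCLS := by rw [F₄.a aCLS rfl, c₃, c₂, F₁.a aCLS rfl]
    refine .cost (.ite (c := 8) (by simp) (fun hlt s₅ e₅ f₅ => ?_) fun hlt s₅ e₅ f₅ => ?_) le_rfl
    · simp only [Ex.eval, hn₄, holds_lt] at hlt
      have hcp := I.cls_p hlt
      have hnx : IsNext X n j (s₄.v va) (s₄.v vp + 1) (s₄.a aNXT (s₄.v vp)) := by
        rw [hN, ← hcp]; exact k2 _ hlt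
      refine (visitProg_spec hD hW s₅ (by rw [e₅, hn₄]) (by rw [e₅, hj₄]) (by rw [e₅, hm₄]) hjn
        (by rw [f₅, hc₄]; exact hcls) (p := s₄.v vp) (a := s₄.v va) (by rw [e₅]) (by rw [e₅]) hlt
        hcp (bir := s.a aBIR) (par := s.a aPAR) (by rw [f₅]; exact hnx)
        (by rw [f₅]; exact I.vis) (by rw [f₅]; exact I.stamp)).mono le_rfl ?_
      rintro s₆ F₆ ⟨h1, h2, h3⟩
      have ea : s₆.v va = s₄.v va := by rw [F₆.v va rfl, e₅]
      rw [f₅] at h1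
      refine ⟨by rw [ea]; exact I.a_le, by rw [h1]; exact hnx.le,
        by rw [h1, ea]; exact hnx.cls_eq, ?_, by rw [ea]; exact h2, by rw [ea]; exact h3⟩
      obtain ⟨w1, w2⟩ := visited_insert hlt hcp hnx
      rw [ea, h1, w2, Finset.card_insert_of_notMem w1, ← I.count]; rfl
    · simp only [Ex.eval, hn₄, holds_lt] at hlt
      have hpn : s₄.v vp = n := by have := I.p_le; omega
      -- If the class number were already `n`, all positions would have been visited and all rounds
      -- used up.
      have han : s₄.v va < n := by
        refine lt_of_le_of_ne I.a_le fun h => ?_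
        have := I.count
        have h2 := Finset.card_filter_le (Finset.range n) fun q => cls X j q < s₄.v va ∨
          (cls X j q = s₄.v va ∧ q < s₄.v vp)
        have h3 : visited X n j (s₄.v va) (s₄.v vp) = Finset.range n := by
          ext q
          simp only [visited, Finset.mem_filter, Finset.mem_range, and_iff_left_iff_imp]
          intro hq
          left
          rw [h]; exact lt_of_le_of_lt cls_le hq
        rw [h3, Finset.card_range] at this
        omega
      have hnx := k1 (s₄.v va + 1) (by omega)
      rw [← hH] at hnx
      have hle := hnx.le
      refine .cost (.set_seq (by simp [e₅]; omega) fun s₆ a₆ b₆ c₆ => .set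
        (by simp [a₆, e₅, c₆, f₅]; omega) fun s₇ a₇ b₇ c₇ => ?_) (show 1 + 1 ≤ 8 by omega)
      have ep : s₇.v vp = s₄.a aHEAD (s₄.v va + 1) := by rw [a₇]; simp [a₆, e₅, c₆, f₅]
      have ea : s₇.v va = s₄.v va + 1 := by rw [b₇ _ (by simp), a₆]; simp [e₅]
      have evis : visited X n j (s₄.v va + 1) (s₄.a aHEAD (s₄.v va + 1)) =
          visited X n j (s₄.v va) (s₄.v vp) := by rw [visited_succ hnx, hpn]
      have eA : s₇.a = s₄.a := by rw [c₇, c₆, f₅]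
      refine ⟨by omega, by omega, by rw [ep, ea]; exact hnx.cls_eq, ?_, ?_, ?_⟩
      · rw [ep, ea, evis, ← I.count]; omega
      · rw [ep, ea, evis, eA]; exact I.vis
      · rw [ep, ea, eA]
        have hS := I.stamp
        refine ⟨fun b hb => (hS.le b hb).trans (by omega), fun q h1 h2 h3 => ?_, fun b hb h => ?_⟩
        · exact absurd h3 (hnx.min q (by omega) h1 h2)
        · have := hS.le b hb; omega
  · rw [Ex.eval, F₄.v vn rfl, b₃ _ (by simp), b₂ _ (by simp), F₁.v vn rfl, hn]
  · intro i hi s₅ F₅ q₅ h₅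
    refine .put (by simp [q₅]; omega) fun s₆ b₆ a₆ c₆ q hq => ?_
    rw [a₆]
    by_cases e : q = i
    · subst e; simp [q₅, F₅.a aNEW rfl]
    · simp only [Ex.eval, q₅, ne_eq, e, not_false_eq_true, Function.update_of_ne, h₅ q hq]
      split_ifs <;> first | rfl | omega
  · intro s₅ F₅ h₅
    have ha : s₄.v va = n := by
      have h1 := h₄.count
      have h2 := h₄.a_le
      have h3 : (visited X n j (s₄.v va) (s₄.v vp)).card ≤ n :=
        (Finset.card_filter_le _ _).trans (by simp)
      omega
    have hvis : visited X n j (s₄.v va) (s₄.v vp) = Finset.range n := by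
      ext q
      simp only [visited, Finset.mem_filter, Finset.mem_range, and_iff_left_iff_imp]
      intro hq
      left
      rw [ha]; exact lt_of_le_of_lt cls_le hq
    have hV := h₄.vis
    rw [hvis] at hV
    refine ⟨fun q hq => ?_, ?_⟩
    · rw [h₅ q hq]
      rcases hq.eq_or_lt with rfl | hq
      · rw [if_neg (by omega), F₄.a aCLS rfl, c₃, c₂, F₁.a aCLS rfl, hcls _ le_rfl,
          hW.cls_of_le le_rfl, hW.cls_of_le le_rfl]
      · rw [if_pos hq, hV.new q (by simpa using hq)]
    · rw [F₅.a aBIR rfl, F₅.a aPAR rfl]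
      exact hT.succ hV
  · omega

/-! ### Comparing factors by means of the tree of names. -/

/-- The state on level `j`. -/
structure Lev (X : ℕ → ℕ) (n j : ℕ) (s : St Var Arr) : Prop where
  len : s.v vn = n
  lev : s.v vlev = j
  pow : s.v vm = 2 ^ j
  cls : ClsInv X n j (s.a aCLS)
  tree : TreeInv X n j (s.a aBIR) (s.a aPAR)

theorem Lev.frame {X : ℕ → ℕ} {n j : ℕ} {s s' : St Var Arr} {p : Cmd Var Arr} (h : Lev X n j s)
    (F : Frame p s s') (hv : (p.wV vn || (p.wV vlev || p.wV vm)) = false := by rfl)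
    (ha : (p.wA aCLS || (p.wA aBIR || p.wA aPAR)) = false := by rfl) : Lev X n j s' := by
  simp only [Bool.or_eq_false_iff] at hv ha
  exact ⟨by rw [F.v _ hv.1, h.len], by rw [F.v _ hv.2.1, h.lev], by rw [F.v _ hv.2.2, h.pow],
    by rw [F.a _ ha.1]; exact h.cls, by rw [F.a _ ha.2.1, F.a _ ha.2.2]; exact h.tree⟩

/-- Replace the representatives `va`, `vb`, `vc`, `vp` by those of level `ve0`. -/
def climbProg : Cmd Var Arr :=
  .loop vu vlev.e (.set va (.cond .lt ve0.e (aBIR.at va.e) (aPAR.at va.e) va.e) ;;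
    .set vb (.cond .lt ve0.e (aBIR.at vb.e) (aPAR.at vb.e) vb.e) ;;
    .set vc (.cond .lt ve0.e (aBIR.at vc.e) (aPAR.at vc.e) vc.e) ;;
    .set vp (.cond .lt ve0.e (aBIR.at vp.e) (aPAR.at vp.e) vp.e))

/-- The state of climbing from the representative of `x` after `t` steps. -/
structure ClimbInv (X : ℕ → ℕ) (n i j : ℕ) (bir : ℕ → ℕ) (x t y : ℕ) : Prop where
  lt : y < n
  rep : cls X j y = y
  cls_eq : cls X i y = cls X i x
  bir_le : bir y ≤ max i (j - t)

theorem ClimbInv.init {X : ℕ → ℕ} {n i j : ℕ} {bir par : ℕ → ℕ} (hT : TreeInv X n j bir par)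
    {x : ℕ} (hx : x < n) (hij : i ≤ j) : ClimbInv X n i j bir x 0 (cls X j x) :=
  have h1 : cls X j x < n := lt_of_le_of_lt cls_le hx
  have h2 : cls X j (cls X j x) = cls X j x := cls_eq_of_le le_rfl
  ⟨h1, h2, cls_eq_of_le hij, le_max_of_le_right (((hT _ h1 h2).1 j le_rfl).1 h2)⟩

/-- The parent is a representative of level `bir y - 1`, so it was born strictly earlier, and it
keeps the name on every level below the birth of `y`. Hence `j` rounds suffice to come down to a
birth level of at most `i`. -/
theorem ClimbInv.step {X : ℕ → ℕ} {n i j : ℕ} {bir par : ℕ → ℕ} (hT : TreeInv X n j bir par)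
    {x t y : ℕ} (h : ClimbInv X n i j bir x t y) :
    ClimbInv X n i j bir x (t + 1) (if i < bir y then par y else y) := by
  obtain ⟨h1, h2⟩ := hT y h.lt h.rep
  have hb := h.bir_le
  split_ifs with hi
  · have hle : cls X (bir y - 1) y ≤ y := cls_le
    have hjb : bir y ≤ j := (h1 j le_rfl).1 h.rep
    have hr : cls X (bir y - 1) (cls X (bir y - 1) y) = cls X (bir y - 1) y := cls_eq_of_le le_rfl
    have hr' := rep_mono (show bir y - 1 ≤ j by omega) hr
    have hlt : cls X (bir y - 1) y < n := lt_of_le_of_lt hle h.lt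
    rw [h2 (by omega)]
    have := ((hT _ hlt hr').1 (bir y - 1) (by omega)).1 hr
    exact ⟨hlt, hr', (cls_eq_of_le (by omega)).trans h.cls_eq, by omega⟩
  · exact ⟨h.lt, h.rep, h.cls_eq, by omega⟩

theorem ClimbInv.final {X : ℕ → ℕ} {n i j : ℕ} {bir par : ℕ → ℕ} (hT : TreeInv X n j bir par)
    {x y : ℕ} (hij : i ≤ j) (h : ClimbInv X n i j bir x j y) : y = cls X i x := by
  have := h.bir_le
  rw [← h.cls_eq, ((hT y h.lt h.rep).1 i hij).2 (by omega)]

theorem climbProg_spec {X : ℕ → ℕ} {n i j Z C x₁ x₂ x₃ x₄ : ℕ} (hD : Dim n Z C) (s : St Var Arr)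
    (h : Lev X n j s) (hi : s.v ve0 = i) (hij : i ≤ j) (hjC : j < C) (h₁ : x₁ < n) (h₂ : x₂ < n)
    (h₃ : x₃ < n) (h₄ : x₄ < n) (e₁ : s.v va = cls X j x₁) (e₂ : s.v vb = cls X j x₂)
    (e₃ : s.v vc = cls X j x₃) (e₄ : s.v vp = cls X j x₄) :
    WP Z C climbProg s (1 + j * 5) fun s' => s'.v va = cls X i x₁ ∧ s'.v vb = cls X i x₂ ∧
      s'.v vc = cls X i x₃ ∧ s'.v vp = cls X i x₄ := by
  have hZ := hD.len
  have hC := hD.lin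
  have hT := h.tree
  refine .mono (.loop (fun t s' => ClimbInv X n i j (s.a aBIR) x₁ t (s'.v va) ∧
    ClimbInv X n i j (s.a aBIR) x₂ t (s'.v vb) ∧ ClimbInv X n i j (s.a aBIR) x₃ t (s'.v vc) ∧
    ClimbInv X n i j (s.a aBIR) x₄ t (s'.v vp)) j 4 (by simp [h.lev]) (by simp) hjC
    ⟨?_, ?_, ?_, ?_⟩ ?_) le_rfl ?_
  · rw [e₁]; exact .init hT h₁ hij
  · rw [e₂]; exact .init hT h₂ hij
  · rw [e₃]; exact .init hT h₃ hij
  · rw [e₄]; exact .init hT h₄ hij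
  · rintro t ht s₁ F q ⟨k₁, k₂, k₃, k₄⟩
    have i₀ : s₁.v ve0 = i := by rw [F.v ve0 rfl, hi]
    have b₀ : s₁.a aBIR = s.a aBIR := F.a aBIR rfl
    have p₀ : s₁.a aPAR = s.a aPAR := F.a aPAR rfl
    have l₁ := (k₁.step hT).lt
    have l₂ := (k₂.step hT).lt
    have l₃ := (k₃.step hT).lt
    have l₄ := (k₄.step hT).lt
    have o₁ := k₁.lt
    have o₂ := k₂.lt
    have o₃ := k₃.lt
    have o₄ := k₄.lt
    refine .cost (.set_seq (by simp [i₀, b₀, p₀]; omega) fun s₂ a₂ b₂ c₂ =>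
      .set_seq (by simp [b₂, c₂, i₀, b₀, p₀]; omega) fun s₃ a₃ b₃ c₃ =>
      .set_seq (by simp [b₃, c₃, b₂, c₂, i₀, b₀, p₀]; omega) fun s₄ a₄ b₄ c₄ =>
      .set (by simp [b₄, c₄, b₃, c₃, b₂, c₂, i₀, b₀, p₀]; omega) fun s₅ a₅ b₅ c₅ => ?_)
      (le_refl (1 + (1 + (1 + 1))))
    simp [a₅, b₅, c₅, a₄, b₄, c₄, a₃, b₃, c₃, a₂, b₂, c₂, i₀, b₀, p₀]
    exact ⟨k₁.step hT, k₂.step hT, k₃.step hT, k₄.step hT⟩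
  · rintro s' - ⟨k₁, k₂, k₃, k₄⟩
    exact ⟨k₁.final hT hij, k₂.final hT hij, k₃.final hT hij, k₄.final hT hij⟩

/-- Comparison of short factors. -/
def eqShort : Cmd Var Arr :=
  .set ve0 (lit 0) ;; .set ve1 (lit 1) ;;
  .loop vu vlev.e (.set ve2 (.cond .le (ve1.e + ve1.e) vel.e (lit 1) (lit 0)) ;;
    .set ve0 (ve0.e + ve2.e) ;; .set ve1 (ve1.e + ve1.e * ve2.e)) ;;
  .set va (aCLS.at vep.e) ;; .set vb (aCLS.at veq.e) ;;
  .set vc (aCLS.at (vep.e + (vel.e - ve1.e))) ;; .set vp (aCLS.at (veq.e + (vel.e - ve1.e))) ;;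
  climbProg ;;
  .set vres (.cond .eq va.e vb.e (.cond .eq vc.e vp.e (lit 1) (lit 0)) (lit 0))

/-- With `2 ^ i ≤ L < 2 * 2 ^ i`, two overlapping pieces of length `2 ^ i` cover the factor, and
their names of level `i` are recovered from the current level by climbing. So no table of older
names is kept, and the space stays linear. -/
theorem eqShort_spec {X : ℕ → ℕ} {n j Z C p q L : ℕ} (hD : Dim n Z C) (s : St Var Arr)
    (h : Lev X n j s) (hjn : 2 ^ j < 2 * n) (hp : s.v vep = p) (hq : s.v veq = q)
    (hL : s.v vel = L) (hL0 : 0 < L) (hLm : L < 2 ^ j) (hpn : p + L ≤ n) (hqn : q + L ≤ n) :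
    WP Z C eqShort s (9 + j * 9) fun s' => s'.v vres ≤ 1 ∧ (s'.v vres = 1 ↔ Agree X p q L) := by
  have hZ := hD.len
  have hC := hD.lin
  have hj : j < 2 ^ j := Nat.lt_two_pow_self
  refine .cost (.set_seq (by simp; omega) fun s₁ a₁ b₁ c₁ => .set_seq (by simp; omega)
    fun s₂ a₂ b₂ c₂ => .seq (.loop (fun i s' => s'.v ve1 = 2 ^ s'.v ve0 ∧ s'.v ve0 ≤ i ∧
      2 ^ s'.v ve0 ≤ L ∧ (s'.v ve0 = i ∨ L < 2 * 2 ^ s'.v ve0)) j 3 (by simp [b₂, b₁, h.lev])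
      (by simp) (by omega) ?_ ?_) fun s₃ F₃ ⟨g₁, g₂, g₃, g₄⟩ => ?_)
      (?_ : 1 + (1 + ((1 + j * (3 + 1)) +
        (1 + (1 + (1 + (1 + ((1 + j * 5) + 1))))))) ≤ _)
  · simp [b₂, a₂, a₁]; omega
  · rintro i hi s₃ F₃ q₃ ⟨g₁, g₂, g₃, g₄⟩
    have hL₃ : s₃.v vel = L := by rw [F₃.v vel rfl, b₂ _ (by simp), b₁ _ (by simp), hL]
    obtain ⟨v, hv⟩ : ∃ v, v = if 2 ^ s₃.v ve0 + 2 ^ s₃.v ve0 ≤ L then 1 else 0 := ⟨_, rfl⟩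
    have hv1 : v ≤ 1 := by rw [hv]; split_ifs <;> omega
    have ev : (Ex.cond .le (ve1.e + ve1.e) vel.e (lit 1) (lit 0)).eval s₃ = v := by
      simp [hL₃, g₁, hv]
    have hmul : 2 ^ s₃.v ve0 * v ≤ 2 ^ s₃.v ve0 := by
      calc _ ≤ 2 ^ s₃.v ve0 * 1 := Nat.mul_le_mul_left _ hv1
        _ = _ := mul_one _
    refine .cost (.set_seq ⟨by simp [g₁]; omega, by rw [ev]; omega⟩ fun s₄ a₄ b₄ c₄ =>
      .set_seq (by rw [ev] at a₄; simp [a₄, b₄]; omega) fun s₅ a₅ b₅ c₅ =>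
      .set (by rw [ev] at a₄; simp [b₅, a₄, b₄, g₁]; omega) fun s₆ a₆ b₆ c₆ => ?_)
      (le_refl (1 + (1 + 1)))
    rw [ev] at a₄
    simp only [a₆, b₆, a₅, b₅, a₄, b₄, g₁, eval_add, eval_mul, Ex.eval, ne_eq, reduceCtorEq,
      not_false_eq_true, op_add, op_mul]
    by_cases hc : 2 ^ s₃.v ve0 + 2 ^ s₃.v ve0 ≤ L
    · rw [if_pos hc] at hv
      subst hv
      rw [pow_succ]
      omega
    · rw [if_neg hc] at hv
      subst hv
      simp only [mul_zero, add_zero]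
      exact ⟨trivial, by omega, g₃, Or.inr (by omega)⟩
  · obtain ⟨i, hi⟩ : ∃ i, i = s₃.v ve0 := ⟨_, rfl⟩
    rw [← hi] at g₁ g₂ g₃ g₄
    have hL2 : L < 2 * 2 ^ i := by
      rcases g₄ with rfl | g₄
      · omega
      · exact g₄
    have k₃ : Lev X n j s₃ := by
      refine Lev.frame ⟨?_, ?_, ?_, ?_, ?_⟩ F₃
      all_goals simp [b₂, b₁, c₂, c₁]
      exacts [h.len, h.lev, h.pow, h.cls, h.tree]
    have hp₃ : s₃.v vep = p := by rw [F₃.v vep rfl, b₂ _ (by simp), b₁ _ (by simp), hp]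
    have hq₃ : s₃.v veq = q := by rw [F₃.v veq rfl, b₂ _ (by simp), b₁ _ (by simp), hq]
    have hL₃ : s₃.v vel = L := by rw [F₃.v vel rfl, b₂ _ (by simp), b₁ _ (by simp), hL]
    have x₁ := k₃.cls p (by omega)
    have x₂ := k₃.cls q (by omega)
    have x₃ := k₃.cls (p + (L - 2 ^ i)) (by omega)
    have x₄ := k₃.cls (q + (L - 2 ^ i)) (by omega)
    have y₁ : cls X j p ≤ p := cls_le
    have y₂ : cls X j q ≤ q := cls_le
    have y₃ : cls X j (p + (L - 2 ^ i)) ≤ p + (L - 2 ^ i) := cls_le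
    have y₄ : cls X j (q + (L - 2 ^ i)) ≤ q + (L - 2 ^ i) := cls_le
    have hi0 : 0 < 2 ^ i := by positivity
    refine .set_seq (by simp [hp₃, x₁]; omega) fun s₄ a₄ b₄ c₄ => .set_seq
      (by simp [b₄, c₄, hq₃, x₂]; omega) fun s₅ a₅ b₅ c₅ => .set_seq
      (by simp [b₅, c₅, b₄, c₄, hp₃, hL₃, g₁, x₃]; omega) fun s₆ a₆ b₆ c₆ => .set_seq
      (by simp [b₆, c₆, b₅, c₅, b₄, c₄, hq₃, hL₃, g₁, x₄]; omega) fun s₇ a₇ b₇ c₇ => ?_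
    refine .seq (climbProg_spec (X := X) (n := n) (j := j) (i := i) (x₁ := p) (x₂ := q) (x₃ := p + (L - 2 ^ i))
      (x₄ := q + (L - 2 ^ i)) hD s₇ ?_ ?_ g₂ (by omega) (by omega) (by omega) (by omega)
      (by omega) ?_ ?_ ?_ ?_) fun s₈ F₈ ⟨z₁, z₂, z₃, z₄⟩ => .set ?_ fun s₉ a₉ b₉ c₉ => ?_
    · refine ⟨?_, ?_, ?_, ?_, ?_⟩
      all_goals simp [b₇, b₆, b₅, b₄, c₇, c₆, c₅, c₄]
      exacts [k₃.len, k₃.lev, k₃.pow, k₃.cls, k₃.tree]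
    · simp [b₇, b₆, b₅, b₄, hi]
    · simp [b₇, b₆, b₅, a₄, hp₃, x₁]
    · simp [b₇, b₆, a₅, b₄, c₄, hq₃, x₂]
    · simp [b₇, a₆, c₅, b₅, b₄, c₄, hp₃, hL₃, g₁, x₃]
    · simp [a₇, c₆, b₆, c₅, b₅, b₄, c₄, hq₃, hL₃, g₁, x₄]
    · refine ⟨by simp; omega, ?_⟩
      exact ite_lt_of (ite_lt_of (by omega : 1 < C) (by omega : 0 < C)) (by omega : 0 < C)
    · rw [agree_iff_cover g₃ (by omega), ← cls_eq_iff, ← cls_eq_iff, a₉]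
      simp only [Ex.eval, holds_eq, z₁, z₂, z₃, z₄]
      clear * - hZ
      split_ifs <;> simp [*]
  · omega

/-- Comparison of long factors. -/
def eqLong : Cmd Var Arr :=
  .set ve0 (vel.e - vm.e) ;; .set ve1 (.cond .lt vm.e ve0.e vm.e ve0.e) ;;
  .set ve2 (.cond .lt (vm.e + vm.e) ve0.e (vm.e + vm.e) ve0.e) ;;
  .set vres (.cond .eq (aCLS.at vep.e) (aCLS.at veq.e)
    (.cond .eq (aCLS.at (vep.e + ve1.e)) (aCLS.at (veq.e + ve1.e))
      (.cond .eq (aCLS.at (vep.e + ve2.e)) (aCLS.at (veq.e + ve2.e))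
        (.cond .eq (aCLS.at (vep.e + ve0.e)) (aCLS.at (veq.e + ve0.e)) (lit 1) (lit 0)) (lit 0))
      (lit 0)) (lit 0))

/-- Pieces at the offsets `0`, `m`, `2 * m` and `L - m`, pushed back where they would stick out,
cover a length of up to `4 * m`. -/
theorem agree_iff_cover_four {X : ℕ → ℕ} {p q L m o₁ o₂ o₃ : ℕ} (h₁ : m ≤ L) (h₂ : L ≤ 4 * m)
    (e₁ : o₁ = min m (L - m)) (e₂ : o₂ = min (m + m) (L - m)) (e₃ : o₃ = L - m) :
    Agree X p q L ↔ Agree X p q m ∧ Agree X (p + o₁) (q + o₁) m ∧ Agree X (p + o₂) (q + o₂) m ∧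
      Agree X (p + o₃) (q + o₃) m := by
  have key : ∀ o, o + m ≤ L → Agree X p q L → Agree X (p + o) (q + o) m := fun o ho h i hi => by
    rw [add_assoc, add_assoc]; exact h _ (by omega)
  refine ⟨fun h => ⟨h.mono h₁, key _ (by omega) h, key _ (by omega) h, key _ (by omega) h⟩, ?_⟩
  rintro ⟨h₁, h₂, h₃, h₄⟩ i hi
  have key : ∀ o, Agree X (p + o) (q + o) m → o ≤ i → i < o + m → X (p + i) = X (q + i) := by
    intro o h h1 h2
    have := h (i - o) (by omega)
    rwa [add_assoc, add_assoc, Nat.add_sub_cancel' h1] at this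
  by_cases c₁ : i < m
  · exact h₁ i c₁
  by_cases c₂ : i < o₁ + m
  · exact key o₁ h₂ (by omega) c₂
  by_cases c₃ : i < o₂ + m
  · exact key o₂ h₃ (by omega) c₃
  · exact key o₃ h₄ (by omega) (by omega)

theorem eqLong_spec {X : ℕ → ℕ} {n j Z C p q L : ℕ} (hD : Dim n Z C) (s : St Var Arr)
    (h : Lev X n j s) (hp : s.v vep = p) (hq : s.v veq = q)
    (hL : s.v vel = L) (hLm : 2 ^ j ≤ L) (hLm' : L ≤ 4 * 2 ^ j) (hpn : p + L ≤ n)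
    (hqn : q + L ≤ n) :
    WP Z C eqLong s 4 fun s' => s'.v vres ≤ 1 ∧ (s'.v vres = 1 ↔ Agree X p q L) := by
  have hZ := hD.len
  have hC := hD.lin
  obtain ⟨m, hm⟩ : ∃ m, m = 2 ^ j := ⟨_, rfl⟩
  have hm₀ : s.v vm = m := by rw [h.pow, hm]
  obtain ⟨o₁, e₁⟩ : ∃ o, o = min m (L - m) := ⟨_, rfl⟩
  obtain ⟨o₂, e₂⟩ : ∃ o, o = min (m + m) (L - m) := ⟨_, rfl⟩
  obtain ⟨o₃, e₃⟩ : ∃ o, o = L - m := ⟨_, rfl⟩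
  rw [← hm] at hLm hLm'
  have u₁ : (if m < o₃ then m else o₃) = o₁ := by split_ifs <;> omega
  have u₂ : (if m + m < o₃ then m + m else o₃) = o₂ := by split_ifs <;> omega
  refine .cost (.set_seq (by simp [hL, hm₀]; omega) fun s₁ a₁ b₁ c₁ => .set_seq ?_
    fun s₂ a₂ b₂ c₂ => .set_seq ?_ fun s₃ a₃ b₃ c₃ => .set ⟨?_, ?_⟩ fun s₄ a₄ b₄ c₄ => ?_)
    (le_refl (1 + (1 + (1 + 1))))
  · simp [a₁, b₁, hL, hm₀, ← e₃, u₁]; omega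
  · simp [b₂, a₁, b₁, hL, hm₀, ← e₃, u₂]; omega
  all_goals
    have f₁ : s₃.v ve0 = o₃ := by simp [b₃, b₂, a₁, hL, hm₀, ← e₃]
    have f₂ : s₃.v ve1 = o₁ := by simp [b₃, a₂, a₁, b₁, hL, hm₀, ← e₃, u₁]
    have f₃ : s₃.v ve2 = o₂ := by simp [a₃, b₂, a₁, b₁, hL, hm₀, ← e₃, u₂]
    have f₄ : s₃.v vep = p := by simp [b₃, b₂, b₁, hp]
    have f₅ : s₃.v veq = q := by simp [b₃, b₂, b₁, hq]
    have f₆ : s₃.a aCLS = s.a aCLS := by simp [c₃, c₂, c₁]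
  · clear a₁ a₂ a₃ b₁ b₂ b₃
    simp [f₁, f₂, f₃, f₄, f₅]
    omega
  · have h1 : 1 < C := by omega
    have h0 : 0 < C := by omega
    exact ite_lt_of (ite_lt_of (ite_lt_of (ite_lt_of h1 h0) h0) h0) h0
  · rw [agree_iff_cover_four hLm hLm' e₁ e₂ e₃, hm, ← cls_eq_iff, ← cls_eq_iff, ← cls_eq_iff,
      ← cls_eq_iff, a₄]
    simp only [Ex.eval, eval_add, op_add, holds_eq, f₁, f₂, f₃, f₄, f₅, f₆]
    rw [h.cls _ (by omega), h.cls _ (by omega), h.cls _ (by omega), h.cls _ (by omega),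
      h.cls _ (by omega), h.cls _ (by omega), h.cls _ (by omega), h.cls _ (by omega)]
    clear * - hZ
    split_ifs <;> simp [*]

/-- Comparison of factors of length at most `4 * 2 ^ vlev`. -/
def eqProg : Cmd Var Arr :=
  .ite .lt vel.e vm.e (.ite .eq vel.e (lit 0) (.set vres (lit 1)) eqShort) eqLong

theorem eqProg_spec {X : ℕ → ℕ} {n j Z C p q L : ℕ} (hD : Dim n Z C) (s : St Var Arr)
    (h : Lev X n j s) (hjn : 2 ^ j < 2 * n) (hp : s.v vep = p) (hq : s.v veq = q)
    (hL : s.v vel = L) (hLm : L ≤ 4 * 2 ^ j) (hpn : p + L ≤ n) (hqn : q + L ≤ n) :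
    WP Z C eqProg s (if L < 2 ^ j then 11 + j * 9 else 5)
      fun s' => s'.v vres ≤ 1 ∧ (s'.v vres = 1 ↔ Agree X p q L) := by
  have hZ := hD.len
  have hC := hD.lin
  split_ifs with hc
  · refine .cost (.ite (c := 10 + j * 9) (by simp) (fun _ s₁ e₁ f₁ => ?_) fun h' => ?_) (by omega)
    · refine .cost (.ite (c := 9 + j * 9) (by simp; omega) (fun h' s₂ e₂ f₂ => ?_)
        fun h' s₂ e₂ f₂ => ?_) (by omega)
      · refine .cost (.set (by simp; omega) fun s₃ a₃ b₃ c₃ => ?_) (by omega)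
        have hL0 : L = 0 := by simpa [e₁, hL] using h'
        subst hL0
        simp [a₃, Agree]
      · have hL0 : L ≠ 0 := by simpa [e₁, hL] using h'
        refine eqShort_spec hD s₂ ?_ hjn (by rw [e₂, e₁, hp]) (by rw [e₂, e₁, hq])
          (by rw [e₂, e₁, hL]) (by omega) hc hpn hqn
        exact ⟨by rw [e₂, e₁, h.len], by rw [e₂, e₁, h.lev], by rw [e₂, e₁, h.pow],
          by rw [f₂, f₁]; exact h.cls, by rw [f₂, f₁]; exact h.tree⟩
    · exact absurd (by simpa [hL, h.pow] using hc) h'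
  · refine .cost (.ite (c := 4) (by simp) (fun h' => ?_) fun _ s₁ e₁ f₁ => ?_) (by omega)
    · exact absurd (by simpa [hL, h.pow] using h') hc
    · refine eqLong_spec hD s₁ ?_ (by rw [e₁, hp]) (by rw [e₁, hq])
        (by rw [e₁, hL]) (by omega) hLm hpn hqn
      exact ⟨by rw [e₁, h.len], by rw [e₁, h.lev], by rw [e₁, h.pow],
          by rw [f₁]; exact h.cls, by rw [f₁]; exact h.tree⟩

/-! ### Runs of occurrences -/

/-- `p` is at most the length of the window at `w`, a period of the window, and at most the
distance of any two of its occurrences before `i`. -/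
structure GapInv (X : ℕ → ℕ) (m w i prev p : ℕ) : Prop where
  pos : 0 < p
  le : p ≤ m
  per : Agree X w (w + p) (m - p)
  min : ∀ t t', t < t' → t' < i → Agree X w t m → Agree X w t' m → p ≤ t' - t
  last : (prev = 0 ∧ ∀ t < i, ¬ Agree X w t m) ∨ ∃ l < i, prev = l + m + 1 ∧ Agree X w l m ∧
    ∀ t, l < t → t < i → ¬ Agree X w t m

/-- Overlapping occurrences force their distance to be a period of the window. -/
theorem agree_shift {X : ℕ → ℕ} {w t t' m : ℕ} (h : Agree X w t m) (h' : Agree X w t' m)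
    (htt : t < t') : Agree X w (w + (t' - t)) (m - (t' - t)) := fun x hx => by
  rw [h' x (by omega), add_assoc, h _ (by omega)]
  congr 1; omega

theorem GapInv.step {X : ℕ → ℕ} {m w i prev p : ℕ} (h : GapInv X m w i prev p)
    (ho : Agree X w i m) :
    GapInv X m w (i + 1) (i + m + 1)
      (if i + m + 1 - prev < p then i + m + 1 - prev else p) := by
  rcases h.last with ⟨h1, h2⟩ | ⟨l, h1, h2, h3, h4⟩
  · have := h.le
    -- The previous occurrence `l` is stored as `l + m + 1`, with `0` for none. Without a previous
    -- occurrence the computed gap exceeds `m`, so it is never taken for a short one.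
    rw [if_neg (by omega)]
    refine ⟨h.pos, h.le, h.per, fun t t' a b c d => ?_,
      Or.inr ⟨i, by omega, rfl, ho, fun t a b => by omega⟩⟩
    exact absurd c (h2 t (by omega))
  · rw [show i + m + 1 - prev = i - l by omega]
    have hm : ∀ q, q ≤ i - l → q ≤ p → ∀ t t', t < t' → t' < i + 1 → Agree X w t m →
        Agree X w t' m → q ≤ t' - t := by
      intro q q1 q2 t t' a b c d
      by_cases e : t' = i
      · by_cases e' : l < t
        · exact absurd c (h4 t e' (by omega))
        · omega
      · exact q2.trans (h.min t t' a (by omega) c d)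
    have hl : ∃ l' < i + 1, i + m + 1 = l' + m + 1 ∧ Agree X w l' m ∧
        ∀ t, l' < t → t < i + 1 → ¬ Agree X w t m :=
      ⟨i, by omega, rfl, ho, fun t a b => by omega⟩
    have := h.le
    split_ifs with hc
    · exact ⟨by omega, by omega, agree_shift h3 ho h1, hm _ le_rfl hc.le, Or.inr hl⟩
    · exact ⟨h.pos, h.le, h.per, hm _ (by omega) le_rfl, Or.inr hl⟩

theorem GapInv.skip {X : ℕ → ℕ} {m w i prev p : ℕ} (h : GapInv X m w i prev p)
    (ho : ¬ Agree X w i m) : GapInv X m w (i + 1) prev p := by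
  refine ⟨h.pos, h.le, h.per, fun t t' a b c d => ?_, ?_⟩
  · rcases Nat.lt_succ_iff_lt_or_eq.1 b with b | rfl
    · exact h.min t t' a b c d
    · exact absurd d ho
  · rcases h.last with ⟨h1, h2⟩ | ⟨l, h1, h2, h3, h4⟩
    · refine Or.inl ⟨h1, fun t ht => ?_⟩
      rcases Nat.lt_succ_iff_lt_or_eq.1 ht with b | rfl
      · exact h2 t b
      · exact ho
    · refine Or.inr ⟨l, by omega, h2, h3, fun t a ht => ?_⟩
      rcases Nat.lt_succ_iff_lt_or_eq.1 ht with b | rfl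
      · exact h4 t a b
      · exact ho

/-- The runs of occurrences of the window at `w` found before `i`. -/
structure RunsInv (X : ℕ → ℕ) (m w p i prev cnt : ℕ) (F L : ℕ → ℕ) : Prop where
  last : (prev = 0 ∧ cnt = 0 ∧ ∀ t < i, ¬ Agree X w t m) ∨ (0 < cnt ∧ prev = L (cnt - 1) + m + 1 ∧
    ∀ t, L (cnt - 1) < t → t < i → ¬ Agree X w t m)
  lt : ∀ r < cnt, L r < i
  le : ∀ r < cnt, F r ≤ L r
  dvd : ∀ r < cnt, p ∣ L r - F r
  occ : ∀ r < cnt, ∀ t, F r ≤ t → t ≤ L r → p ∣ t - F r → Agree X w t m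
  pre : ∀ r < cnt, ∀ t, t + p = F r → ¬ Agree X w t m
  post : ∀ r, r + 1 < cnt → ¬ Agree X w (L r + p) m
  cover : ∀ t < i, Agree X w t m → ∃ r < cnt, F r ≤ t ∧ t ≤ L r ∧ p ∣ t - F r
  sep : ∀ r, r + 1 < cnt → L r < F (r + 1) ∧ m < 2 * (F (r + 1) - L r)
  cnt_le : cnt ≤ i

theorem RunsInv.skip {X : ℕ → ℕ} {m w p i prev cnt : ℕ} {F L : ℕ → ℕ}
    (h : RunsInv X m w p i prev cnt F L) (ho : ¬ Agree X w i m) :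
    RunsInv X m w p (i + 1) prev cnt F L := by
  refine ⟨?_, fun r hr => (h.lt r hr).trans (by omega), h.le, h.dvd, h.occ, h.pre, h.post,
    fun t ht hot => ?_, h.sep, h.cnt_le.trans (by omega)⟩
  · rcases h.last with ⟨h1, h2, h3⟩ | ⟨h1, h2, h3⟩
    · refine Or.inl ⟨h1, h2, fun t ht => ?_⟩
      rcases Nat.lt_succ_iff_lt_or_eq.1 ht with b | rfl
      · exact h3 t b
      · exact ho
    · refine Or.inr ⟨h1, h2, fun t a ht => ?_⟩
      rcases Nat.lt_succ_iff_lt_or_eq.1 ht with b | rfl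
      · exact h3 t a b
      · exact ho
  · rcases Nat.lt_succ_iff_lt_or_eq.1 ht with b | rfl
    · exact h.cover t b hot
    · exact absurd hot ho

theorem RunsInv.extend {X : ℕ → ℕ} {m w p i prev cnt : ℕ} {F L : ℕ → ℕ}
    (h : RunsInv X m w p i prev cnt F L) (hp : 0 < p) (hpm : p ≤ m) (ho : Agree X w i m)
    (hg : i + m + 1 - prev = p) :
    0 < cnt ∧ RunsInv X m w p (i + 1) (i + m + 1) cnt F (Function.update L (cnt - 1) i) := by
  rcases h.last with ⟨h1, h2, h3⟩ | ⟨h1, h2, h3⟩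
  · omega
  have hlt := h.lt (cnt - 1) (by omega)
  have hle := h.le (cnt - 1) (by omega)
  have hi : i = L (cnt - 1) + p := by omega
  have hd : p ∣ i - F (cnt - 1) := by
    rw [show i - F (cnt - 1) = L (cnt - 1) - F (cnt - 1) + p by omega]
    exact dvd_add (h.dvd _ (by omega)) dvd_rfl
  have hn : ∀ r, r + 1 < cnt → Function.update L (cnt - 1) i r = L r := fun r hr =>
    Function.update_of_ne (by omega) _ _
  have hge : ∀ r < cnt, L r ≤ Function.update L (cnt - 1) i r := fun r hr => by
    by_cases e : r = cnt - 1
    · subst e; rw [Function.update_self]; omega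
    · rw [hn r (by omega)]
  refine ⟨h1, ⟨Or.inr ⟨h1, by simp, fun t a b => ?_⟩, fun r hr => ?_, fun r hr =>
    (h.le r hr).trans (hge r hr), fun r hr => ?_, fun r hr t a b c => ?_, h.pre, fun r hr => ?_,
    fun t ht hot => ?_, fun r hr => ?_, h.cnt_le.trans (by omega)⟩⟩
  · rw [Function.update_self] at a; omega
  · by_cases e : r = cnt - 1
    · subst e; simp
    · rw [hn r (by omega)]; have := h.lt r hr; omega
  · by_cases e : r = cnt - 1
    · subst e; simpa using hd
    · rw [hn r (by omega)]; exact h.dvd r hr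
  · by_cases e : r = cnt - 1
    · subst e
      rw [Function.update_self] at b
      by_cases e' : t ≤ L (cnt - 1)
      · exact h.occ _ hr t a e' c
      · have h5 : p ∣ i - t := by
          rw [show i - t = (i - F (cnt - 1)) - (t - F (cnt - 1)) by omega]
          exact Nat.dvd_sub hd c
        by_cases e'' : i = t
        · rw [← e'']; exact ho
        · have := Nat.le_of_dvd (by omega) h5; omega
    · rw [hn r (by omega)] at b
      exact h.occ r hr t a b c
  · rw [hn r (by omega)]; exact h.post r hr
  · by_cases e : t = i
    · exact ⟨cnt - 1, by omega, by omega, by simp [e], by rw [e]; exact hd⟩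
    · obtain ⟨r, r1, r2, r3, r4⟩ := h.cover t (by omega) hot
      exact ⟨r, r1, r2, r3.trans (hge r r1), r4⟩
  · rw [hn r (by omega)]; exact h.sep r hr

/-- No gap is smaller than `p`, so a gap different from `p` is larger. By `gap_eq_period` it must
even exceed `m / 2`, which bounds the number of runs. -/
theorem RunsInv.start {X : ℕ → ℕ} {m w p i prev cnt : ℕ} {F L : ℕ → ℕ}
    (h : RunsInv X m w p i prev cnt F L) (hp : 0 < p)
    (hper : Agree X w (w + p) (m - p))
    (hmin : ∀ t t', t < t' → t' ≤ i → Agree X w t m → Agree X w t' m → p ≤ t' - t)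
    (ho : Agree X w i m) (hg : i + m + 1 - prev ≠ p) :
    RunsInv X m w p (i + 1) (i + m + 1) (cnt + 1) (Function.update F cnt i)
      (Function.update L cnt i) := by
  have hn : ∀ f : ℕ → ℕ, ∀ r < cnt, Function.update f cnt i r = f r := fun f r hr =>
    Function.update_of_ne (by omega) _ _
  have hlast : 0 < cnt → Agree X w (L (cnt - 1)) m ∧ L (cnt - 1) < i ∧ p < i - L (cnt - 1) ∧
      ∀ t, L (cnt - 1) < t → t < i → ¬ Agree X w t m := by
    intro hc
    rcases h.last with ⟨h1, h2, h3⟩ | ⟨h1, h2, h3⟩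
    · omega
    · have a := h.occ (cnt - 1) (by omega) _ (h.le _ (by omega)) le_rfl (h.dvd _ (by omega))
      have b := h.lt (cnt - 1) (by omega)
      have c := hmin _ i b le_rfl a ho
      exact ⟨a, b, by omega, h3⟩
  refine ⟨Or.inr ⟨by omega, by simp, fun t a b => ?_⟩, fun r hr => ?_, fun r hr => ?_,
    fun r hr => ?_, fun r hr t a b c => ?_, fun r hr t a => ?_, fun r hr => ?_,
    fun t ht hot => ?_, fun r hr => ?_, by have := h.cnt_le; omega⟩
  · simp at a; omega
  · by_cases e : r = cnt
    · subst e; simp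
    · rw [hn L r (by omega)]; have := h.lt r (by omega); omega
  · by_cases e : r = cnt
    · subst e; simp
    · rw [hn L r (by omega), hn F r (by omega)]; exact h.le r (by omega)
  · by_cases e : r = cnt
    · subst e; simp
    · rw [hn L r (by omega), hn F r (by omega)]; exact h.dvd r (by omega)
  · by_cases e : r = cnt
    · subst e
      simp only [Function.update_self] at a b
      rw [show t = i by omega]; exact ho
    · rw [hn F r (by omega)] at a c
      rw [hn L r (by omega)] at b
      exact h.occ r (by omega) t a b c
  · by_cases e : r = cnt
    · subst e
      rw [Function.update_self] at a
      intro hot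
      obtain ⟨r', r1, r2, r3, r4⟩ := h.cover t (by omega) hot
      obtain ⟨k1, k2, k3, k4⟩ := hlast (by omega)
      have : ¬ L (r - 1) < t := fun h5 => k4 t h5 (by omega) hot
      omega
    · rw [hn F r (by omega)] at a
      exact h.pre r (by omega) t a
  · rw [hn L r (by omega)]
    by_cases e : r + 1 = cnt
    · obtain ⟨k1, k2, k3, k4⟩ := hlast (by omega)
      rw [← e, Nat.add_sub_cancel] at k2 k3 k4
      exact k4 _ (by omega) (by omega)
    · exact h.post r (by omega)
  · by_cases e : t = i
    · subst e; exact ⟨cnt, by omega, by simp, by simp, by simp⟩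
    · obtain ⟨r, r1, r2, r3, r4⟩ := h.cover t (by omega) hot
      refine ⟨r, by omega, ?_⟩
      rw [hn L r r1, hn F r r1]
      exact ⟨r2, r3, r4⟩
  · rw [hn L r (by omega)]
    by_cases e : r + 1 = cnt
    · obtain ⟨k1, k2, k3, k4⟩ := hlast (by omega)
      rw [← e, Nat.add_sub_cancel] at k1 k2 k3 k4
      rw [← e, Function.update_self]
      refine ⟨k2, ?_⟩
      by_contra hc
      -- A gap of at most `m / 2` and larger than `p` adds up with `p` to at most `m`, so the lemma
      -- applies and makes it equal to `p`.
      have := gap_eq_period (t := L r) (g := i - L r) hp k3.le (by omega) (m := m) (X := X)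
        (fun x hx => by
          have h1 := hper x hx
          rw [add_assoc] at h1
          rw [add_assoc, ← k1 x (by omega), ← k1 (p + x) (by omega), h1])
        (by rw [show L r + (i - L r) = i by omega]; exact k1.symm.trans ho)
        (fun u u1 u2 hu => k4 u u1 (by omega) (k1.trans hu))
      omega
    · rw [hn F (r + 1) (by omega)]; exact h.sep r (by omega)

/-- All runs of occurrences of the window at `w`. -/
structure Wins (X : ℕ → ℕ) (n m w p cnt : ℕ) (F L : ℕ → ℕ) : Prop where
  pos : 0 < p
  p_le : p ≤ m
  per : Agree X w (w + p) (m - p)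
  run : ∀ r < cnt, IsRun X w m p (F r) (L r)
  cover : ∀ t < n, Agree X w t m → ∃ r < cnt, F r ≤ t ∧ t ≤ L r ∧ p ∣ t - F r
  lt : ∀ r < cnt, L r < n
  sep : ∀ r, r + 1 < cnt → L r < F (r + 1) ∧ m < 2 * (F (r + 1) - L r)
  cnt_le : cnt ≤ n

theorem Wins.congr {X : ℕ → ℕ} {n m w p cnt : ℕ} {F L F' L' : ℕ → ℕ}
    (h : Wins X n m w p cnt F L) (hF : ∀ r < cnt, F' r = F r) (hL : ∀ r < cnt, L' r = L r) :
    Wins X n m w p cnt F' L' := by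
  refine ⟨h.pos, h.p_le, h.per, fun r hr => ?_, fun t ht ho => ?_, fun r hr => ?_, fun r hr => ?_,
    h.cnt_le⟩
  · rw [hF r hr, hL r hr]; exact h.run r hr
  · obtain ⟨r, r1, r2⟩ := h.cover t ht ho
    exact ⟨r, r1, by rw [hF r r1, hL r r1]; exact r2⟩
  · rw [hL r hr]; exact h.lt r hr
  · rw [hL r (by omega), hF _ hr]; exact h.sep r hr

/-- For the last run maximality on the right needs that no occurrence starts at or after `n`; the
padding provides this. -/
theorem RunsInv.wins {X : ℕ → ℕ} {n m w p prev cnt : ℕ} {F L : ℕ → ℕ}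
    (h : RunsInv X m w p n prev cnt F L) (hp : 0 < p) (hpm : p ≤ m)
    (hper : Agree X w (w + p) (m - p)) (hlt : ∀ t, Agree X w t m → t < n) :
    Wins X n m w p cnt F L := by
  refine ⟨hp, hpm, hper, fun r hr => ⟨h.le r hr, h.dvd r hr, h.occ r hr, h.pre r hr, ?_⟩, h.cover,
    h.lt, h.sep, h.cnt_le⟩
  by_cases e : r + 1 < cnt
  · exact h.post r e
  · intro hc
    rcases h.last with ⟨h1, h2, h3⟩ | ⟨h1, h2, h3⟩
    · omega
    · rw [show r = cnt - 1 by omega] at hc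
      exact h3 _ (by omega) (hlt _ hc) hc

/-- The distance to the previous occurrence. -/
def gapProg : Cmd Var Arr :=
  .loop vt vn.e (.ite .eq (aCLS.at vt.e) (aCLS.at vw.e)
    (.set vg (vt.e + vm.e + lit 1 - vprev.e) ;; .set vd (.cond .lt vg.e vd.e vg.e vd.e) ;;
      .set vprev (vt.e + vm.e + lit 1)) .nop)

/-- Collect the runs. -/
def runsProg : Cmd Var Arr :=
  .loop vt vn.e (.ite .eq (aCLS.at vt.e) (aCLS.at vw.e)
    (.ite .eq (vt.e + vm.e + lit 1 - vprev.e) vd.e .nop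
      (.set vcnt (vcnt.e + lit 1) ;; .put aF (vlo.e + vcnt.e - lit 1) vt.e) ;;
      .put aL (vlo.e + vcnt.e - lit 1) vt.e ;; .set vprev (vt.e + vm.e + lit 1)) .nop)

/-- Find the runs of occurrences of the window `vi`. -/
def winProg : Cmd Var Arr :=
  .set vw (vi.e * vm.e) ;; .set vprev (lit 0) ;; .set vd vm.e ;; gapProg ;;
  .set vprev (lit 0) ;; .set vcnt (lit 0) ;; .set vlo (vi.e * (vn.e + lit 1)) ;; runsProg ;;
  .put aPP vi.e vd.e ;; .put aRR vi.e vcnt.e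

theorem Lev.agree {X : ℕ → ℕ} {n j : ℕ} {s : St Var Arr} (h : Lev X n j s) {p q : ℕ} (hp : p ≤ n)
    (hq : q ≤ n) : s.a aCLS p = s.a aCLS q ↔ Agree X q p (2 ^ j) := by
  rw [h.cls p hp, h.cls q hq, cls_eq_iff]
  exact ⟨Agree.symm, Agree.symm⟩

theorem gapProg_spec {X : ℕ → ℕ} {n j Z C w m : ℕ} (hD : Dim n Z C) (s : St Var Arr)
    (h : Lev X n j s) (hm : m = 2 ^ j) (hw : s.v vw = w) (hwn : w + m ≤ n)
    (hp : s.v vprev = 0) (hd : s.v vd = m) :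
    WP Z C gapProg s (1 + n * 5) fun s' => ∃ prev, GapInv X m w n prev (s'.v vd) := by
  have hZ := hD.len
  have hC := hD.lin
  have hm0 : 0 < m := by rw [hm]; positivity
  refine .mono (.loop (fun i s' => GapInv X m w i (s'.v vprev) (s'.v vd)) n 4 (by simp [h.len])
    (by simp) (by omega) ?_ ?_) le_rfl fun s' _ h => ⟨_, h⟩
  · rw [hp, hd]
    exact ⟨hm0, le_rfl, fun x hx => by omega, fun t t' a b => by omega, Or.inl ⟨rfl, by omega⟩⟩
  · intro i hi s₁ F₁ q₁ I
    have h₁ : Lev X n j s₁ := h.frame F₁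
    have hw₁ : s₁.v vw = w := by rw [F₁.v vw rfl, hw]
    have hc := h₁.agree (p := i) (q := w) (by omega) (by omega)
    rw [← hm] at hc
    refine .cost (.ite (c := 3) (by simp [q₁, hw₁]; omega) (fun h' s₂ e₂ f₂ => ?_)
      fun h' s₂ e₂ f₂ => .cost (.nop fun s₃ e₃ f₃ => ?_) (by omega)) le_rfl
    · simp only [Ex.eval, holds_eq, q₁, hw₁, hc] at h'
      have hm₂ : s₂.v vm = m := by rw [e₂, h₁.pow, hm]
      have hq₂ : s₂.v vt = i := by rw [e₂, q₁]
      have := I.step h'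
      have hle := I.le
      refine .cost (.set_seq (by simp [hm₂, hq₂]; omega) fun s₃ a₃ b₃ c₃ => .set_seq
        (by simp [a₃, b₃, hm₂, hq₂, e₂]; split_ifs <;> omega) fun s₄ a₄ b₄ c₄ => .set
        (by simp [b₄, b₃, hm₂, hq₂]; omega) fun s₅ a₅ b₅ c₅ => ?_) (le_refl (1 + (1 + 1)))
      simp only [a₅, b₅, a₄, b₄, a₃, b₃, hm₂, hq₂, e₂, Ex.eval, eval_add, eval_sub, holds_lt, ne_eq,
        reduceCtorEq, not_false_eq_true, op_add, op_sub]
      exact this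
    · simp only [Ex.eval, holds_eq, q₁, hw₁, hc] at h'
      rw [e₃, e₂]
      exact I.skip h'

set_option maxHeartbeats 400000 in
theorem runsProg_spec {X : ℕ → ℕ} {n j Z C w m p i prev' : ℕ} (hD : Dim n Z C) (s : St Var Arr)
    (h : Lev X n j s) (hm : m = 2 ^ j) (hw : s.v vw = w) (hwn : w + m ≤ n) (hi : i < 2)
    (hp : s.v vprev = 0) (hcnt : s.v vcnt = 0) (hd : s.v vd = p) (hlo : s.v vlo = i * (n + 1))
    (hG : GapInv X m w n prev' p) :
    WP Z C runsProg s (1 + n * 7) fun s' =>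
      (∃ prev, RunsInv X m w p n prev (s'.v vcnt) (fun r => s'.a aF (i * (n + 1) + r))
        (fun r => s'.a aL (i * (n + 1) + r))) ∧
      ∀ x < i * (n + 1), s'.a aF x = s.a aF x ∧ s'.a aL x = s.a aL x := by
  have hZ := hD.len
  have hC := hD.lin
  have hpm := hG.le
  obtain ⟨lo, e⟩ : ∃ lo, lo = i * (n + 1) := ⟨_, rfl⟩
  have hlon : lo ≤ n + 1 := by
    rw [e]; calc i * (n + 1) ≤ 1 * (n + 1) := Nat.mul_le_mul_right _ (by omega)
      _ = n + 1 := one_mul _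
  rw [← e] at hlo ⊢
  have upd : ∀ (f : ℕ → ℕ) r v, (fun x => Function.update f (lo + r) v (lo + x)) =
      Function.update (fun x => f (lo + x)) r v := by
    intro f r v
    funext x
    simp [Function.update_apply]
  refine .mono (.loop (fun t s' => RunsInv X m w p t (s'.v vprev) (s'.v vcnt)
      (fun r => s'.a aF (lo + r)) (fun r => s'.a aL (lo + r)) ∧
      ∀ x < lo, s'.a aF x = s.a aF x ∧ s'.a aL x = s.a aL x) n 6
    (by simp [h.len]) (by simp) (by omega) ?_ ?_) le_rfl fun s' _ h => ⟨⟨_, h.1⟩, h.2⟩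
  · rw [hp, hcnt]
    refine ⟨⟨Or.inl ⟨rfl, rfl, by omega⟩, ?_, ?_, ?_, ?_, ?_, ?_, ?_, ?_, le_rfl⟩, by simp⟩
    all_goals intros; omega
  · rintro t ht s₁ F₁ q₁ ⟨I, I'⟩
    have h₁ : Lev X n j s₁ := h.frame F₁
    have hw₁ : s₁.v vw = w := by rw [F₁.v vw rfl, hw]
    have hd₁ : s₁.v vd = p := by rw [F₁.v vd rfl, hd]
    have hlo₁ : s₁.v vlo = lo := by rw [F₁.v vlo rfl, hlo]
    have hc := h₁.agree (p := t) (q := w) (by omega) (by omega)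
    rw [← hm] at hc
    have hcl := I.cnt_le
    refine .cost (.ite (c := 5) (by simp [q₁, hw₁]; omega) (fun h' s₂ e₂ f₂ => ?_)
      fun h' s₂ e₂ f₂ => .cost (.nop fun s₃ e₃ f₃ => ?_) (by omega)) le_rfl
    · simp only [Ex.eval, holds_eq, q₁, hw₁, hc] at h'
      have hm₂ : s₂.v vm = m := by rw [e₂, h₁.pow, hm]
      have hq₂ : s₂.v vt = t := by rw [e₂, q₁]
      refine .cost (.seq (c := 3) (R := fun s₃ => RunsInv X m w p (t + 1) (t + m + 1) (s₃.v vcnt)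
        (fun r => s₃.a aF (lo + r)) (Function.update (fun r => s₁.a aL (lo + r)) (s₃.v vcnt - 1) t) ∧
        0 < s₃.v vcnt ∧ ∀ x < lo, s₃.a aF x = s.a aF x) (.cost (.ite (c := 2)
        (by simp [hq₂, hm₂]; omega) (fun h'' s₃ e₃ f₃ => .cost (.nop fun s₄ e₄ f₄ => ?_) (by omega))
        fun h'' s₃ e₃ f₃ => .cost (.set_seq ?_ fun s₄ a₄ b₄ c₄ => .put ?_ fun s₅ b₅ a₅ c₅ => ?_)
        (le_refl (1 + 1))) le_rfl) fun s₃ F₃ ⟨g₁, g₂, g₃⟩ => .put_seq ?_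
        fun s₄ b₄ a₄ c₄ => .set ?_ fun s₅ a₅ b₅ c₅ => ?_) (show 3 + (1 + 1) ≤ 5 by omega)
      · simp [hq₂, hm₂, e₂, hd₁] at h''
        rw [e₄, e₃, e₂, f₄, f₃, f₂]
        have := I.extend hG.pos hpm h' h''
        exact ⟨this.2, this.1, fun x hx => (I' x hx).1⟩
      · simp [e₃, e₂]; omega
      · simp [b₄, a₄, e₃, e₂, hq₂, hlo₁, q₁]; omega
      · simp [hq₂, hm₂, e₂, hd₁] at h''
        have := I.start hG.pos hG.per (fun t t' a b => hG.min t t' a (by omega)) h' h''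
        have ecnt : s₅.v vcnt = s₁.v vcnt + 1 := by simp [b₅, a₄, e₃, e₂]
        have eF : s₅.a aF = Function.update (s₁.a aF) (lo + s₁.v vcnt) t := by
          rw [a₅]; simp [c₄, b₄, a₄, f₃, f₂, e₃, e₂, hlo₁, q₁, ← add_assoc]
        rw [ecnt, eF, upd, Nat.add_sub_cancel]
        refine ⟨this, by omega, fun x hx => ?_⟩
        rw [Function.update_of_ne (by omega)]
        exact (I' x hx).1
      · have := g₁.cnt_le
        simp [F₃.v vlo rfl, F₃.v vt rfl, e₂, hlo₁, q₁]; omega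
      · simp [b₄, F₃.v vt rfl, F₃.v vm rfl, hq₂, hm₂]; omega
      · have ep : s₅.v vprev = t + m + 1 := by
          rw [a₅]; simp [b₄, F₃.v vt rfl, F₃.v vm rfl, hq₂, hm₂]
        have ec : s₅.v vcnt = s₃.v vcnt := by simp [b₅, b₄]
        have eL : s₅.a aL = Function.update (s₁.a aL) (lo + (s₃.v vcnt - 1)) t := by
          rw [c₅, a₄]
          simp [F₃.v vt rfl, F₃.v vlo rfl, hq₂, F₃.a aL rfl, f₂, e₂, hlo₁, q₁,
            Nat.add_sub_assoc (show 1 ≤ s₃.v vcnt by omega)]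
        have eF : s₅.a aF = s₃.a aF := by simp [c₅, c₄]
        rw [ep, ec, eL, eF, upd]
        refine ⟨g₁, fun x hx => ⟨g₃ x hx, ?_⟩⟩
        rw [Function.update_of_ne (by omega)]
        exact (I' x hx).2
    · simp only [Ex.eval, holds_eq, q₁, hw₁, hc] at h'
      rw [e₃, e₂, f₃, f₂]
      exact ⟨I.skip h', I'⟩

/-- The runs of window `i` are stored. -/
def WinOK (X : ℕ → ℕ) (n m i : ℕ) (s : St Var Arr) : Prop :=
  Wins X n m (i * m) (s.a aPP i) (s.a aRR i) (fun r => s.a aF (i * (n + 1) + r))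
    (fun r => s.a aL (i * (n + 1) + r))

/-- Two passes are made because the difference `p` has to be known before occurrences can be
grouped. Window `i` stores its runs from index `i * (n + 1)` on, so the second window leaves the
data of the first untouched. -/
theorem winProg_spec {X : ℕ → ℕ} {n j Z C m i : ℕ} (hD : Dim n Z C) (hW : IsWord X n)
    (s : St Var Arr) (h : Lev X n j s) (hm : m = 2 ^ j) (hmn : 2 * m ≤ n) (hi : i < 2)
    (hvi : s.v vi = i) (h₀ : ∀ i' < i, WinOK X n m i' s) :
    WP Z C winProg s (10 + n * 12) fun s' => ∀ i' < i + 1, WinOK X n m i' s' := by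
  have hZ := hD.len
  have hC := hD.lin
  have hm0 : 0 < m := by rw [hm]; positivity
  have hlon : i * (n + 1) ≤ n + 1 := by
    calc i * (n + 1) ≤ 1 * (n + 1) := Nat.mul_le_mul_right _ (by omega)
      _ = n + 1 := one_mul _
  have hw : i * m ≤ m := by
    calc i * m ≤ 1 * m := Nat.mul_le_mul_right _ (by omega)
      _ = m := one_mul _
  have hpow : s.v vm = m := by rw [h.pow, hm]
  refine .cost (.set_seq (by simp [hvi, hpow]; omega) fun s₁ a₁ b₁ c₁ => .set_seq
    (by simp; omega) fun s₂ a₂ b₂ c₂ => .set_seq (by simp [b₂, b₁, hpow]; omega)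
    fun s₃ a₃ b₃ c₃ => .seq (gapProg_spec (X := X) (j := j) (w := i * m) hD s₃
      ⟨?_, ?_, ?_, ?_, ?_⟩ hm ?_ (by omega) ?_ ?_) fun s₄ F₄ ⟨prev, hG⟩ => .set_seq
      (by simp; omega) fun s₅ a₅ b₅ c₅ => .set_seq (by simp; omega) fun s₆ a₆ b₆ c₆ => .set_seq
      ?_ fun s₇ a₇ b₇ c₇ => .seq (runsProg_spec (X := X) (j := j) (w := i * m) (p := s₄.v vd)
      (i := i) hD s₇ ⟨?_, ?_, ?_, ?_, ?_⟩ hm ?_ (by omega) hi ?_ ?_ ?_ ?_ hG)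
      fun s₈ F₈ ⟨⟨prev', hR⟩, hfr⟩ => .put_seq ?_ fun s₉ b₉ a₉ c₉ => .put ?_
      fun s' b' a' c' => ?_)
    (?_ : 1 + (1 + (1 + ((1 + n * 5) + (1 + (1 + (1 + ((1 + n * 7) + (1 + 1)))))))) ≤ _)
  · simp [b₃, b₂, b₁, h.len]
  · simp [b₃, b₂, b₁, h.lev]
  · simp [b₃, b₂, b₁, h.pow]
  · simpa [c₃, c₂, c₁] using h.cls
  · simpa [c₃, c₂, c₁] using h.tree
  · simp [b₃, b₂, a₁, hvi, hpow]
  · simp [b₃, a₂]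
  · simp [a₃, b₂, b₁, hpow]
  · simp [b₆, b₅, F₄.v vi rfl, F₄.v vn rfl, b₃, b₂, b₁, hvi, h.len]; omega
  · simp [b₇, b₆, b₅, F₄.v vn rfl, b₃, b₂, b₁, h.len]
  · simp [b₇, b₆, b₅, F₄.v vlev rfl, b₃, b₂, b₁, h.lev]
  · simp [b₇, b₆, b₅, F₄.v vm rfl, b₃, b₂, b₁, h.pow]
  · simpa [c₇, c₆, c₅, F₄.a aCLS rfl, c₃, c₂, c₁] using h.cls
  · simpa [c₇, c₆, c₅, F₄.a aBIR rfl, F₄.a aPAR rfl, c₃, c₂, c₁] using h.tree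
  · simp [b₇, b₆, b₅, F₄.v vw rfl, b₃, b₂, a₁, hvi, hpow]
  · simp [b₇, b₆, a₅]
  · simp [b₇, a₆]
  · simp [b₇, b₆, b₅]
  · simp [a₇, b₆, b₅, F₄.v vi rfl, F₄.v vn rfl, b₃, b₂, b₁, hvi, h.len]
  rotate_right 1
  · omega
  all_goals
    have hvi₈ : s₈.v vi = i := by
      simp [F₈.v vi rfl, b₇, b₆, b₅, F₄.v vi rfl, b₃, b₂, b₁, hvi]
    have hvd₈ : s₈.v vd = s₄.v vd := by simp [F₈.v vd rfl, b₇, b₆, b₅]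
  · simp [hvi₈]; omega
  · simp [b₉, hvi₈]; omega
  · have eP : s'.a aPP = Function.update (s.a aPP) i (s₄.v vd) := by
      simp [c', a₉, hvi₈, hvd₈, F₈.a aPP rfl, c₇, c₆, c₅, F₄.a aPP rfl, c₃, c₂, c₁]
    have eR : s'.a aRR = Function.update (s.a aRR) i (s₈.v vcnt) := by
      simp [a', b₉, c₉, hvi₈, F₈.a aRR rfl, c₇, c₆, c₅, F₄.a aRR rfl, c₃, c₂, c₁]
    have eF : s'.a aF = s₈.a aF := by simp [c', c₉]
    have eL : s'.a aL = s₈.a aL := by simp [c', c₉]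
    have eF₇ : s₇.a aF = s.a aF := by simp [c₇, c₆, c₅, F₄.a aF rfl, c₃, c₂, c₁]
    have eL₇ : s₇.a aL = s.a aL := by simp [c₇, c₆, c₅, F₄.a aL rfl, c₃, c₂, c₁]
    intro i' hi'
    rw [WinOK, eP, eR, eF, eL]
    by_cases e : i' = i
    · subst e
      simp only [Function.update_self]
      refine hR.wins hG.pos hG.le hG.per fun t ht => ?_
      have := hW.add_le_of_agree ht (by omega) hm0
      omega
    · rw [Function.update_of_ne e, Function.update_of_ne e]
      have h1 := h₀ i' (by omega)
      have h2 : (i' + 1) * (n + 1) ≤ i * (n + 1) := Nat.mul_le_mul_right _ (by omega)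
      rw [add_mul] at h2
      have h3 := h1.cnt_le
      refine h1.congr (fun r hr => ?_) fun r hr => ?_
      · rw [(hfr _ (by omega)).1, eF₇]
      · rw [(hfr _ (by omega)).2, eL₇]

/-! ### Deciding one block length -/

/-- The situation in which the block length `k` is treated on level `j`. -/
structure KCtx (X : ℕ → ℕ) (n j k : ℕ) (s : St Var Arr) : Prop where
  lev : Lev X n j s
  inp : Inp X n s
  k_eq : s.v vk = k
  lo : 2 * 2 ^ j ≤ k
  hi : k < 4 * 2 ^ j
  dvd : k ∣ n
  le : k ≤ n
  win : ∀ i < 2, WinOK X n (2 ^ j) i s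

theorem KCtx.of_eq {X : ℕ → ℕ} {n j k : ℕ} {s s' : St Var Arr} (h : KCtx X n j k s)
    (hv : s'.v vn = s.v vn ∧ s'.v vlev = s.v vlev ∧ s'.v vm = s.v vm ∧ s'.v vk = s.v vk)
    (ha : ∀ b ∈ [aX, aCLS, aBIR, aPAR, aPP, aRR, aF, aL], s'.a b = s.a b) : KCtx X n j k s' := by
  simp only [List.mem_cons, List.not_mem_nil, or_false, forall_eq_or_imp, forall_eq] at ha
  obtain ⟨a₁, a₂, a₃, a₄, a₅, a₆, a₇, a₈⟩ := ha
  have hl := h.lev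
  refine ⟨⟨by rw [hv.1, hl.len], by rw [hv.2.1, hl.lev], by rw [hv.2.2.1, hl.pow],
    by rw [a₂]; exact hl.cls, by rw [a₃, a₄]; exact hl.tree⟩, h.inp.frame hv.1 a₁,
    hv.2.2.2.trans h.k_eq, h.lo, h.hi, h.dvd, h.le, fun i hi => ?_⟩
  have := h.win i hi
  rwa [WinOK, a₅, a₆, a₇, a₈]

theorem KCtx.frame {X : ℕ → ℕ} {n j k : ℕ} {s s' : St Var Arr} {p : Cmd Var Arr}
    (h : KCtx X n j k s) (F : Frame p s s')
    (hv : (p.wV vn || (p.wV vlev || (p.wV vm || p.wV vk))) = false := by rfl)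
    (ha : [aX, aCLS, aBIR, aPAR, aPP, aRR, aF, aL].all (fun b => !p.wA b) = true := by rfl) :
    KCtx X n j k s' := by
  simp only [Bool.or_eq_false_iff] at hv
  refine h.of_eq ⟨F.v _ hv.1, F.v _ hv.2.1, F.v _ hv.2.2.1, F.v _ hv.2.2.2⟩ fun b hb => F.a b ?_
  simpa using List.all_eq_true.1 ha b hb

theorem KCtx.set {X : ℕ → ℕ} {n j k : ℕ} {s s' : St Var Arr} {x : Var}
    (h : KCtx X n j k s) (hb : ∀ y, y ≠ x → s'.v y = s.v y) (hc : s'.a = s.a)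
    (hx : x ∉ [vn, vlev, vm, vk] := by decide) : KCtx X n j k s' := by
  simp only [List.mem_cons, List.not_mem_nil, or_false, not_or] at hx
  exact h.of_eq ⟨hb _ (Ne.symm hx.1), hb _ (Ne.symm hx.2.1), hb _ (Ne.symm hx.2.2.1),
    hb _ (Ne.symm hx.2.2.2)⟩ fun b _ => by rw [hc]

theorem KCtx.pow_lt {X : ℕ → ℕ} {n j k : ℕ} {s : St Var Arr} (h : KCtx X n j k s) :
    2 ^ j < 2 * n := by
  have h1 := h.lo
  have h2 := h.le
  have : 0 < 2 ^ j := by positivity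
  omega

/-- Remainders. -/
def modE (e f : Ex Var Arr) : Ex Var Arr := e - e / f * f

@[simp] theorem modE_eval (e f : Ex Var Arr) (s : St Var Arr) :
    (modE e f).eval s = e.eval s % f.eval s := by
  simp only [modE, eval_sub, eval_mul, eval_div]
  rw [Nat.mod_eq_sub_div_mul]

theorem modE_safe {Z C : ℕ} {e f : Ex Var Arr} {s : St Var Arr} (he : e.safe Z C s)
    (hf : f.safe Z C s) (hC : e.eval s < C) : (modE e f).safe Z C s := by
  simp only [modE, safe_sub, safe_mul, safe_div, eval_mul, eval_div]
  exact ⟨he, ⟨⟨he, hf, lt_of_le_of_lt (Nat.div_le_self _ _) hC⟩, hf,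
    lt_of_le_of_lt (Nat.div_mul_le_self _ _) hC⟩, lt_of_le_of_lt (Nat.sub_le _ _) hC⟩

/-- `f` holds the answers for the block lengths below `k`. -/
def AnsInv (X : ℕ → ℕ) (n k : ℕ) (f : ℕ → ℕ) : Prop :=
  (∀ d, 1 ≤ d → d < k → f d ≤ 1 ∧ (f d = 1 ↔ CycPer X n d)) ∧ ∀ d, k ≤ d → f d = 0

theorem AnsInv.step {X : ℕ → ℕ} {n k v : ℕ} {f : ℕ → ℕ} (h : AnsInv X n k f) (hv : v ≤ 1)
    (hv' : v = 1 ↔ CycPer X n k) : AnsInv X n (k + 1) (Function.update f k v) := by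
  refine ⟨fun d h1 h2 => ?_, fun d h1 => ?_⟩
  · by_cases e : d = k
    · subst e; rw [Function.update_self]; exact ⟨hv, hv'⟩
    · rw [Function.update_of_ne e]; exact h.1 d h1 (by omega)
  · rw [Function.update_of_ne (by omega)]; exact h.2 d (by omega)

/-- The answers are zero initially, so nothing has to be written for non-divisors. -/
theorem AnsInv.skip {X : ℕ → ℕ} {n k : ℕ} {f : ℕ → ℕ} (h : AnsInv X n k f) (hk : ¬ k ∣ n) :
    AnsInv X n (k + 1) f := by
  refine ⟨fun d h1 h2 => ?_, fun d h1 => h.2 d (by omega)⟩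
  rcases Nat.lt_succ_iff_lt_or_eq.1 h2 with h2 | rfl
  · exact h.1 d h1 h2
  · rw [h.2 d le_rfl]
    exact ⟨by omega, fun h => by omega, fun h => absurd h.1 hk⟩

/-- Find the least proper divisor of `vk` that is a period of the prefix of length `vk`. -/
def periodProg : Cmd Var Arr :=
  .set vp0 vk.e ;;
  .loop vd vk.e (.ite .eq (vk.e / vd.e * vd.e) vk.e (.ite .eq vp0.e vk.e
    (.set vep (lit 0) ;; .set veq vd.e ;; .set vel (vk.e - vd.e) ;; eqProg ;;
      .set vp0 (.cond .eq vres.e (lit 1) vd.e vp0.e)) .nop) .nop)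

theorem eq_cost_le (L j : ℕ) : (if L < 2 ^ j then 11 + j * 9 else 5) ≤ 11 + j * 9 := by
  split_ifs <;> omega

/-- All candidates are enumerated, but only divisors of `k` are compared, and only until the first
success. -/
theorem periodProg_spec {X : ℕ → ℕ} {n j k Z C : ℕ} (hD : Dim n Z C) (s : St Var Arr)
    (h : KCtx X n j k s) :
    WP Z C periodProg s (2 + k * 12) fun s' =>
      (s'.v vp0 = k ∧ ∀ d, d ∣ k → 0 < d → d < k → ¬ Agree X 0 d (k - d)) ∨
      (s'.v vp0 < k ∧ 0 < s'.v vp0 ∧ s'.v vp0 ∣ k ∧ Agree X 0 (s'.v vp0) (k - s'.v vp0)) := by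
  have hZ := hD.len
  have hC := hD.lin
  have hkn := h.le
  have hk0 : 0 < k := by have := h.lo; have : 0 < 2 ^ j := by positivity
                         omega
  refine .cost (.set_seq (by simp [h.k_eq]; omega) fun s₁ a₁ b₁ c₁ => .mono (.loop (fun t s' =>
      (s'.v vp0 = k ∧ ∀ d < t, d ∣ k → 0 < d → d < k → ¬ Agree X 0 d (k - d)) ∨
      (s'.v vp0 < k ∧ 0 < s'.v vp0 ∧ s'.v vp0 ∣ k ∧ Agree X 0 (s'.v vp0) (k - s'.v vp0)))
      k 11 (by simp [b₁, h.k_eq]) (by simp) (by omega) (Or.inl ⟨by simp [a₁, h.k_eq], by omega⟩) ?_)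
      le_rfl ?_) (show 1 + (1 + k * (11 + 1)) ≤ _ by omega)
  · intro t ht s₂ F₂ q₂ I
    have h₂ : KCtx X n j k s₂ := (h.set b₁ c₁).frame F₂
    have hdm : k / t * t ≤ k := Nat.div_mul_le_self _ _
    have hdl : k / t ≤ k := Nat.div_le_self _ _
    refine .cost (.ite (c := 10) (by simp [q₂, h₂.k_eq]; omega) (fun h' s₃ e₃ f₃ => ?_)
      fun h' s₃ e₃ f₃ => .cost (.nop fun s₄ e₄ f₄ => ?_) (by omega)) le_rfl
    · have h₃ : KCtx X n j k s₃ := h₂.of_eq (by simp [e₃]) (by simp [f₃])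
      simp [q₂, h₂.k_eq] at h'
      have htk : t ∣ k := Dvd.intro_left _ h'
      have ht0 : 0 < t := by
        rcases Nat.eq_zero_or_pos t with rfl | h0
        · simp at h'; omega
        · exact h0
      refine .cost (.ite (c := 9) (by simp) (fun h'' s₄ e₄ f₄ => ?_)
        fun h'' s₄ e₄ f₄ => .cost (.nop fun s₅ e₅ f₅ => ?_) (by omega)) le_rfl
      · simp [h₃.k_eq] at h''
        rw [e₃] at h''
        have h₄ : KCtx X n j k s₄ := h₃.of_eq (by simp [e₄]) (by simp [f₄])
        have hq₄ : s₄.v vd = t := by rw [e₄, e₃, q₂]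
        -- A proper divisor is at most `k / 2`, so the factors compared have length at least `2 ^ j`
        -- and the comparison takes constant time.
        have ht2 : 2 * t ≤ k := by
          obtain ⟨c, rfl⟩ := htk
          have : 2 ≤ c := by
            by_contra hc
            interval_cases c <;> omega
          calc 2 * t = t * 2 := by ring
            _ ≤ t * c := Nat.mul_le_mul_left _ this
        have hlo := h.lo
        have hhi := h.hi
        refine .cost (.set_seq (by simp; omega) fun s₅ a₅ b₅ c₅ => .set_seq
          (by simp [b₅, hq₄]; omega) fun s₆ a₆ b₆ c₆ => .set_seq
          (by simp [b₆, b₅, h₄.k_eq, hq₄]; omega) fun s₇ a₇ b₇ c₇ => .seq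
          (eqProg_spec (p := 0) (q := t) (L := k - t) hD s₇
            (((h₄.set b₅ c₅).set b₆ c₆).set b₇ c₇).lev h.pow_lt (by simp [b₇, b₆, a₅])
            (by simp [b₇, a₆, b₅, hq₄]) (by simp [a₇, b₆, b₅, h₄.k_eq, hq₄]) (by omega)
            (by omega) (by omega)) fun s₈ F₈ ⟨g₁, g₂⟩ => .set ?_ fun s₉ a₉ b₉ c₉ => ?_)
          (show 1 + (1 + (1 + ((if k - t < 2 ^ j then 11 + j * 9 else 5) + 1))) ≤ 9 by
            rw [if_neg (by omega)])
        · simp [F₈.v vd rfl, F₈.v vp0 rfl, b₇, b₆, b₅, hq₄, e₄, e₃, h'']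
          split_ifs <;> omega
        · have hp0 : s₉.v vp0 = if s₈.v vres = 1 then t else k := by
            rw [a₉]
            simp [F₈.v vd rfl, F₈.v vp0 rfl, b₇, b₆, b₅, hq₄, e₄, e₃, h'']
          rw [hp0]
          split_ifs with hr
          · exact Or.inr ⟨ht, ht0, htk, g₂.1 hr⟩
          · rcases I with ⟨I1, I2⟩ | ⟨I1, I2⟩
            · refine Or.inl ⟨rfl, fun d hd hdk hd0 hdlt => ?_⟩
              rcases Nat.lt_succ_iff_lt_or_eq.1 hd with hd | rfl
              · exact I2 d hd hdk hd0 hdlt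
              · exact fun hA => hr (g₂.2 hA)
            · omega
      · simp [h₃.k_eq] at h''
        rw [e₃] at h''
        rw [e₅, e₄, e₃]
        rcases I with ⟨I1, I2⟩ | I
        · exact absurd I1 h''
        · exact Or.inr I
    · simp [q₂, h₂.k_eq] at h'
      rw [e₄, e₃]
      rcases I with ⟨I1, I2⟩ | I
      · refine Or.inl ⟨I1, fun d hd hdk hd0 hdlt => ?_⟩
        rcases Nat.lt_succ_iff_lt_or_eq.1 hd with hd | rfl
        · exact I2 d hd hdk hd0 hdlt
        · exact absurd (Nat.div_mul_cancel hdk) h'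
      · exact Or.inr I
  · rintro s₂ - (⟨I1, I2⟩ | I)
    · exact Or.inl ⟨I1, fun d hdk hd0 hdlt => I2 d hdlt hdk hd0 hdlt⟩
    · exact Or.inr I

/-- Treat the block length `vk` when the prefix of this length has the period `vp0`. -/
def powerProg : Cmd Var Arr :=
  .set vok (aANS.at vp0.e) ;;
  .loop vq (vn.e / vk.e) (.set vep (vq.e * vk.e) ;; .set veq (vq.e * vk.e + vp0.e) ;;
    .set vel (vk.e - vp0.e) ;; eqProg ;; .set vok (vok.e * vres.e)) ;;
  .put aANS vk.e vok.e

/-- The answer for `d` is known since lengths are treated in increasing order, and each block costs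
one long comparison. Conjunctions are computed as products of zeros and ones. -/
theorem powerProg_spec {X : ℕ → ℕ} {n j k d Z C : ℕ} (hD : Dim n Z C) (s : St Var Arr)
    (h : KCtx X n j k s) (hp0 : s.v vp0 = d) (hdk : d < k) (hd0 : 0 < d) (hd : d ∣ k)
    (hA : Agree X 0 d (k - d)) (hans : AnsInv X n k (s.a aANS)) :
    WP Z C powerProg s (3 + n / k * 10) fun s' => AnsInv X n (k + 1) (s'.a aANS) := by
  have hZ := hD.len
  have hC := hD.lin
  have hkn := h.le
  have hk0 : 0 < k := by omega
  have hlo := h.lo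
  have hhi := h.hi
  have hNn : n / k ≤ n := Nat.div_le_self _ _
  have h2d : 2 * d ≤ k := by
    obtain ⟨c, rfl⟩ := hd
    have : 2 ≤ c := by
      by_contra hc
      interval_cases c <;> omega
    calc 2 * d = d * 2 := by ring
      _ ≤ d * c := Nat.mul_le_mul_left _ this
  obtain ⟨ha1, ha2⟩ := hans.1 d hd0 hdk
  refine .cost (.set_seq (by simp [hp0]; omega) fun s₁ a₁ b₁ c₁ => .seq (.loop (fun q s' =>
    s'.v vok ≤ 1 ∧ (s'.v vok = 1 ↔ CycPer X n d ∧ ∀ q' < q, Agree X (q' * k) (q' * k + d) (k - d)))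
    (n / k) 9 (by simp [b₁, h.k_eq, h.lev.len])
    (by simp [b₁, h.k_eq, h.lev.len]; omega) (by omega) ?_ ?_)
    fun s₂ F₂ ⟨g₁, g₂⟩ => .put ?_ fun s₃ b₃ a₃ c₃ => ?_)
    (show 1 + ((1 + n / k * (9 + 1)) + 1) ≤ _ by omega)
  · simp [a₁, hp0, ha1, ha2]
  · rintro q hq s₂ F₂ q₂ ⟨g₁, g₂⟩
    have h₂ : KCtx X n j k s₂ := (h.set b₁ c₁).frame F₂
    have hd₂ : s₂.v vp0 = d := by rw [F₂.v vp0 rfl, b₁ _ (by simp), hp0]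
    have hqk : q * k + k ≤ n := by
      calc q * k + k = (q + 1) * k := by ring
        _ ≤ n / k * k := Nat.mul_le_mul_right _ hq
        _ ≤ n := Nat.div_mul_le_self _ _
    refine .cost (.set_seq (by simp [q₂, h₂.k_eq]; omega) fun s₃ a₃ b₃ c₃ => .set_seq
      (by simp [b₃, q₂, h₂.k_eq, hd₂]; omega) fun s₄ a₄ b₄ c₄ => .set_seq
      (by simp [b₄, b₃, h₂.k_eq, hd₂]; omega) fun s₅ a₅ b₅ c₅ => .seq
      (eqProg_spec (p := q * k) (q := q * k + d) (L := k - d) hD s₅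
        (((h₂.set b₃ c₃).set b₄ c₄).set b₅ c₅).lev h.pow_lt (by simp [b₅, b₄, a₃, q₂, h₂.k_eq])
        (by simp [b₅, a₄, b₃, q₂, h₂.k_eq, hd₂]) (by simp [a₅, b₄, b₃, h₂.k_eq, hd₂]) (by omega)
        (by omega) (by omega)) fun s₆ F₆ ⟨y₁, y₂⟩ => .set ?_ fun s₇ a₇ b₇ c₇ => ?_)
      (show 1 + (1 + (1 + ((if k - d < 2 ^ j then 11 + j * 9 else 5) + 1))) ≤ 9 by
        rw [if_neg (by omega)])
    · have : s₂.v vok * s₆.v vres ≤ 1 * 1 := Nat.mul_le_mul g₁ y₁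
      simp [F₆.v vok rfl, b₅, b₄, b₃]
      omega
    · have : s₂.v vok * s₆.v vres ≤ 1 * 1 := Nat.mul_le_mul g₁ y₁
      have e : s₇.v vok = s₂.v vok * s₆.v vres := by
        rw [a₇]; simp [F₆.v vok rfl, b₅, b₄, b₃]
      rw [e, mul_eq_one, g₂, y₂]
      refine ⟨by omega, fun ⟨⟨h1, h2⟩, h3⟩ => ⟨h1, fun q' hq' => ?_⟩, fun ⟨h1, h2⟩ =>
        ⟨⟨h1, fun q' hq' => h2 q' (by omega)⟩, h2 q (by omega)⟩⟩
      rcases Nat.lt_succ_iff_lt_or_eq.1 hq' with hq' | rfl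
      · exact h2 q' hq'
      · exact h3
  · simp [F₂.v vk rfl, b₁, h.k_eq]; omega
  · rw [a₃]
    simp only [Ex.eval, F₂.v vk rfl, b₁ _ (show vk ≠ vok by simp), h.k_eq, F₂.a aANS rfl, c₁]
    refine hans.step g₁ ?_
    rw [g₂, cycPer_iff_of_period h.dvd hk0 hd0 hd hA]

/-- `v` is the first place below `t` where `P` fails, or `k` if there is none. -/
def FirstInv (P : ℕ → Prop) (k t v : ℕ) : Prop :=
  (v = k ∧ ∀ d < t, P d) ∨ (v < t ∧ ¬ P v ∧ ∀ d < v, P d)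

theorem FirstInv.step {P : ℕ → Prop} [DecidablePred P] {k t v : ℕ} (h : FirstInv P k t v)
    (ht : t < k) : FirstInv P k (t + 1) (if v = k then if P t then v else t else v) := by
  rcases h with ⟨h1, h2⟩ | ⟨h1, h2, h3⟩
  · rw [if_pos h1]
    split_ifs with h3
    · refine Or.inl ⟨h1, fun d hd => ?_⟩
      rcases Nat.lt_succ_iff_lt_or_eq.1 hd with hd | rfl
      · exact h2 d hd
      · exact h3
    · exact Or.inr ⟨by omega, h3, h2⟩
  · rw [if_neg (by omega)]
    exact Or.inr ⟨by omega, h2, h3⟩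

theorem FirstInv.final {P : ℕ → Prop} {k v : ℕ} (h : FirstInv P k k v) (hP : ∃ d < k, ¬ P d) :
    v < k ∧ ¬ P v ∧ ∀ d < v, P d := by
  rcases h with ⟨h1, h2⟩ | h
  · obtain ⟨d, hd, hn⟩ := hP
    exact absurd (h2 d hd) hn
  · exact h

/-- Find the ends of the run of the window `vi` in the cyclic word. -/
def cycProg : Cmd Var Arr :=
  .set vw (vi.e * vm.e) ;; .set vd (aPP.at vi.e) ;; .set vr vk.e ;; .set vrl vk.e ;;
  .loop vt vk.e (
    .set vr (.cond .eq vr.e vk.e (.cond .eq (aX.at (modE (vw.e + vm.e + vt.e) vk.e + lit 1))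
      (aX.at (modE (vw.e + vm.e + vt.e - vd.e) vk.e + lit 1)) vr.e vt.e) vr.e) ;;
    .set vrl (.cond .eq vrl.e vk.e (.cond .eq
      (aX.at (modE (vw.e + vk.e - lit 1 - vt.e) vk.e + lit 1))
      (aX.at (modE (vw.e + vk.e - lit 1 - vt.e + vd.e) vk.e + lit 1)) vrl.e vt.e) vrl.e)) ;;
  .set vff (vw.e + vk.e - vd.e * (vrl.e / vd.e)) ;; .set vfl (vw.e + vd.e * (vr.e / vd.e))

/-- Primitivity provides a break of the period `p` within one turn of the cyclic word in either
direction, so scanning `k` letters finds both ends of the run. The summand `k` in the left end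
prevents truncation. -/
theorem cycProg_spec {X : ℕ → ℕ} {n j k i w p Z C : ℕ} (hD : Dim n Z C) (s : St Var Arr)
    (h : KCtx X n j k s) (hprim : ∀ d, d ∣ k → 0 < d → d < k → ¬ Agree X 0 d (k - d))
    (hi : i < 2) (hvi : s.v vi = i) (hw : w = i * 2 ^ j) (hp : p = s.a aPP i) :
    WP Z C cycProg s (7 + k * 3) fun s' => ∃ l r, IsCycRun X k w (2 ^ j) p l r ∧ r < k ∧
      s'.v vff = w + k - p * (l / p) ∧ s'.v vfl = w + p * (r / p) ∧ s'.v vd = p := by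
  have hZ := hD.len
  have hC := hD.lin
  have hkn := h.le
  have hlo := h.lo
  have hhi := h.hi
  have hwin := h.win i hi
  have hpp := hwin.pos
  have hpm := hwin.p_le
  rw [← hp] at hpp hpm
  have hpow := h.lev.pow
  obtain ⟨m, hm⟩ : ∃ m, m = 2 ^ j := ⟨_, rfl⟩
  rw [← hm] at hlo hhi hpm hw hpow ⊢
  have hwm : w ≤ m := by
    rw [hw]; calc i * m ≤ 1 * m := Nat.mul_le_mul_right _ (by omega)
      _ = m := one_mul _
  have hx : ∀ x y, s.a aX (x % k + 1) = s.a aX (y % k + 1) ↔ X (x % k) = X (y % k) := by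
    intro x y
    have h1 := Nat.mod_lt x (show 0 < k by omega)
    have h2 := Nat.mod_lt y (show 0 < k by omega)
    rw [← h.inp.val _ (by omega), ← h.inp.val _ (by omega)]
    omega
  refine .cost (.set_seq (by simp [hvi, hpow, ← hw]; omega) fun s₁ a₁ b₁ c₁ => .set_seq
    (by simp [b₁, c₁, hvi, ← hp]; omega) fun s₂ a₂ b₂ c₂ => .set_seq
    (by simp [b₂, b₁, h.k_eq]; omega) fun s₃ a₃ b₃ c₃ => .set_seq
    (by simp [b₃, b₂, b₁, h.k_eq]; omega) fun s₄ a₄ b₄ c₄ => .seq (.loop (fun t s' =>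
      FirstInv (fun d => X ((w + m + d) % k) = X ((w + m + d - p) % k)) k t (s'.v vr) ∧
      FirstInv (fun d => X ((w + k - 1 - d) % k) = X ((w + k - 1 - d + p) % k)) k t (s'.v vrl))
      k 2 (by simp [b₄, b₃, b₂, b₁, h.k_eq]) (by simp) (by omega) ?_ ?_) fun s₅ F₅ ⟨g₁, g₂⟩ => ?_)
    (?_ : 1 + (1 + (1 + (1 + ((1 + k * (2 + 1)) + (1 + 1))))) ≤ _)
  · exact ⟨Or.inl ⟨by simp [b₄, a₃, b₂, b₁, h.k_eq], by omega⟩,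
      Or.inl ⟨by simp [a₄, b₃, b₂, b₁, h.k_eq], by omega⟩⟩
  · rintro t ht s₅ F₅ q₅ ⟨g₁, g₂⟩
    have hw₅ : s₅.v vw = w := by simp [F₅.v vw rfl, b₄, b₃, b₂, a₁, hvi, hpow, ← hw]
    have hd₅ : s₅.v vd = p := by simp [F₅.v vd rfl, b₄, b₃, a₂, b₁, c₁, hvi, ← hp]
    have hk₅ : s₅.v vk = k := by simp [F₅.v vk rfl, b₄, b₃, b₂, b₁, h.k_eq]
    have hm₅ : s₅.v vm = m := by simp [F₅.v vm rfl, b₄, b₃, b₂, b₁, hpow]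
    have hX₅ : s₅.a aX = s.a aX := by simp [F₅.a aX rfl, c₄, c₃, c₂, c₁]
    have hr₅ : s₅.v vr ≤ k := by rcases g₁ with g | g <;> omega
    have hl₅ : s₅.v vrl ≤ k := by rcases g₂ with g | g <;> omega
    have hmod : ∀ x, x % k < k := fun x => Nat.mod_lt _ (by omega)
    have k₁ := hmod (w + m + t)
    have k₂ := hmod (w + m + t - p)
    have k₃ := hmod (w + k - 1 - t)
    have k₄ := hmod (w + k - 1 - t + p)
    have safe_mod : ∀ {e : Ex Var Arr} {s' : St Var Arr}, e.safe Z C s' → e.eval s' < C →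
        s'.v vk = k → (aX.at (modE e vk.e + lit 1)).safe Z C s' := by
      intro e s' h1 h2 h3
      have := hmod (e.eval s')
      refine ⟨⟨modE_safe h1 trivial h2, by simp; omega, ?_⟩, ?_⟩
      · simp [h3]; omega
      · simp [h3]; omega
    refine .cost (.set_seq ⟨⟨trivial, trivial, fun _ => ⟨safe_mod ?_ ?_ hk₅, safe_mod ?_ ?_ hk₅,
      fun _ => trivial, fun _ => trivial⟩, fun _ => trivial⟩, ?_⟩ fun s₆ a₆ b₆ c₆ => .set
      ⟨⟨trivial, trivial, fun _ => ⟨safe_mod ?_ ?_ ?_, safe_mod ?_ ?_ ?_,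
      fun _ => trivial, fun _ => trivial⟩, fun _ => trivial⟩, ?_⟩ fun s₇ a₇ b₇ c₇ => ?_)
      (le_refl (1 + 1))
    · simp [hw₅, hm₅, q₅]; omega
    · simp [hw₅, hm₅, q₅]; omega
    · simp [hw₅, hm₅, q₅, hd₅]; omega
    · simp [hw₅, hm₅, q₅, hd₅]; omega
    · refine ite_lt_of (ite_lt_of ?_ ?_) ?_ <;> simp [q₅] <;> omega
    · simp [b₆, hw₅, hk₅, q₅]; omega
    · simp [b₆, hw₅, hk₅, q₅]; omega
    · simp [b₆, hk₅]
    · simp [b₆, hw₅, hk₅, q₅, hd₅]; omega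
    · simp [b₆, hw₅, hk₅, q₅, hd₅]; omega
    · simp [b₆, hk₅]
    · refine ite_lt_of (ite_lt_of ?_ ?_) ?_ <;> simp [b₆, q₅] <;> omega
    · have e₁ : s₇.v vr = if s₅.v vr = k then
          if X ((w + m + t) % k) = X ((w + m + t - p) % k) then s₅.v vr else t else s₅.v vr := by
        rw [b₇ _ (by simp), a₆]
        simp [hw₅, hm₅, q₅, hd₅, hk₅, hX₅, hx]
      have e₂ : s₇.v vrl = if s₅.v vrl = k then
          if X ((w + k - 1 - t) % k) = X ((w + k - 1 - t + p) % k) then s₅.v vrl else t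
          else s₅.v vrl := by
        rw [a₇]
        simp [b₆, c₆, hw₅, hm₅, q₅, hd₅, hk₅, hX₅, hx]
      rw [e₁, e₂]
      exact ⟨g₁.step ht, g₂.step ht⟩
  · have hw₅ : s₅.v vw = w := by simp [F₅.v vw rfl, b₄, b₃, b₂, a₁, hvi, hpow, ← hw]
    have hd₅ : s₅.v vd = p := by simp [F₅.v vd rfl, b₄, b₃, a₂, b₁, c₁, hvi, ← hp]
    have hk₅ : s₅.v vk = k := by simp [F₅.v vk rfl, b₄, b₃, b₂, b₁, h.k_eq]
    -- The scan to the right compares with the letter `p` places before, hence the base point `w + m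
    -- - p`; the scan to the left runs through the same steps in reverse order.
    obtain ⟨r1, r2, r3⟩ := g₁.final (by
      obtain ⟨d, h1, h2⟩ := exists_break (X := X) (k := k) (b := w + m - p) hpp (by omega) hprim
      refine ⟨d, h1, fun h3 => h2 ?_⟩
      rw [show w + m - p + d + p = w + m + d by omega, h3]
      congr 2; omega)
    obtain ⟨l1, l2, l3⟩ := g₂.final (by
      obtain ⟨d, h1, h2⟩ := exists_break (X := X) (k := k) (b := w) hpp (by omega) hprim
      refine ⟨k - 1 - d, by omega, fun h3 => h2 ?_⟩
      rwa [show w + k - 1 - (k - 1 - d) = w + d by omega] at h3)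
    obtain ⟨r, hr⟩ : ∃ r, r = s₅.v vr := ⟨_, rfl⟩
    obtain ⟨l, hl⟩ : ∃ l, l = s₅.v vrl := ⟨_, rfl⟩
    rw [← hr] at r1 r2 r3
    rw [← hl] at l1 l2 l3
    have m1 : p * (l / p) ≤ l := Nat.mul_div_le _ _
    have m2 : p * (r / p) ≤ r := Nat.mul_div_le _ _
    have m3 : l / p ≤ l := Nat.div_le_self _ _
    have m4 : r / p ≤ r := Nat.div_le_self _ _
    refine .set_seq (by simp [hw₅, hd₅, hk₅, ← hl]; omega) fun s₆ a₆ b₆ c₆ => .set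
      (by simp [b₆, hw₅, hd₅, hk₅, ← hr]; omega) fun s₇ a₇ b₇ c₇ => ?_
    refine ⟨l, r, ⟨l1, r2, r3, l2, l3⟩, r1, ?_, ?_, ?_⟩
    · simp [b₇, a₆, hw₅, hd₅, hk₅, hl]
    · simp [a₇, b₆, hw₅, hd₅, hr]
    · simp [b₇, b₆, hd₅]
  · omega

/-- Test whether the block `vo` starting at `vs` is the prefix of length `vk` rotated such that
the position `o` of the block corresponds to the position `f` of the prefix. -/
def tryProg (f o : Ex Var Arr) : Cmd Var Arr :=
  .set val (modE (f + vk.e - o) vk.e) ;;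
  .set vep vs.e ;; .set veq val.e ;; .set vel (vk.e - val.e) ;; eqProg ;; .set vhas vres.e ;;
  .set vep (vs.e + (vk.e - val.e)) ;; .set veq (lit 0) ;; .set vel val.e ;; eqProg ;;
  .put aGOOD vo.e (.cond .eq (vhas.e * vres.e) (lit 1) (lit 1) (aGOOD.at vo.e))

/-- Both pieces of the rotation are compared exactly, so a wrong alignment never sets a mark.
Completeness alone depends on which alignments are tried. -/
theorem tryProg_spec {X : ℕ → ℕ} {n j k q a Z C : ℕ} (hD : Dim n Z C) (s : St Var Arr)
    (h : KCtx X n j k s) (f o : Ex Var Arr) (hf : f.safe Z C s) (ho : o.safe Z C s)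
    (hfC : f.eval s + k < C) (ha : a = (f.eval s + k - o.eval s) % k)
    (hq : s.v vo = q) (hs : s.v vs = q * k) (hqn : q * k + k ≤ n) :
    WP Z C (tryProg f o) s (31 + j * 18) fun s' =>
      (∀ q', q' ≠ q → s'.a aGOOD q' = s.a aGOOD q') ∧
      ((∀ t < k, X (q * k + t) = X ((a + t) % k)) → s'.a aGOOD q = 1) ∧
      (¬ (∀ t < k, X (q * k + t) = X ((a + t) % k)) → s'.a aGOOD q = s.a aGOOD q) := by
  have hZ := hD.len
  have hC := hD.lin
  have hkn := h.le
  have hlo := h.lo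
  have hhi := h.hi
  have hk0 : 0 < k := by have : 0 < 2 ^ j := by positivity
                         omega
  have hak : a < k := by rw [ha]; exact Nat.mod_lt _ hk0
  have hqn' : q ≤ q * k := Nat.le_mul_of_pos_right _ hk0
  have hke := h.k_eq
  refine .cost (.set_seq ⟨modE_safe ?_ trivial ?_, ?_⟩ fun s₁ a₁ b₁ c₁ => .set_seq ?_
    fun s₂ a₂ b₂ c₂ => .set_seq ?_ fun s₃ a₃ b₃ c₃ => .set_seq ?_ fun s₄ a₄ b₄ c₄ => .seq
    (eqProg_spec (p := q * k) (q := a) (L := k - a) hD s₄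
      ((((h.set b₁ c₁).set b₂ c₂).set b₃ c₃).set b₄ c₄).lev h.pow_lt ?_ ?_ ?_ (by omega) (by omega)
      (by omega)) fun s₅ F₅ ⟨x₁, x₂⟩ => .set_seq ?_ fun s₆ a₆ b₆ c₆ => .set_seq ?_
    fun s₇ a₇ b₇ c₇ => .set_seq ?_ fun s₈ a₈ b₈ c₈ => .set_seq ?_ fun s₉ a₉ b₉ c₉ => .seq
    (eqProg_spec (p := q * k + (k - a)) (q := 0) (L := a) hD s₉
      (((((((((h.set b₁ c₁).set b₂ c₂).set b₃ c₃).set b₄ c₄).frame F₅).set b₆ c₆).set b₇ c₇).set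
        b₈ c₈).set b₉ c₉).lev h.pow_lt ?_ ?_ ?_ (by omega) (by omega) (by omega))
    fun s' F' ⟨y₁, y₂⟩ => .put ?_ fun s'' b'' a'' c'' => ?_)
    (?_ : 1 + (1 + (1 + (1 + ((if k - a < 2 ^ j then 11 + j * 9 else 5) + (1 + (1 + (1 + (1 +
      ((if a < 2 ^ j then 11 + j * 9 else 5) + 1))))))))) ≤ _)
  rotate_right 1
  · have := eq_cost_le (k - a) j
    have := eq_cost_le a j
    omega
  · simp [hf, ho, hke]; omega
  · simp [hke]; omega
  · simp [hke, ← ha]; omega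
  all_goals
    have e₁ : s₁.v val = a := by simp [a₁, hke, ha]
    have hk₁ : s₁.v vk = k := by rw [b₁ _ (by simp), hke]
    have hs₁ : s₁.v vs = q * k := by rw [b₁ _ (by simp), hs]
  · simp [hs₁]; omega
  · simp [b₂, e₁]; omega
  · simp [b₃, b₂, e₁, hk₁]; omega
  · simp [b₄, b₃, a₂, hs₁]
  · simp [b₄, a₃, b₂, e₁]
  · simp [a₄, b₃, b₂, e₁, hk₁]
  · simp; omega
  all_goals
    have e₆ : s₆.v val = a := by simp [b₆, F₅.v val rfl, b₄, b₃, b₂, e₁]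
    have hk₆ : s₆.v vk = k := by simp [b₆, F₅.v vk rfl, b₄, b₃, b₂, hk₁]
    have hs₆ : s₆.v vs = q * k := by simp [b₆, F₅.v vs rfl, b₄, b₃, b₂, hs₁]
  · simp [hs₆, e₆, hk₆]; omega
  · simp; omega
  · simp [b₈, b₇, e₆]; omega
  · simp [b₉, b₈, a₇, hs₆, hk₆, e₆]
  · simp [b₉, a₈]
  · simp [a₉, b₈, b₇, e₆]
  all_goals
    have hq' : s'.v vo = q := by
      simp [F'.v vo rfl, b₉, b₈, b₇, b₆, F₅.v vo rfl, b₄, b₃, b₂, b₁, hq]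
    have hh' : s'.v vhas = s₅.v vres := by simp [F'.v vhas rfl, b₉, b₈, b₇, a₆]
    have hG' : s'.a aGOOD = s.a aGOOD := by
      simp [F'.a aGOOD rfl, c₉, c₈, c₇, c₆, F₅.a aGOOD rfl, c₄, c₃, c₂, c₁]
    have hm : s₅.v vres * s'.v vres ≤ 1 * 1 := Nat.mul_le_mul x₁ y₁
  · simp [hq', hh']; omega
  · have e : s''.a aGOOD = Function.update (s.a aGOOD) q
        (if s₅.v vres * s'.v vres = 1 then 1 else s.a aGOOD q) := by
      rw [a'']; simp [hq', hh', hG']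
    have hiff : s₅.v vres * s'.v vres = 1 ↔ ∀ t < k, X (q * k + t) = X ((a + t) % k) := by
      rw [mul_eq_one, x₂, y₂, agree_rot_iff hak]
    rw [e]
    refine ⟨fun q' hq' => Function.update_of_ne hq' _ _, fun hg => ?_, fun hg => ?_⟩
    · rw [Function.update_self, if_pos (hiff.2 hg)]
    · rw [Function.update_self, if_neg (fun h => hg (hiff.1 h))]

/-- The entries of `g` that are one mark blocks that are rotations of the prefix. -/
def GoodInv (X : ℕ → ℕ) (n k : ℕ) (g : ℕ → ℕ) : Prop :=
  ∀ q < n / k, g q ≤ 1 ∧ (g q = 1 → RotAt X k (q * k))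

/-- Some occurrence of the window at `w` in the run from `f` to `e` witnesses that block `q` is a
rotation. -/
def Hits (X : ℕ → ℕ) (k m w p f e q : ℕ) : Prop :=
  ∃ a < k, (∀ t < k, X (q * k + t) = X ((a + t) % k)) ∧ ∃ o, o + m ≤ k ∧ (a + o) % k = w ∧
    f ≤ q * k + o ∧ q * k + o ≤ e ∧ p ∣ q * k + o - f

/-- The marks `g'` extend the marks `g`. -/
structure Extends (X : ℕ → ℕ) (n k : ℕ) (g g' : ℕ → ℕ) : Prop where
  good : GoodInv X n k g → GoodInv X n k g'
  mono : ∀ q, g q = 1 → g' q = 1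

theorem Extends.refl (X : ℕ → ℕ) (n k : ℕ) (g : ℕ → ℕ) : Extends X n k g g :=
  ⟨id, fun _ => id⟩

theorem Extends.trans {X : ℕ → ℕ} {n k : ℕ} {g g' g'' : ℕ → ℕ} (h : Extends X n k g g')
    (h' : Extends X n k g' g'') : Extends X n k g g'' :=
  ⟨h'.good ∘ h.good, fun q => h'.mono q ∘ h.mono q⟩

theorem tryProg_extends {X : ℕ → ℕ} {n j k q a Z C : ℕ} (hD : Dim n Z C) (s : St Var Arr)
    (h : KCtx X n j k s) (f o : Ex Var Arr) (hf : f.safe Z C s) (ho : o.safe Z C s)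
    (hfC : f.eval s + k < C) (ha : a = (f.eval s + k - o.eval s) % k)
    (hq : s.v vo = q) (hs : s.v vs = q * k) (hqn : q * k + k ≤ n) :
    WP Z C (tryProg f o) s (31 + j * 18) fun s' => Extends X n k (s.a aGOOD) (s'.a aGOOD) ∧
      ((∀ t < k, X (q * k + t) = X ((a + t) % k)) → s'.a aGOOD q = 1) := by
  have hk0 : 0 < k := by have := h.lo; have : 0 < 2 ^ j := by positivity
                         omega
  have hak : a < k := by rw [ha]; exact Nat.mod_lt _ hk0
  refine (tryProg_spec hD s h f o hf ho hfC ha hq hs hqn).mono le_rfl ?_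
  rintro s' - ⟨h1, h2, h3⟩
  refine ⟨⟨fun hg q' hq' => ?_, fun q' hq' => ?_⟩, h2⟩
  · by_cases e : q' = q
    · subst e
      by_cases hA : ∀ t < k, X (q' * k + t) = X ((a + t) % k)
      · rw [h2 hA]; exact ⟨le_rfl, fun _ => ⟨a, hak, hA⟩⟩
      · rw [h3 hA]; exact hg q' hq'
    · rw [h1 q' e]; exact hg q' hq'
  · by_cases e : q' = q
    · subst e
      by_cases hA : ∀ t < k, X (q' * k + t) = X ((a + t) % k)
      · exact h2 hA
      · rw [h3 hA, hq']
    · rw [h1 q' e, hq']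

/-- Try the alignments of block number `vq` of the current run. -/
def blockProg : Cmd Var Arr :=
  .set vo (vlo.e / vk.e + vq.e) ;; .set vs (vo.e * vk.e) ;;
  .set vtf (.cond .le vs.e vlo.e vlo.e
    (vlo.e + (vs.e - vlo.e + vd.e - lit 1) / vd.e * vd.e) - vs.e) ;;
  .set vtl (.cond .le vhi.e (vs.e + vk.e - vm.e) vhi.e
    (vlo.e + (vs.e + vk.e - vm.e - vlo.e) / vd.e * vd.e) - vs.e) ;;
  tryProg vff.e vtf.e ;; tryProg (vff.e + vd.e) vtf.e ;; tryProg vfl.e vtl.e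

/-- The variables describe a run of a window. -/
structure RunVars (X : ℕ → ℕ) (k m w p l r f e : ℕ) (s : St Var Arr) : Prop where
  cyc : IsCycRun X k w m p l r
  run : IsRun X w m p f e
  ff : s.v vff = w + k - p * (l / p)
  fl : s.v vfl = w + p * (r / p)
  d : s.v vd = p
  f_eq : s.v vlo = f
  e_eq : s.v vhi = e

theorem blockProg_spec {X : ℕ → ℕ} {n j k m w p l r f e x q Z C : ℕ} (hD : Dim n Z C)
    (s : St Var Arr) (h : KCtx X n j k s) (hm : m = 2 ^ j) (hR : RunVars X k m w p l r f e s)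
    (hp : 0 < p) (hpm : p ≤ m) (hper : Agree X w (w + p) (m - p)) (hwm : w ≤ m) (hr : r < k)
    (hen : e < n) (hx : s.v vq = x) (hq : q = f / k + x) (hqe : q ≤ e / k) :
    WP Z C blockProg s (97 + j * 54) fun s' => Extends X n k (s.a aGOOD) (s'.a aGOOD) ∧
      (Hits X k m w p f e q → s'.a aGOOD q = 1) := by
  have hZ := hD.len
  have hC := hD.lin
  have hkn := h.le
  have hlo := h.lo
  have hhi := h.hi
  have hpow := h.lev.pow
  rw [← hm] at hpow hlo hhi
  have hk0 : 0 < k := by omega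
  have hqk : q * k ≤ e := (Nat.mul_le_mul_right _ hqe).trans (Nat.div_mul_le_self _ _)
  have hqn : q * k + k ≤ n := by
    obtain ⟨N, rfl⟩ := h.dvd
    have h1 : q * k < N * k := by rw [mul_comm N]; omega
    have h2 : q + 1 ≤ N := lt_of_mul_lt_mul_right h1 (Nat.zero_le _)
    calc q * k + k = (q + 1) * k := by ring
      _ ≤ N * k := Nat.mul_le_mul_right _ h2
      _ = k * N := mul_comm _ _
  have hqq : q ≤ q * k := Nat.le_mul_of_pos_right _ hk0
  have hfe := hR.run.le
  have hfk : f / k ≤ f := Nat.div_le_self _ _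
  have b1 : (q * k - f + p - 1) / p * p ≤ q * k - f + p - 1 := Nat.div_mul_le_self _ _
  have b2 : (q * k - f + p - 1) / p ≤ q * k - f + p - 1 := Nat.div_le_self _ _
  have b3 : (q * k + k - m - f) / p * p ≤ q * k + k - m - f := Nat.div_mul_le_self _ _
  have b4 : (q * k + k - m - f) / p ≤ q * k + k - m - f := Nat.div_le_self _ _
  have b5 : p * (r / p) ≤ r := Nat.mul_div_le _ _
  have d₀ := hR.d
  have f₀ := hR.f_eq
  have e₀ := hR.e_eq
  have k₀ := h.k_eq
  refine .cost (.set_seq ?_ fun s₁ a₁ b₁ c₁ => .set_seq ?_ fun s₂ a₂ b₂ c₂ => .set_seq ?_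
    fun s₃ a₃ b₃ c₃ => .set_seq ?_ fun s₄ a₄ b₄ c₄ => .seq
    (tryProg_extends (q := q) (a := (w + k - p * (l / p) + k - (apFirst f p (q * k) - q * k)) % k)
      hD s₄ ((((h.set b₁ c₁).set b₂ c₂).set b₃ c₃).set b₄ c₄) vff.e vtf.e trivial trivial
      ?_ ?_ ?_ ?_ hqn) fun s₅ F₅ ⟨x₅, y₅⟩ => .seq
    (tryProg_extends (q := q)
      (a := (w + k - p * (l / p) + p + k - (apFirst f p (q * k) - q * k)) % k)
      hD s₅ (((((h.set b₁ c₁).set b₂ c₂).set b₃ c₃).set b₄ c₄).frame F₅) (vff.e + vd.e) vtf.e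
      ?_ trivial ?_ ?_ ?_ ?_ hqn) fun s₆ F₆ ⟨x₆, y₆⟩ => .mono
    (tryProg_extends (q := q)
      (a := (w + p * (r / p) + k - (apLast f e p (q * k + k - m) - q * k)) % k)
      hD s₆ ((((((h.set b₁ c₁).set b₂ c₂).set b₃ c₃).set b₄ c₄).frame F₅).frame F₆) vfl.e vtl.e
      trivial trivial ?_ ?_ ?_ ?_ hqn) le_rfl fun s' F' ⟨x₇, y₇⟩ => ?_)
    (?_ : 1 + (1 + (1 + (1 + ((31 + j * 18) + ((31 + j * 18) + (31 + j * 18)))))) ≤ _)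
  rotate_right 1
  · omega
  · simp [f₀, k₀, hx, ← hq]; omega
  all_goals
    have o₁ : s₁.v vo = q := by rw [a₁]; simp [f₀, k₀, hx, ← hq]
    have k₁ : s₁.v vk = k := by rw [b₁ _ (by simp), k₀]
    have d₁ : s₁.v vd = p := by rw [b₁ _ (by simp), d₀]
    have f₁ : s₁.v vlo = f := by rw [b₁ _ (by simp), f₀]
    have e₁ : s₁.v vhi = e := by rw [b₁ _ (by simp), e₀]
    have m₁ : s₁.v vm = m := by rw [b₁ _ (by simp), hpow]
  · simp [o₁, k₁]; omega
  all_goals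
    have s₂' : s₂.v vs = q * k := by rw [a₂]; simp [o₁, k₁]
  · simp [b₂, s₂', d₁, f₁]
    refine ⟨by omega, ?_⟩
    split_ifs <;> omega
  all_goals
    have t₃ : s₃.v vtf = apFirst f p (q * k) - q * k := by
      rw [a₃]; simp [b₂, s₂', d₁, f₁, apFirst]
  · simp [b₃, b₂, s₂', d₁, f₁, k₁, m₁, e₁]
    refine ⟨by omega, ?_⟩
    split_ifs <;> omega
  all_goals
    have t₄ : s₄.v vtl = apLast f e p (q * k + k - m) - q * k := by
      rw [a₄]; simp [b₃, b₂, s₂', d₁, f₁, k₁, m₁, e₁, apLast]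
    have u₄ : s₄.v vtf = apFirst f p (q * k) - q * k := by rw [b₄ _ (by simp), t₃]
    have k₄ : s₄.v vk = k := by simp [b₄, b₃, b₂, k₁]
    have o₄ : s₄.v vo = q := by simp [b₄, b₃, b₂, o₁]
    have s₄' : s₄.v vs = q * k := by simp [b₄, b₃, s₂']
    have d₄ : s₄.v vd = p := by simp [b₄, b₃, b₂, d₁]
    have ff₄ : s₄.v vff = w + k - p * (l / p) := by simp [b₄, b₃, b₂, b₁, hR.ff]
    have fl₄ : s₄.v vfl = w + p * (r / p) := by simp [b₄, b₃, b₂, b₁, hR.fl]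
    clear a₁ a₂ a₃ a₄
  · simp [ff₄]; omega
  · simp [ff₄, u₄]
  · exact o₄
  · exact s₄'
  · simp [F₅.v vff rfl, F₅.v vd rfl, ff₄, d₄]; omega
  · simp [F₅.v vff rfl, F₅.v vd rfl, ff₄, d₄]; omega
  · simp [F₅.v vff rfl, F₅.v vd rfl, F₅.v vtf rfl, ff₄, d₄, u₄]
  · rw [F₅.v vo rfl, o₄]
  · rw [F₅.v vs rfl, s₄']
  · simp [F₆.v vfl rfl, F₅.v vfl rfl, fl₄]; omega
  · simp [F₆.v vfl rfl, F₅.v vfl rfl, F₆.v vtl rfl, F₅.v vtl rfl, fl₄, t₄]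
  · rw [F₆.v vo rfl, F₅.v vo rfl, o₄]
  · rw [F₆.v vs rfl, F₅.v vs rfl, s₄']
  · have e₄ : s₄.a aGOOD = s.a aGOOD := by simp [c₄, c₃, c₂, c₁]
    rw [e₄] at x₅
    refine ⟨(x₅.trans x₆).trans x₇, ?_⟩
    rintro ⟨a, ha, hA, o, h1, h2, h3, h4, h5⟩
    rcases rotation_found hp hpm (by omega) hper hR.cyc ha hA h1 h2 hR.run h3 h4 h5 with
      h6 | h6 | h6
    · exact x₇.mono _ (x₆.mono _ (y₅ (h6 ▸ hA)))
    · exact x₇.mono _ (y₆ (h6 ▸ hA))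
    · exact y₇ (h6 ▸ hA)

/-- Try the alignments given by run number `vrr` of window `vi`. -/
def runProg : Cmd Var Arr :=
  .set vlo (aF.at (vi.e * (vn.e + lit 1) + vrr.e)) ;;
  .set vhi (aL.at (vi.e * (vn.e + lit 1) + vrr.e)) ;;
  .loop vq (vhi.e / vk.e - vlo.e / vk.e + lit 1) blockProg

/-- Only the blocks between those of the first and the last occurrence of the run can contain an
occurrence from it, so no others are inspected. -/
theorem runProg_spec {X : ℕ → ℕ} {n j k m i w p l r cnt rr Z C : ℕ} {F L : ℕ → ℕ}
    (hD : Dim n Z C) (s : St Var Arr) (h : KCtx X n j k s) (hm : m = 2 ^ j)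
    (hvi : s.v vi = i) (hi : i < 2) (hw : w = i * m)
    (hW : Wins X n m w p cnt F L) (hrr : rr < cnt) (hvr : s.v vrr = rr)
    (hF : F = fun r => s.a aF (i * (n + 1) + r)) (hL : L = fun r => s.a aL (i * (n + 1) + r))
    (hcyc : IsCycRun X k w m p l r) (hr : r < k) (hff : s.v vff = w + k - p * (l / p))
    (hfl : s.v vfl = w + p * (r / p)) (hd : s.v vd = p) :
    WP Z C runProg s (3 + (L rr / k - F rr / k + 1) * (98 + j * 54)) fun s' =>
      Extends X n k (s.a aGOOD) (s'.a aGOOD) ∧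
      ∀ q, Hits X k m w p (F rr) (L rr) q → s'.a aGOOD q = 1 := by
  have hZ := hD.len
  have hC := hD.lin
  have hkn := h.le
  have hlo := h.lo
  have hpm := hW.p_le
  have hk0 : 0 < k := by have : 0 < 2 ^ j := by positivity
                         omega
  have hlon : i * (n + 1) ≤ n + 1 := by
    calc i * (n + 1) ≤ 1 * (n + 1) := Nat.mul_le_mul_right _ (by omega)
      _ = n + 1 := one_mul _
  have hwm : w ≤ m := by
    rw [hw]; calc i * m ≤ 1 * m := Nat.mul_le_mul_right _ (by omega)
      _ = m := one_mul _
  have hcn := hW.cnt_le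
  have hLn := hW.lt rr hrr
  have hFL := (hW.run rr hrr).le
  have hk₀ := h.k_eq
  have hn₀ := h.lev.len
  obtain ⟨f, hf⟩ : ∃ f, f = F rr := ⟨_, rfl⟩
  obtain ⟨e, he⟩ : ∃ e, e = L rr := ⟨_, rfl⟩
  have hf' : s.a aF (i * (n + 1) + rr) = f := by rw [hf, hF]
  have he' : s.a aL (i * (n + 1) + rr) = e := by rw [he, hL]
  rw [← hf] at hFL ⊢
  rw [← he] at hFL hLn ⊢
  have v₁ : f / k ≤ f := Nat.div_le_self _ _
  have v₂ : e / k ≤ e := Nat.div_le_self _ _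
  have v₃ : f / k ≤ e / k := Nat.div_le_div_right hFL
  have v₅ : e / k - f / k ≤ e / k := Nat.sub_le _ _
  have v₄ : e / k - f / k + 1 < C := by omega
  refine .cost (.set_seq (by simp [hvi, hn₀, hvr, hf']; omega) fun s₁ a₁ b₁ c₁ => .set_seq
    (by simp [b₁, c₁, hvi, hn₀, hvr, he']; omega) fun s₂ a₂ b₂ c₂ => .mono (.loop (fun x s' =>
      Extends X n k (s.a aGOOD) (s'.a aGOOD) ∧
      ∀ x' < x, Hits X k m w p f e (f / k + x') → s'.a aGOOD (f / k + x') = 1)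
      (e / k - f / k + 1) (97 + j * 54) ?_ ?_ v₄ ⟨?_, by omega⟩ ?_) le_rfl ?_)
      (?_ : 1 + (1 + (1 + (e / k - f / k + 1) * (97 + j * 54 + 1))) ≤ _)
  rotate_right 1
  · rw [show 97 + j * 54 + 1 = 98 + j * 54 by omega]; omega
  all_goals
    have f₂ : s₂.v vlo = f := by simp [b₂, a₁, hvi, hn₀, hvr, hf']
    have e₂ : s₂.v vhi = e := by simp [a₂, b₁, c₁, hvi, hn₀, hvr, he']
    have k₂ : s₂.v vk = k := by simp [b₂, b₁, hk₀]
    have g₂ : s₂.a aGOOD = s.a aGOOD := by rw [c₂, c₁]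
  · simp [f₂, e₂, k₂]
  · simp [f₂, e₂, k₂, hk0.ne']; exact ⟨by omega, by omega, by omega⟩
  · rw [g₂]; exact .refl _ _ _ _
  · rintro x hx s₃ F₃ q₃ ⟨I₁, I₂⟩
    have h₃ : KCtx X n j k s₃ := ((h.set b₁ c₁).set b₂ c₂).frame F₃
    refine (blockProg_spec (q := f / k + x) hD s₃ h₃ hm ⟨hcyc, hf ▸ he ▸ hW.run rr hrr, ?_, ?_, ?_,
      ?_, ?_⟩ hW.pos hpm hW.per hwm hr hLn q₃ rfl (by omega)).mono le_rfl ?_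
    · rw [F₃.v vff rfl, b₂ _ (by simp), b₁ _ (by simp), hff]
    · rw [F₃.v vfl rfl, b₂ _ (by simp), b₁ _ (by simp), hfl]
    · rw [F₃.v vd rfl, b₂ _ (by simp), b₁ _ (by simp), hd]
    · rw [F₃.v vlo rfl, f₂]
    · rw [F₃.v vhi rfl, e₂]
    · rintro s₄ - ⟨y₁, y₂⟩
      refine ⟨I₁.trans y₁, fun x' hx' hh => ?_⟩
      rcases Nat.lt_succ_iff_lt_or_eq.1 hx' with hx' | rfl
      · exact y₁.mono _ (I₂ x' hx' hh)
      · exact y₂ hh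
  · rintro s₃ - ⟨I₁, I₂⟩
    refine ⟨I₁, fun q hh => ?_⟩
    have hh' := hh
    obtain ⟨a, -, -, o, o1, -, o3, o4, -⟩ := hh
    have hm0 : 0 < m := by rw [hm]; positivity
    have hqd : (q * k + o) / k = q := by
      rw [Nat.div_eq_iff hk0]
      constructor
      · omega
      · omega
    have h1 : f / k ≤ q := hqd ▸ Nat.div_le_div_right o3
    have h2 : q ≤ e / k := hqd ▸ Nat.div_le_div_right o4
    have := I₂ (q - f / k) (by omega)
    rw [Nat.add_sub_cancel' h1] at this
    exact this hh'

/-- The runs of a window meet few blocks. -/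
theorem Wins.sum_le {X : ℕ → ℕ} {n m w p cnt k : ℕ} {F L : ℕ → ℕ} (h : Wins X n m w p cnt F L)
    (hk : k < 4 * m) (hk0 : 0 < k) (hkn : k ∣ n) :
    ∑ r ∈ Finset.range cnt, (L r / k - F r / k + 1) ≤ 9 * (n / k) := by
  rcases Nat.eq_zero_or_pos cnt with rfl | hc
  · simp
  -- Runs are disjoint and ordered, so their extents telescope and each run adds at most one block
  -- more. Their separation by more than `m / 2`, with `k < 4 * m`, allows at most `8 * (n / k)`
  -- runs.
  have key : ∀ c, c + 1 ≤ cnt → ∑ r ∈ Finset.range (c + 1), (L r / k - F r / k + 1) ≤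
      L c / k + (c + 1) ∧ m * c ≤ 2 * F c := by
    intro c
    induction c with
    | zero => intro _; simp
    | succ c ih =>
      intro hcc
      obtain ⟨h1, h2⟩ := ih (by omega)
      obtain ⟨h3, h4⟩ := h.sep c (by omega)
      have h5 := (h.run (c + 1) (by omega)).le
      have h6 := (h.run c (by omega)).le
      have h7 : L c / k ≤ F (c + 1) / k := Nat.div_le_div_right h3.le
      have h8 : F (c + 1) / k ≤ L (c + 1) / k := Nat.div_le_div_right h5
      rw [Finset.sum_range_succ]
      refine ⟨by omega, ?_⟩
      rw [mul_add]; omega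
  obtain ⟨c, rfl⟩ : ∃ c, cnt = c + 1 := ⟨cnt - 1, by omega⟩
  obtain ⟨h1, h2⟩ := key c le_rfl
  have h3 := h.lt c (by omega)
  have h4 := (h.run c (by omega)).le
  obtain ⟨N, rfl⟩ := hkn
  rw [Nat.mul_div_cancel_left _ hk0]
  have h5 : L c / k < N := Nat.div_lt_of_lt_mul h3
  have h6 : m * c < m * (8 * N) := by
    have h7 : k * N ≤ 4 * m * N := Nat.mul_le_mul_right _ hk.le
    calc m * c ≤ 2 * F c := h2
      _ < 2 * (k * N) := by omega
      _ ≤ 2 * (4 * m * N) := by omega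
      _ = m * (8 * N) := by ring
  have := lt_of_mul_lt_mul_left h6 (Nat.zero_le _)
  omega

/-- Mark the blocks that are found to be rotations by means of window `vi`. -/
def windowProg : Cmd Var Arr := cycProg ;; .loop vrr (aRR.at vi.e) runProg

/-- An intact window inside a block is an occurrence, hence lies in some stored run, and treating
this run marks the block. -/
theorem windowProg_spec {X : ℕ → ℕ} {n j k i Z C : ℕ} (hD : Dim n Z C) (s : St Var Arr)
    (h : KCtx X n j k s) (hprim : ∀ d, d ∣ k → 0 < d → d < k → ¬ Agree X 0 d (k - d))
    (hi : i < 2) (hvi : s.v vi = i) :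
    WP Z C windowProg s (8 + k * 3 + n / k * (918 + j * 486)) fun s' =>
      Extends X n k (s.a aGOOD) (s'.a aGOOD) ∧
      ∀ q < n / k, ∀ a < k, (∀ t < k, X (q * k + t) = X ((a + t) % k)) →
        ∀ o, o + 2 ^ j ≤ k → (a + o) % k = i * 2 ^ j → s'.a aGOOD q = 1 := by
  obtain ⟨m, hm⟩ : ∃ m, m = 2 ^ j := ⟨_, rfl⟩
  have hZ := hD.len
  have hC := hD.lin
  have hlo := h.lo
  have hhi := h.hi
  have hm0 : 0 < m := by rw [hm]; positivity
  have hWin := h.win i hi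
  rw [← hm] at hlo hhi ⊢
  have hk0 : 0 < k := by omega
  have hwm : i * m ≤ m := by
    calc i * m ≤ 1 * m := Nat.mul_le_mul_right _ (by omega)
      _ = m := one_mul _
  have hW := hWin
  unfold WinOK at hW
  rw [← hm] at hW
  have hcn := hW.cnt_le
  have hsum : ∑ r ∈ Finset.range (s.a aRR i), (3 + (s.a aL (i * (n + 1) + r) / k -
      s.a aF (i * (n + 1) + r) / k + 1) * (98 + j * 54) + 1) ≤ n / k * (918 + j * 486) := by
    have h1 := hW.sum_le hhi hk0 h.dvd
    calc _ ≤ ∑ r ∈ Finset.range (s.a aRR i), (s.a aL (i * (n + 1) + r) / k -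
          s.a aF (i * (n + 1) + r) / k + 1) * (102 + j * 54) := by
          refine Finset.sum_le_sum fun r _ => ?_
          generalize s.a aL (i * (n + 1) + r) / k - s.a aF (i * (n + 1) + r) / k = b
          nlinarith
      _ ≤ 9 * (n / k) * (102 + j * 54) := by
          rw [← Finset.sum_mul]; exact Nat.mul_le_mul_right _ h1
      _ = _ := by ring
  refine .cost (.seq (cycProg_spec hD s h hprim hi hvi rfl rfl) fun s₁ F₁ hcyc => .mono
    (.loop_sum (fun r s' => Extends X n k (s.a aGOOD) (s'.a aGOOD) ∧ ∀ r' < r, ∀ q,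
      Hits X k m (i * m) (s.a aPP i) (s.a aF (i * (n + 1) + r')) (s.a aL (i * (n + 1) + r')) q →
        s'.a aGOOD q = 1) (s.a aRR i) (fun r => 3 + (s.a aL (i * (n + 1) + r) / k -
      s.a aF (i * (n + 1) + r) / k + 1) * (98 + j * 54)) ?_ ?_ (by omega) ?_ ?_) le_rfl ?_)
      (?_ : 7 + k * 3 + (1 + _) ≤ _)
  rotate_right 1
  · exact hsum.trans' le_rfl |> fun h => by omega
  all_goals have i₁ : s₁.v vi = i := by rw [F₁.v vi rfl, hvi]
  · simp [i₁, F₁.a aRR rfl]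
  · simp [i₁]; omega
  · exact ⟨by rw [F₁.a aGOOD rfl]; exact .refl _ _ _ _, by omega⟩
  · rintro r hr s₂ F₂ q₂ ⟨I₁, I₂⟩
    obtain ⟨l, r', c1, c2, c3, c4, c5⟩ := hcyc
    rw [← hm] at c1
    refine (runProg_spec (m := m) (i := i) (w := i * m) (p := s.a aPP i) (rr := r) (l := l)
      (r := r') hD s₂ ((h.frame F₁).frame F₂) hm ?_ hi rfl hW hr q₂ ?_ ?_ c1 c2 ?_ ?_ ?_).mono
      le_rfl ?_
    · rw [F₂.v vi rfl, i₁]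
    · funext t; rw [F₂.a aF rfl, F₁.a aF rfl]
    · funext t; rw [F₂.a aL rfl, F₁.a aL rfl]
    · rw [F₂.v vff rfl, c3, hm]
    · rw [F₂.v vfl rfl, c4, hm]
    · rw [F₂.v vd rfl, c5]
    · rintro s₃ - ⟨y₁, y₂⟩
      refine ⟨I₁.trans y₁, fun r' hr' q hh => ?_⟩
      rcases Nat.lt_succ_iff_lt_or_eq.1 hr' with hr' | rfl
      · exact y₁.mono _ (I₂ r' hr' q hh)
      · exact y₂ q hh
  · rintro s₃ - ⟨I₁, I₂⟩
    refine ⟨I₁, fun q hq a ha hA o ho hao => ?_⟩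
    have hqn : q * k + o < n := by
      have h1 : (q + 1) * k ≤ n :=
        (Nat.mul_le_mul_right _ (Nat.succ_le_of_lt hq)).trans (Nat.div_mul_le_self _ _)
      rw [add_mul] at h1; omega
    obtain ⟨r, r1, r2, r3, r4⟩ := hW.cover (q * k + o) hqn fun t ht => by
      rw [add_assoc, hA (o + t) (by omega), ← add_assoc, ← Nat.mod_add_mod, hao,
        Nat.mod_eq_of_lt (by omega)]
    exact I₂ r r1 q ⟨a, ha, hA, o, ho, hao, r2, r3, r4⟩

/-- Decide the block length `vk` if the prefix of length `vk` is primitive. -/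
def primProg : Cmd Var Arr :=
  .loop vq (vn.e / vk.e) (.put aGOOD vq.e (lit 0)) ;; .loop vi (lit 2) windowProg ;;
  .set vok (lit 1) ;; .loop vq (vn.e / vk.e) (.set vok (vok.e * aGOOD.at vq.e)) ;;
  .put aANS vk.e vok.e

/-- Marks are sound by `GoodInv`; they are complete because every rotation leaves one of the two
windows intact. -/
theorem primProg_spec {X : ℕ → ℕ} {n j k Z C : ℕ} (hD : Dim n Z C) (s : St Var Arr)
    (h : KCtx X n j k s) (hprim : ∀ d, d ∣ k → 0 < d → d < k → ¬ Agree X 0 d (k - d))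
    (hA : AnsInv X n k (s.a aANS)) :
    WP Z C primProg s (23 + k * 6 + n / k * (1840 + j * 972)) fun s' =>
      AnsInv X n (k + 1) (s'.a aANS) := by
  have hZ := hD.len
  have hC := hD.lin
  have hkn := h.le
  have hk0 : 0 < k := by have := h.lo; have : 0 < 2 ^ j := by positivity
                         omega
  have hN : n / k ≤ n := Nat.div_le_self _ _
  have hk₀ := h.k_eq
  have hn₀ := h.lev.len
  refine .cost (.seq (.loop (fun q s' => ∀ q' < q, s'.a aGOOD q' = 0) (n / k) 1 ?_ ?_ (by omega)
    (by omega) ?_) fun s₁ F₁ h₁ => .seq (.loop (fun i s' => GoodInv X n k (s'.a aGOOD) ∧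
      ∀ i' < i, ∀ q < n / k, ∀ a < k, (∀ t < k, X (q * k + t) = X ((a + t) % k)) →
        ∀ o, o + 2 ^ j ≤ k → (a + o) % k = i' * 2 ^ j → s'.a aGOOD q = 1) 2
      (8 + k * 3 + n / k * (918 + j * 486)) rfl
      (by simp; omega) (by omega) ?_ ?_) fun s₂ F₂ h₂ => .set_seq
      (by simp; omega) fun s₃ a₃ b₃ c₃ => .seq (.loop (fun q s' => s'.v vok ≤ 1 ∧
        (s'.v vok = 1 ↔ ∀ q' < q, s₂.a aGOOD q' = 1)) (n / k) 1 ?_ ?_ (by omega) ?_ ?_)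
      fun s₄ F₄ h₄ => .put ?_ fun s' b' a' c' => ?_)
      (?_ : 1 + n / k * (1 + 1) + (1 + 2 * (8 + k * 3 + n / k * (918 + j * 486) + 1) +
        (1 + (1 + n / k * (1 + 1) + 1))) ≤ _)
  rotate_right 1
  · generalize n / k = N
    nlinarith
  · simp [hn₀, hk₀]
  · simp [hn₀, hk₀]; omega
  · rintro q hq s₂ F₂ q₂ I₁
    refine .put ?_ fun s₃ b₃ a₃ c₃ => ?_
    · simp [q₂]; omega
    · intro q' hq'
      rw [a₃, Function.update_apply]
      simp only [Ex.eval, q₂]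
      split_ifs with e
      · rfl
      · exact I₁ q' (by omega)
  · exact ⟨fun q hq => by simp [h₁ q hq], by omega⟩
  · rintro i hi s₃ F₃ q₃ ⟨I₁, I₂⟩
    refine (windowProg_spec hD s₃ ((h.frame F₁).frame F₃) hprim hi q₃).mono le_rfl ?_
    rintro s₄ - ⟨y₁, y₂⟩
    refine ⟨y₁.good I₁, fun i' hi' q hq a ha hA o ho hao => ?_⟩
    rcases Nat.lt_succ_iff_lt_or_eq.1 hi' with hi' | rfl
    · exact y₁.mono _ (I₂ i' hi' q hq a ha hA o ho hao)
    · exact y₂ q hq a ha hA o ho hao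
  all_goals
    have n₃ : s₃.v vn = n := by rw [b₃ _ (by simp), F₂.v vn rfl, F₁.v vn rfl, hn₀]
    have k₃ : s₃.v vk = k := by rw [b₃ _ (by simp), F₂.v vk rfl, F₁.v vk rfl, hk₀]
  · simp [n₃, k₃]
  · simp [n₃, k₃]; omega
  · exact ⟨by rw [a₃]; rfl, by rw [a₃]; simp⟩
  · rintro q hq s₅ F₅ q₅ ⟨I₁, I₂⟩
    have g₅ : s₅.a aGOOD = s₂.a aGOOD := by rw [F₅.a aGOOD rfl, c₃]
    have hg := (h₂.1 q hq).1
    have hle : s₅.v vok * s₂.a aGOOD q ≤ 1 := by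
      calc _ ≤ 1 * 1 := Nat.mul_le_mul I₁ hg
        _ = 1 := rfl
    refine .set ?_ fun s₆ a₆ b₆ c₆ => ?_
    · simp [q₅, g₅]; omega
    · rw [a₆]
      simp only [Ex.eval, Op.eval, q₅, g₅]
      refine ⟨hle, ?_⟩
      rw [mul_eq_one, I₂]
      refine ⟨fun ⟨h1, h2⟩ q' hq' => ?_, fun hh => ⟨fun q' hq' => hh q' (by omega), hh q (by omega)⟩⟩
      rcases Nat.lt_succ_iff_lt_or_eq.1 hq' with hq' | rfl
      · exact h1 q' hq'
      · exact h2
  · have k₄ : s₄.v vk = k := by rw [F₄.v vk rfl, k₃]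
    simp [k₄]; omega
  · have k₄ : s₄.v vk = k := by rw [F₄.v vk rfl, k₃]
    have A₄ : s₄.a aANS = s.a aANS := by
      rw [F₄.a aANS rfl, c₃, F₂.a aANS rfl, F₁.a aANS rfl]
    rw [a', A₄]
    simp only [Ex.eval, k₄]
    refine hA.step h₄.1 (h₄.2.trans ⟨fun hh => ⟨h.dvd, fun q hq => (h₂.1 q hq).2 (hh q hq)⟩,
      fun hh q hq => ?_⟩)
    obtain ⟨a, ha, hR⟩ := hh.2 q hq
    obtain ⟨i, hi, o, ho, hao⟩ := exists_intact (m := 2 ^ j) ha h.lo (by positivity)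
    exact h₂.2 i hi q hq a ha hR o ho hao

/-- Decide the block length `vk`. -/
def processProg : Cmd Var Arr := periodProg ;; .ite .lt vp0.e vk.e powerProg primProg

theorem processProg_spec {X : ℕ → ℕ} {n j k Z C : ℕ} (hD : Dim n Z C) (s : St Var Arr)
    (h : KCtx X n j k s) (hA : AnsInv X n k (s.a aANS)) :
    WP Z C processProg s (26 + k * 18 + n / k * (1840 + j * 972)) fun s' =>
      AnsInv X n (k + 1) (s'.a aANS) := by
  refine .cost (.seq (periodProg_spec hD s h) fun s₁ F₁ h₁ => .ite
    (c := 23 + k * 6 + n / k * (1840 + j * 972)) ?_ (fun hlt s₂ e₂ f₂ => ?_)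
    (fun hlt s₂ e₂ f₂ => ?_))
    (?_ : 2 + k * 12 + (1 + (23 + k * 6 + n / k * (1840 + j * 972))) ≤ _)
  rotate_right 1
  · omega
  · simp
  all_goals
    have h₂ : KCtx X n j k s₂ := (h.frame F₁).of_eq (by simp [e₂]) (by simp [f₂])
    have A₂ : AnsInv X n k (s₂.a aANS) := by rw [f₂, F₁.a aANS rfl]; exact hA
    have k₁ : s₁.v vk = k := by rw [F₁.v vk rfl, h.k_eq]
    simp only [Ex.eval, k₁, Cmp.Holds] at hlt
  · obtain ⟨h3, h4, h5, h6⟩ := h₁.resolve_left fun hh => by omega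
    refine (powerProg_spec hD s₂ h₂ (by rw [e₂]) h3 h4 h5 h6 A₂).mono ?_ fun _ _ hh => hh
    generalize n / k = N
    nlinarith
  · obtain ⟨-, h4⟩ := h₁.resolve_right fun hh => hlt hh.1
    exact primProg_spec hD s₂ h₂ h4 A₂

/-! ### The whole program -/

/-- Decide the block length `1`. -/
def oneProg : Cmd Var Arr :=
  .set vok (lit 1) ;;
  .loop vq vn.e (.set vok (.cond .eq (aCLS.at vq.e) (lit 0) vok.e (lit 0))) ;;
  .put aANS (lit 1) vok.e

theorem cycPer_one_iff {X : ℕ → ℕ} {n : ℕ} : CycPer X n 1 ↔ ∀ q < n, cls X 0 q = 0 := by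
  have h0 : cls X 0 0 = 0 := Nat.le_zero.1 cls_le
  refine ⟨fun h q hq => ?_, fun h => ⟨one_dvd _, fun q hq => ⟨0, one_pos, fun i hi => ?_⟩⟩⟩
  · obtain ⟨a, ha, hh⟩ := h.2 q (by simpa using hq)
    refine (cls_zero_eq_iff.2 ?_).trans h0
    simpa [Nat.mod_one] using hh 0 one_pos
  · obtain rfl : i = 0 := by omega
    simpa using cls_zero_eq_iff.1 ((h q (by simpa using hq)).trans h0.symm)

theorem oneProg_spec {X : ℕ → ℕ} {n Z C : ℕ} (hD : Dim n Z C) (s : St Var Arr)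
    (hn : s.v vn = n) (hcls : ClsInv X n 0 (s.a aCLS)) (hA : AnsInv X n 1 (s.a aANS)) :
    WP Z C oneProg s (3 + n * 2) fun s' => AnsInv X n 2 (s'.a aANS) := by
  have hZ := hD.len
  have hC := hD.lin
  refine .cost (.set_seq (by simp; omega) fun s₁ a₁ b₁ c₁ => .seq (.loop (fun q s' =>
    s'.v vok ≤ 1 ∧ (s'.v vok = 1 ↔ ∀ q' < q, cls X 0 q' = 0)) n 1 ?_ ?_ (by omega) ?_ ?_)
    fun s₂ F₂ h₂ => .put ?_ fun s₃ b₃ a₃ c₃ => ?_) (?_ : 1 + (1 + n * (1 + 1) + 1) ≤ _)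
  rotate_right 1
  · omega
  · simp [b₁, hn]
  · simp
  · exact ⟨by rw [a₁]; rfl, by rw [a₁]; simp⟩
  · rintro q hq s₂ F₂ q₂ ⟨I₁, I₂⟩
    have e₂ : s₂.a aCLS q = cls X 0 q := by rw [F₂.a aCLS rfl, c₁]; exact hcls q hq.le
    refine .set ?_ fun s₃ a₃ b₃ c₃ => ?_
    · simp [q₂]
      refine ⟨by omega, ?_⟩
      split_ifs <;> omega
    · rw [a₃]
      simp only [Ex.eval, Cmp.Holds, q₂, e₂]
      split_ifs with hh
      · refine ⟨I₁, I₂.trans ⟨fun h q' hq' => ?_, fun h q' hq' => h q' (by omega)⟩⟩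
        rcases Nat.lt_succ_iff_lt_or_eq.1 hq' with hq' | rfl
        · exact h q' hq'
        · exact hh
      · exact ⟨Nat.zero_le _, fun h => absurd h (by simp), fun h => absurd (h q (by omega)) hh⟩
  · simp; omega
  · rw [a₃, F₂.a aANS rfl, c₁]
    exact hA.step h₂.1 (h₂.2.trans cycPer_one_iff.symm)

/-- The time for the block length `k`. -/
def kCost (n k : ℕ) : ℕ := 5 + if k ∣ n then 26 + k * 18 + n / k * (1840 + Nat.log 2 k * 972) else 0

/-- Decide the block lengths belonging to the current level. -/
def lengthsProg : Cmd Var Arr :=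
  .loop vout (vm.e + vm.e) (.set vk (vm.e + vm.e + vout.e) ;; .ite .le vk.e vn.e
    (.ite .eq (vn.e / vk.e * vk.e) vn.e processProg .nop) .nop)

/-- The intervals from `2 * 2 ^ j` to `4 * 2 ^ j` of successive levels tile the lengths from `2` on;
length `1` is treated separately. -/
theorem lengthsProg_spec {X : ℕ → ℕ} {n j Z C : ℕ} (hD : Dim n Z C) (s : St Var Arr)
    (h : Lev X n j s) (hX : Inp X n s) (hw : ∀ i < 2, WinOK X n (2 ^ j) i s)
    (hjn : 2 * 2 ^ j ≤ n) (hA : AnsInv X n (2 * 2 ^ j) (s.a aANS)) :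
    WP Z C lengthsProg s (1 + ∑ o ∈ Finset.range (2 * 2 ^ j), kCost n (2 * 2 ^ j + o))
      fun s' => AnsInv X n (2 * 2 ^ (j + 1)) (s'.a aANS) := by
  have hZ := hD.len
  have hC := hD.lin
  have hm0 : 0 < 2 ^ j := by positivity
  have hpow := h.pow
  refine .mono (.loop_sum (fun o s' => AnsInv X n (2 * 2 ^ j + o) (s'.a aANS)) (2 * 2 ^ j)
    (fun o => kCost n (2 * 2 ^ j + o) - 1) (by simp [hpow]; omega) (by simp [hpow]; omega)
    (by omega) hA ?_) ?_ ?_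
  · intro o ho s₁ F₁ q₁ I₁
    obtain ⟨k, hk⟩ : ∃ k, k = 2 * 2 ^ j + o := ⟨_, rfl⟩
    change WP Z C _ s₁ (kCost n (2 * 2 ^ j + o) - 1) fun s' =>
      AnsInv X n (2 * 2 ^ j + o + 1) (s'.a aANS)
    replace I₁ : AnsInv X n k (s₁.a aANS) := hk ▸ I₁
    rw [← hk]
    have hjk : j ≤ Nat.log 2 k := by
      refine Nat.le_log_of_pow_le (by omega) (by omega)
    have n₁ : s₁.v vn = n := by rw [F₁.v vn rfl, h.len]
    have m₁ : s₁.v vm = 2 ^ j := by rw [F₁.v vm rfl, hpow]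
    refine .cost (.set_seq (by simp [m₁, q₁]; omega) fun s₂ a₂ b₂ c₂ => .ite
      (c := 1 + (1 + if k ∣ n then 26 + k * 18 + n / k * (1840 + Nat.log 2 k * 972) else 0))
      (by simp) (fun h₃ s₃ e₃ f₃ => .ite
        (c := 1 + if k ∣ n then 26 + k * 18 + n / k * (1840 + Nat.log 2 k * 972) else 0) ?_
        (fun h₄ s₄ e₄ f₄ => ?_) (fun h₄ s₄ e₄ f₄ => ?_))
      (fun h₃ s₃ e₃ f₃ => .cost (.nop fun s₄ e₄ f₄ => ?_) (by omega))) (by unfold kCost; omega)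
    all_goals
      have k₂ : s₂.v vk = k := by simp [a₂, m₁, q₁]; omega
      have n₂ : s₂.v vn = n := by rw [b₂ _ (by simp), n₁]
      simp only [Ex.eval, Cmp.Holds, k₂, n₂] at h₃
      have A₂ : AnsInv X n k (s₂.a aANS) := by rw [c₂]; exact I₁
    · have := Nat.div_mul_le_self n k
      simp [e₃, k₂, n₂]
      have := Nat.div_le_self n k
      omega
    · simp only [eval_mul, eval_div, Ex.eval, Cmp.Holds, e₃, k₂, n₂] at h₄
      have hdvd : k ∣ n := Dvd.intro_left _ h₄
      rw [if_pos hdvd]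
      have hK : KCtx X n j k s₄ := by
        refine ⟨⟨?_, ?_, ?_, ?_, ?_⟩, hX.frame ?_ ?_, ?_, by omega, by omega, hdvd, h₃, fun i hi => ?_⟩
        · rw [e₄, e₃, n₂]
        · rw [e₄, e₃, b₂ _ (by simp), F₁.v vlev rfl, h.lev]
        · rw [e₄, e₃, b₂ _ (by simp), m₁]
        · rw [f₄, f₃, c₂, F₁.a aCLS rfl]; exact h.cls
        · rw [f₄, f₃, c₂, F₁.a aBIR rfl, F₁.a aPAR rfl]; exact h.tree
        · rw [e₄, e₃, n₂, h.len]
        · rw [f₄, f₃, c₂, F₁.a aX rfl]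
        · rw [e₄, e₃, k₂]
        · have := hw i hi
          rwa [WinOK, f₄, f₃, c₂, F₁.a aPP rfl, F₁.a aRR rfl, F₁.a aF rfl, F₁.a aL rfl]
      refine (processProg_spec hD s₄ hK (by rw [f₄, f₃]; exact A₂)).mono ?_ fun _ _ hh => hh
      have : n / k * (1840 + j * 972) ≤ n / k * (1840 + Nat.log 2 k * 972) :=
        Nat.mul_le_mul_left _ (by omega)
      omega
    · simp only [eval_mul, eval_div, Ex.eval, Cmp.Holds, e₃, k₂, n₂] at h₄
      refine .cost (.nop fun s₅ e₅ f₅ => ?_) (by omega)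
      rw [f₅, f₄, f₃]
      exact A₂.skip fun hd => h₄ (Nat.div_mul_cancel hd)
    · rw [f₄, f₃]
      exact A₂.skip fun hd => h₃ (Nat.le_of_dvd (by omega) hd)
  · refine Nat.add_le_add_left (Finset.sum_le_sum fun o _ => ?_) _
    unfold kCost; omega
  · rintro s' - hh
    rwa [show 2 * 2 ^ j + 2 * 2 ^ j = 2 * 2 ^ (j + 1) by rw [pow_succ]; ring] at hh

/-- Go through one level. -/
def levelProg : Cmd Var Arr :=
  .ite .le (vm.e + vm.e) vn.e (.loop vi (lit 2) winProg ;; lengthsProg) .nop ;;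
  refineProg ;; .set vm (vm.e + vm.e)

theorem AnsInv.skip_all {X : ℕ → ℕ} {n k k' : ℕ} {f : ℕ → ℕ} (h : AnsInv X n k f) (hk : n < k)
    (hn : 0 < n) (hkk : k ≤ k') : AnsInv X n k' f := by
  induction k', hkk using Nat.le_induction with
  | base => exact h
  | succ k' hk' ih => exact ih.skip fun hd => by have := Nat.le_of_dvd hn hd; omega

theorem levelProg_spec {X : ℕ → ℕ} {n j Z C : ℕ} (hD : Dim n Z C) (hW : IsWord X n)
    (s : St Var Arr) (h : Lev X n j s) (hX : Inp X n s) (hjn : 2 ^ j < 2 * n)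
    (hA : AnsInv X n (2 * 2 ^ j) (s.a aANS)) :
    WP Z C levelProg s
      (35 + n * 52 + ∑ o ∈ Finset.range (2 * 2 ^ j), kCost n (2 * 2 ^ j + o)) fun s' =>
      s'.v vm = 2 ^ (j + 1) ∧ ClsInv X n (j + 1) (s'.a aCLS) ∧
      TreeInv X n (j + 1) (s'.a aBIR) (s'.a aPAR) ∧ AnsInv X n (2 * 2 ^ (j + 1)) (s'.a aANS) := by
  have hZ := hD.len
  have hC := hD.lin
  have hpow := h.pow
  have hn := h.len
  obtain ⟨S, hS⟩ : ∃ S, S = ∑ o ∈ Finset.range (2 * 2 ^ j), kCost n (2 * 2 ^ j + o) := ⟨_, rfl⟩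
  rw [← hS]
  refine .cost (.seq (.ite (Q := fun s' => AnsInv X n (2 * 2 ^ (j + 1)) (s'.a aANS))
    (c := 1 + 2 * (10 + n * 12 + 1) + (1 + S)) (by simp [hpow]; omega)
    (fun h₁ s₁ e₁ f₁ => ?_) (fun h₁ s₁ e₁ f₁ => .cost (.nop fun s₂ e₂ f₂ => ?_) (by omega)))
    fun s₁ F₁ h₁ => .seq (refineProg_spec (X := X) (j := j) hD hW s₁ ?_ ?_ ?_ hjn ?_ ?_)
    fun s₂ F₂ ⟨h₂, h₃⟩ => .set ?_ fun s₃ a₃ b₃ c₃ => ⟨?_, ?_, ?_, ?_⟩)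
    (?_ : 1 + (1 + 2 * (10 + n * 12 + 1) + (1 + S)) + (9 + n * 28 + 1) ≤ _)
  rotate_right 1
  · omega
  · simp only [Ex.eval, Op.eval, Cmp.Holds, hpow, hn] at h₁
    have L₁ : Lev X n j s₁ := ⟨by rw [e₁, h.len], by rw [e₁, h.lev], by rw [e₁, hpow],
      by rw [f₁]; exact h.cls, by rw [f₁]; exact h.tree⟩
    refine .seq (.loop (fun i s' => ∀ i' < i, WinOK X n (2 ^ j) i' s') 2 (10 + n * 12) rfl
      (by simp; omega) (by omega) (by omega) ?_) fun s₂ F₂ h₂ => ?_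
    · intro i hi s₂ F₂ q₂ I₂
      exact winProg_spec hD hW s₂ (L₁.frame F₂) rfl (by omega) hi q₂ I₂
    · rw [hS]
      exact lengthsProg_spec hD s₂ (L₁.frame F₂) ((hX.frame (by rw [e₁]) (by rw [f₁])).frame
        (F₂.v vn rfl) (F₂.a aX rfl)) h₂ (by omega) (by rw [F₂.a aANS rfl, f₁]; exact hA)
  · simp only [Ex.eval, Op.eval, Cmp.Holds, hpow, hn] at h₁
    rw [f₂, f₁]
    refine hA.skip_all (by omega) (by omega) ?_
    rw [pow_succ]; omega
  · rw [F₁.v vn rfl, hn]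
  · rw [F₁.v vlev rfl, h.lev]
  · rw [F₁.v vm rfl, hpow]
  · rw [F₁.a aCLS rfl]; exact h.cls
  · rw [F₁.a aBIR rfl, F₁.a aPAR rfl]; exact h.tree
  · simp [F₂.v vm rfl, F₁.v vm rfl, hpow]; omega
  · rw [a₃]; simp [F₂.v vm rfl, F₁.v vm rfl, hpow, pow_succ]; omega
  · rwa [c₃]
  · rwa [c₃]
  · rw [c₃, F₂.a aANS rfl]; exact h₁

/-- Decide all block lengths. -/
def mainProg : Cmd Var Arr :=
  lgProg ;; sortProg ;; nameProg ;; oneProg ;; .set vm (lit 1) ;; .loop vlev vlg.e levelProg ;;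
  .loop vq (vn.e + lit 1) (.put aX vq.e (aANS.at vq.e))

theorem sum_kCost (n l : ℕ) : ∑ j ∈ Finset.range l, ∑ o ∈ Finset.range (2 * 2 ^ j),
    kCost n (2 * 2 ^ j + o) ≤ ∑ k ∈ Finset.range (2 * 2 ^ l), kCost n k := by
  induction l with
  | zero => simp
  | succ l ih =>
    rw [Finset.sum_range_succ, show 2 * 2 ^ (l + 1) = 2 * 2 ^ l + 2 * 2 ^ l by rw [pow_succ]; ring,
      Finset.sum_range_add]
    exact Nat.add_le_add_right ih _

/-- With `n ≤ 2 ^ l`, the first `l` levels settle all lengths below `2 * 2 ^ l`, which includes `n`.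
The input is overwritten by the answers only at the very end. -/
theorem mainProg_spec {X : ℕ → ℕ} {n Z C : ℕ} (hD : Dim n Z C) (hW : IsWord X n)
    (s : St Var Arr) (hX : Inp X n s) (ha : ∀ b, b ≠ aX → s.a b = 0) :
    ∃ l, (l = 0 ∨ 2 ^ l < 2 * n) ∧ WP Z C mainProg s
      (16 + n * 12 + l * (41 + n * 64) + ∑ k ∈ Finset.range (2 * 2 ^ l), kCost n k) fun s' =>
      ∀ k, 1 ≤ k → k ≤ n → s'.a aX k ≤ 1 ∧ (s'.a aX k = 1 ↔ CycPer X n k) := by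
  have hZ := hD.len
  have hC := hD.lin
  have hn := hX.len
  obtain ⟨h1, h2, h3⟩ := lgProg_spec hD s hn
  obtain ⟨l, hl⟩ : ∃ l, l = (run Z C lgProg s).v vlg := ⟨_, rfl⟩
  rw [← hl] at h2 h3
  have hlC : l < C := by
    rcases h3 with h | h
    · omega
    · have := Nat.lt_two_pow_self (n := l); omega
  refine ⟨l, h3, .cost (.seq (R := fun s' => s'.v vlg = l) ⟨h1, hl.symm⟩ fun s₁ F₁ l₁ => .seq
    (sortProg_spec (X := X) hD s₁ (hX.frame (F₁.v vn rfl) (F₁.a aX rfl)) l₁ h2 h3)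
    fun s₂ F₂ ⟨h₂, h₂'⟩ => .seq (nameProg_spec hD hW s₂ ((hX.frame (F₁.v vn rfl)
    (F₁.a aX rfl)).frame (F₂.v vn rfl) (F₂.a aX rfl)) h₂ h₂') fun s₃ F₃ h₃ => .seq
    (oneProg_spec (X := X) (n := n) hD s₃ ?_ h₃ ?_) fun s₄ F₄ h₄ => .set_seq (by simp; omega)
    fun s₅ a₅ b₅ c₅ => .seq (.loop_sum (fun j s' => s'.v vm = 2 ^ j ∧ ClsInv X n j (s'.a aCLS) ∧
      TreeInv X n j (s'.a aBIR) (s'.a aPAR) ∧ AnsInv X n (2 * 2 ^ j) (s'.a aANS)) l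
      (fun j => 35 + n * 52 + ∑ o ∈ Finset.range (2 * 2 ^ j), kCost n (2 * 2 ^ j + o)) ?_ ?_ hlC
      ⟨?_, ?_, ?_, ?_⟩ ?_) fun s₆ F₆ h₆ => .mono (.loop (fun q s' => ∀ q' < q,
        s'.a aX q' = s₆.a aANS q') (n + 1) 1 ?_ ?_ (by omega) (by omega) ?_) le_rfl
        fun s₇ F₇ h₇ k hk hkn => ?_)
      (?_ : 3 + n * 4 + (3 + n * 2 + l * (12 * n + 5) + (2 + n * 2 + (3 + n * 2 + (1 + (1 + _ +
        (1 + (n + 1) * (1 + 1))))))) ≤ _)⟩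
  rotate_right 1
  · have h5 : ∑ j ∈ Finset.range l, (35 + n * 52 + ∑ o ∈ Finset.range (2 * 2 ^ j),
        kCost n (2 * 2 ^ j + o) + 1) ≤
        l * (36 + n * 52) + ∑ k ∈ Finset.range (2 * 2 ^ l), kCost n k := by
      have h4 := sum_kCost n l
      simp only [Finset.sum_add_distrib, Finset.sum_const, Finset.card_range, smul_eq_mul] at h4 ⊢
      linarith
    nlinarith
  all_goals have n₂ : s₂.v vn = n := by rw [F₂.v vn rfl, F₁.v vn rfl, hn]
  · rw [F₃.v vn rfl, n₂]
  · rw [F₃.a aANS rfl, F₂.a aANS rfl, F₁.a aANS rfl, ha _ (by simp)]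
    exact ⟨by omega, fun _ _ => rfl⟩
  all_goals
    have n₅ : s₅.v vn = n := by rw [b₅ _ (by simp), F₄.v vn rfl, F₃.v vn rfl, n₂]
    have l₅ : s₅.v vlg = l := by
      rw [b₅ _ (by simp), F₄.v vlg rfl, F₃.v vlg rfl, F₂.v vlg rfl, l₁]
  · simp [l₅]
  · simp
  · rw [a₅]; rfl
  · rw [c₅, F₄.a aCLS rfl]; exact h₃
  · have hb : s₅.a aBIR = 0 := by
      rw [c₅, F₄.a aBIR rfl, F₃.a aBIR rfl, F₂.a aBIR rfl, F₁.a aBIR rfl, ha _ (by simp)]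
    rw [hb]
    refine fun r _ hr' => ⟨fun i hi => ?_, fun h => absurd h (lt_irrefl 0)⟩
    obtain rfl : i = 0 := by omega
    simpa using hr'
  · rw [c₅]; exact h₄
  · rintro j hj s₆ F₆ q₆ ⟨I₁, I₂, I₃, I₄⟩
    refine levelProg_spec hD hW s₆ ⟨?_, q₆, I₁, I₂, I₃⟩ (hX.frame ?_ ?_) ?_ I₄
    · rw [F₆.v vn rfl, n₅]
    · rw [F₆.v vn rfl, n₅, hn]
    · rw [F₆.a aX rfl, c₅, F₄.a aX rfl, F₃.a aX rfl, F₂.a aX rfl, F₁.a aX rfl]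
    · have : 2 ^ j < 2 ^ l := Nat.pow_lt_pow_right (by omega) hj
      omega
  all_goals have n₆ : s₆.v vn = n := by rw [F₆.v vn rfl, n₅]
  · simp [n₆]
  · simp [n₆]; omega
  · intro q hq s₇ F₇ q₇ I₇
    refine .put ?_ fun s₈ b₈ a₈ c₈ => ?_
    · simp [q₇]; omega
    · intro q' hq'
      rw [a₈, Function.update_apply]
      simp only [Ex.eval, q₇, F₇.a aANS rfl]
      split_ifs with e
      · rw [e]
      · exact I₇ q' (by omega)
  · rw [h₇ k (by omega)]
    exact h₆.2.2.2.1 k hk (by omega)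

end Loops

namespace Loops

open ArithmeticFunction (vonMangoldt)

/-! ### Sums over divisors -/

/-- An elementary substitute for Mertens' product. If the largest element `a` is added to `c`
smaller ones, then `2 * c + 3 ≤ a`, and its squared factor is at most `(2 * c + 3) / (2 * c + 1)`,
so the bounds telescope. The square gives square-root growth in the number of primes. -/
theorem prod_odd_le (s : Finset ℕ) (h : ∀ p ∈ s, p % 2 = 1 ∧ 3 ≤ p) :
    ∏ p ∈ s, ((1 - (p : ℝ)⁻¹)⁻¹) ^ 2 ≤ 2 * s.card + 1 := by
  induction s using Finset.induction_on_max with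
  | empty => simp
  | insert a s ha ih =>
    have hn : a ∉ s := fun h => (ha a h).false
    have ih := ih fun p hp => h p (Finset.mem_insert_of_mem hp)
    have ha3 := h a (Finset.mem_insert_self _ _)
    have hc : s.card ≤ (a - 3) / 2 := by
      calc s.card ≤ (Finset.range ((a - 3) / 2)).card := by
            refine Finset.card_le_card_of_injOn (fun x => (x - 3) / 2) (fun x hx => ?_)
              fun x hx y hy hxy => ?_
            · have h1 := ha x hx
              have h2 := h x (Finset.mem_insert_of_mem hx)
              simp only [Finset.coe_range, Set.mem_Iio]
              omega
            · have h1 := h x (Finset.mem_insert_of_mem hx)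
              have h2 := h y (Finset.mem_insert_of_mem hy)
              simp only at hxy
              omega
        _ = _ := Finset.card_range _
    have hca : 2 * s.card + 3 ≤ a := by omega
    rw [Finset.prod_insert hn, Finset.card_insert_of_notMem hn]
    have hca' : (2 * s.card + 3 : ℝ) ≤ a := by exact_mod_cast hca
    have hc0 : (0 : ℝ) ≤ s.card := Nat.cast_nonneg _
    push_cast
    generalize (s.card : ℝ) = c at *
    generalize (a : ℝ) = b at *
    have hb : 0 < b - 1 := by linarith
    have hb0 : b ≠ 0 := by linarith
    have e : (1 - b⁻¹)⁻¹ = b / (b - 1) := by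
      rw [show 1 - b⁻¹ = (b - 1) / b by field_simp, inv_div]
    rw [e]
    calc (b / (b - 1)) ^ 2 * _ ≤ (b / (b - 1)) ^ 2 * (2 * c + 1) := by gcongr
      _ = b ^ 2 * (2 * c + 1) / (b - 1) ^ 2 := by rw [div_pow]; ring
      _ ≤ 2 * (c + 1) + 1 := by
        rw [div_le_iff₀ (by positivity)]
        nlinarith

/-- The divisors are among the numbers composed of primes dividing `n`, so the sum is at most the
Euler product over these primes. The prime `2` contributes the factor `4`, and there are at most
`Nat.log 2 n` prime factors. -/
theorem sum_inv_divisors_sq_le {n : ℕ} (hn : n ≠ 0) :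
    (∑ k ∈ n.divisors, (k : ℝ)⁻¹) ^ 2 ≤ 4 * (2 * Nat.log 2 n + 1) := by
  let f : ℕ →* ℝ := { toFun := fun n => (n : ℝ)⁻¹, map_one' := by simp, map_mul' := by
                        intro a b; push_cast; rw [mul_inv] }
  have h1 : ∑ k ∈ n.divisors, (k : ℝ)⁻¹ ≤ ∏ p ∈ n.primeFactors, (1 - (p : ℝ)⁻¹)⁻¹ := by
    have h := (EulerProduct.summable_and_hasSum_factoredNumbers_prod_filter_prime_geometric
      (f := f) (fun {p} hp => by
        simp only [f, MonoidHom.coe_mk, OneHom.coe_mk, norm_inv, Real.norm_natCast]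
        exact inv_lt_one_of_one_lt₀ (by exact_mod_cast hp.one_lt)) n.primeFactors).2
    rw [Finset.filter_true_of_mem fun p hp => Nat.prime_of_mem_primeFactors hp] at h
    refine le_trans (le_of_eq ?_) (sum_le_hasSum (n.divisors.subtype fun k : ℕ => k ∈ Nat.factoredNumbers _)
      (fun i _ => by simp [f]) h)
    refine (Finset.sum_subtype_of_mem (p := fun k : ℕ => k ∈ Nat.factoredNumbers n.primeFactors)
      (fun k : ℕ => f k) fun k hk => ?_).symm
    have hk := Nat.dvd_of_mem_divisors hk
    exact Nat.mem_factoredNumbers_of_primeFactors_subset (ne_zero_of_dvd_ne_zero hn hk)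
      (Nat.primeFactors_mono hk hn)
  have h2 := prod_odd_le (n.primeFactors.erase 2) fun p hp => by
    have hp2 := Finset.ne_of_mem_erase hp
    have hpp := Nat.prime_of_mem_primeFactors (Finset.mem_of_mem_erase hp)
    have := hpp.eq_two_or_odd
    have := hpp.two_le
    omega
  have h3 : (n.primeFactors.erase 2).card ≤ Nat.log 2 n := by
    refine (Finset.card_le_card (Finset.erase_subset _ _)).trans (Nat.le_log_of_pow_le one_lt_two ?_)
    exact (Finset.pow_card_le_prod _ _ _ fun p hp =>
      (Nat.prime_of_mem_primeFactors hp).two_le).trans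
      (Nat.le_of_dvd (Nat.pos_of_ne_zero hn) (Nat.prod_primeFactors_dvd n))
  have h4 : ∏ p ∈ n.primeFactors, ((1 - (p : ℝ)⁻¹)⁻¹) ^ 2 ≤
      4 * ∏ p ∈ n.primeFactors.erase 2, ((1 - (p : ℝ)⁻¹)⁻¹) ^ 2 := by
    by_cases h : 2 ∈ n.primeFactors
    · rw [← Finset.mul_prod_erase _ _ h]
      norm_num
    · rw [Finset.erase_eq_of_notMem h]
      have : 0 ≤ ∏ p ∈ n.primeFactors, ((1 - (p : ℝ)⁻¹)⁻¹) ^ 2 :=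
        Finset.prod_nonneg fun _ _ => sq_nonneg _
      linarith
  calc (∑ k ∈ n.divisors, (k : ℝ)⁻¹) ^ 2 ≤ (∏ p ∈ n.primeFactors, (1 - (p : ℝ)⁻¹)⁻¹) ^ 2 := by
        gcongr
    _ = _ := (Finset.prod_pow _ _ _).symm
    _ ≤ _ := h4
    _ ≤ 4 * (2 * (n.primeFactors.erase 2).card + 1) := by linarith
    _ ≤ _ := by
      have : ((n.primeFactors.erase 2).card : ℝ) ≤ Nat.log 2 n := by exact_mod_cast h3
      linarith

/-- Expand `log k` as the sum of the von Mangoldt function over the divisors of `k`, exchange the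
sums and write `k = d * e`; then `e` is again a divisor of `n`. -/
theorem sum_log_div_le (n : ℕ) : ∑ k ∈ n.divisors, Real.log k / k ≤
    (∑ d ∈ n.divisors, vonMangoldt d / d) * ∑ k ∈ n.divisors, (k : ℝ)⁻¹ := by
  calc ∑ k ∈ n.divisors, Real.log k / k
      = ∑ k ∈ n.divisors, ∑ d ∈ k.divisors, vonMangoldt d / k := by
        refine Finset.sum_congr rfl fun k _ => ?_
        rw [← Finset.sum_div, ArithmeticFunction.vonMangoldt_sum]
    _ = ∑ d ∈ n.divisors, ∑ k ∈ n.divisors with d ∣ k, vonMangoldt d / k := by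
        refine Finset.sum_comm' fun k d => ?_
        simp only [Nat.mem_divisors, Finset.mem_filter]
        constructor
        · rintro ⟨⟨h1, h2⟩, h3, h4⟩
          exact ⟨⟨⟨h1, h2⟩, h3⟩, h3.trans h1, h2⟩
        · rintro ⟨⟨⟨h1, h2⟩, h3⟩, -, -⟩
          exact ⟨⟨h1, h2⟩, h3, ne_zero_of_dvd_ne_zero h2 h1⟩
    _ ≤ ∑ d ∈ n.divisors, vonMangoldt d / d * ∑ k ∈ n.divisors, (k : ℝ)⁻¹ := by
        refine Finset.sum_le_sum fun d hd => ?_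
        have hd0 : 0 < d := Nat.pos_of_mem_divisors hd
        have hinj : Set.InjOn (· / d) ((n.divisors.filter (d ∣ ·) : Finset ℕ) : Set ℕ) := by
          intro a ha b hb hab
          simp only [Finset.coe_filter, Set.mem_ofPred_eq] at ha hb
          exact (Nat.div_left_inj ha.2 hb.2).1 hab
        calc ∑ k ∈ n.divisors with d ∣ k, vonMangoldt d / k
            = vonMangoldt d / d * ∑ k ∈ n.divisors with d ∣ k, ((k / d : ℕ) : ℝ)⁻¹ := by
              rw [Finset.mul_sum]
              refine Finset.sum_congr rfl fun k hk => ?_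
              rw [Finset.mem_filter] at hk
              obtain ⟨e, rfl⟩ := hk.2
              rw [Nat.mul_div_cancel_left _ hd0]
              push_cast
              rw [div_mul_eq_div_div, div_eq_mul_inv (_ / _)]
          _ = vonMangoldt d / d * ∑ k ∈ (n.divisors.filter (d ∣ ·)).image (· / d), (k : ℝ)⁻¹ := by
              rw [Finset.sum_image hinj]
          _ ≤ _ := by
              refine mul_le_mul_of_nonneg_left (Finset.sum_le_sum_of_subset_of_nonneg ?_
                fun _ _ _ => by positivity)
                (div_nonneg ArithmeticFunction.vonMangoldt_nonneg (Nat.cast_nonneg _))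
              intro k hk
              simp only [Finset.mem_image, Finset.mem_filter, Nat.mem_divisors] at hk ⊢
              obtain ⟨a, ⟨⟨h1, h2⟩, h3⟩, rfl⟩ := hk
              exact ⟨(Nat.div_dvd_of_dvd h3).trans h1, h2⟩
    _ = _ := by rw [Finset.sum_mul]

/-- Cauchy–Schwarz separates the terms into `vonMangoldt d / d ^ 2`, whose sum is bounded since
`vonMangoldt d ≤ log d ≤ 2 * √d`, and `vonMangoldt d`, whose sum over the divisors of `n` is exactly
`log n`. -/
theorem exists_sum_vonMangoldt_sq_le :
    ∃ B : ℝ, 0 ≤ B ∧ ∀ n : ℕ, (∑ d ∈ n.divisors, vonMangoldt d / d) ^ 2 ≤ B * Real.log n := by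
  have hs : Summable fun n : ℕ => 2 * (n : ℝ) ^ (-(3 / 2) : ℝ) :=
    (Real.summable_nat_rpow.2 (by norm_num)).mul_left _
  refine ⟨∑' n : ℕ, 2 * (n : ℝ) ^ (-(3 / 2) : ℝ), tsum_nonneg fun _ => by positivity, fun n => ?_⟩
  have h1 : ∑ d ∈ n.divisors, vonMangoldt d / (d : ℝ) ^ 2 ≤
      ∑' n : ℕ, 2 * (n : ℝ) ^ (-(3 / 2) : ℝ) := by
    refine le_trans (Finset.sum_le_sum fun d hd => ?_) (hs.sum_le_tsum n.divisors
      fun _ _ => by positivity)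
    have hd0 : (0 : ℝ) < d := by exact_mod_cast Nat.pos_of_mem_divisors hd
    rw [div_le_iff₀ (by positivity)]
    calc vonMangoldt d ≤ Real.log d := ArithmeticFunction.vonMangoldt_le_log
      _ ≤ (d : ℝ) ^ (1 / 2 : ℝ) / (1 / 2) := Real.log_le_rpow_div hd0.le (by norm_num)
      _ = 2 * ((d : ℝ) ^ (-(3 / 2) : ℝ) * (d : ℝ) ^ (2 : ℝ)) := by
        rw [← Real.rpow_add hd0]; norm_num; ring
      _ = _ := by rw [Real.rpow_two]; ring
  calc (∑ d ∈ n.divisors, vonMangoldt d / d) ^ 2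
      ≤ (∑ d ∈ n.divisors, vonMangoldt d / (d : ℝ) ^ 2) * ∑ d ∈ n.divisors, vonMangoldt d := by
        refine Finset.sum_sq_le_sum_mul_sum_of_sq_le_mul _ (fun d _ => ?_) (fun d _ => ?_)
          fun d _ => le_of_eq ?_
        · exact div_nonneg ArithmeticFunction.vonMangoldt_nonneg (sq_nonneg _)
        · exact ArithmeticFunction.vonMangoldt_nonneg
        · rw [div_pow]; ring
    _ ≤ _ := by
        rw [ArithmeticFunction.vonMangoldt_sum]
        exact mul_le_mul_of_nonneg_right h1 (Real.log_natCast_nonneg n)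

theorem exists_sum_log_div_le : ∃ B : ℝ, 0 ≤ B ∧ ∀ n : ℕ, 2 ≤ n →
    ∑ k ∈ n.divisors, Real.log k / k ≤ B * Real.log n := by
  obtain ⟨B, hB, h⟩ := exists_sum_vonMangoldt_sq_le
  have hl2 : 0 < Real.log 2 := Real.log_pos one_lt_two
  refine ⟨√(B * (12 / Real.log 2)), Real.sqrt_nonneg _, fun n hn => ?_⟩
  have hln : Real.log 2 ≤ Real.log n := Real.log_le_log two_pos (by exact_mod_cast hn)
  have h1 := h n
  have h2 := sum_inv_divisors_sq_le (n := n) (by omega)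
  have h3 : (Nat.log 2 n : ℝ) ≤ Real.log n / Real.log 2 := Real.natLog_le_logb _ _
  have h4 : 4 * (2 * (Nat.log 2 n : ℝ) + 1) ≤ 12 / Real.log 2 * Real.log n := by
    have : 1 ≤ Real.log n / Real.log 2 := by rw [le_div_iff₀ hl2]; linarith
    rw [div_mul_eq_mul_div, mul_div_assoc]
    linarith
  refine (sum_log_div_le n).trans (abs_le_of_sq_le_sq' ?_ (by positivity)).2
  rw [mul_pow, mul_pow, Real.sq_sqrt (by positivity)]
  calc _ ≤ (B * Real.log n) * (12 / Real.log 2 * Real.log n) :=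
        mul_le_mul h1 (h2.trans h4) (sq_nonneg _) (by positivity)
    _ = _ := by ring

/-- The crude harmonic bound suffices for the terms without a logarithm. -/
theorem sum_inv_divisors_le (n : ℕ) :
    ∑ k ∈ n.divisors, (k : ℝ)⁻¹ ≤ 1 + Real.log n := by
  refine le_trans ?_ (harmonic_le_one_add_log n)
  rw [harmonic_eq_sum_Icc]
  push_cast
  exact Finset.sum_le_sum_of_subset_of_nonneg (fun k hk => Finset.mem_Icc.2
    ⟨Nat.pos_of_mem_divisors hk, Nat.divisor_le hk⟩) fun _ _ _ => by positivity

end Loops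

/-! ### Total running time, word size and input format. -/

namespace Loops

open WordRAM Var Arr

/-- A bound for the number of steps of `mainProg`. -/
def timeBound (n : ℕ) : ℕ :=
  16 + n * 12 + Nat.log 2 (2 * n) * (41 + n * 64) + ∑ k ∈ Finset.range (4 * n + 2), kCost n k

theorem sum_kCost_eq {n : ℕ} (hn : 2 ≤ n) : ∑ k ∈ Finset.range (4 * n + 2), kCost n k =
    (4 * n + 2) * 5 +
      ∑ k ∈ n.divisors, (26 + k * 18 + n / k * (1840 + Nat.log 2 k * 972)) := by
  unfold kCost
  rw [Finset.sum_add_distrib, Finset.sum_const, Finset.card_range, smul_eq_mul,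
    ← Finset.sum_filter]
  congr 1
  refine Finset.sum_congr (Finset.ext fun k => ?_) fun k _ => rfl
  simp only [Finset.mem_filter, Finset.mem_range, Nat.mem_divisors]
  exact ⟨fun h => ⟨h.2, by omega⟩, fun h => ⟨by have := Nat.le_of_dvd (by omega) h.1; omega, h.1⟩⟩

theorem exists_timeBound_le : ∃ B : ℝ, ∀ n : ℕ, 2 ≤ n →
    (timeBound n : ℝ) ≤ B * (n * Real.log n) := by
  obtain ⟨B, hB, h⟩ := exists_sum_log_div_le
  have hl2 : 0 < Real.log 2 := Real.log_pos one_lt_two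
  obtain ⟨μ, hμ⟩ : ∃ μ, μ = (Real.log 2)⁻¹ := ⟨_, rfl⟩
  have hμ0 : 0 < μ := by rw [hμ]; positivity
  -- Since `1 ≤ μ * log n`, linear terms cost a factor `μ`: `20` comes from the loop over all
  -- lengths, `25` absorbs the remaining `26 + 12 * n`, and `26` counts divisors. The levels give
  -- `41 + 64 * n ≤ 105 * n`, and `1858 = 18 + 1840` collects the sums of `k` and of `n / k`.
  refine ⟨20 * μ + 2 * μ * 105 + 25 * μ + 26 * μ + 1858 * (μ + 1) + 972 * (μ * B), fun n hn => ?_⟩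
  obtain ⟨l, hl⟩ : ∃ l, l = Real.log n := ⟨_, rfl⟩
  have hln : Real.log 2 ≤ l := hl ▸ Real.log_le_log two_pos (by exact_mod_cast hn)
  have h1 : 1 ≤ μ * l := by
    rw [hμ, inv_mul_eq_div, le_div_iff₀ hl2]; linarith
  have hlog : ∀ k : ℕ, (Nat.log 2 k : ℝ) ≤ μ * Real.log k := fun k => by
    rw [hμ, inv_mul_eq_div]; exact Real.natLog_le_logb _ _
  have hS := sum_inv_divisors_le n
  have hf := h n hn
  have hn0 : (2 : ℝ) ≤ n := by exact_mod_cast hn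
  obtain ⟨S, hS'⟩ : ∃ S, S = ∑ k ∈ n.divisors, (k : ℝ)⁻¹ := ⟨_, rfl⟩
  have hdiv : ∀ k : ℕ, ((n / k : ℕ) : ℝ) ≤ n * (k : ℝ)⁻¹ := fun k => by
    rw [← div_eq_mul_inv]; exact Nat.cast_div_le
  have hnS : ∑ k ∈ n.divisors, ((n / k : ℕ) : ℝ) ≤ n * S := by
    rw [hS', Finset.mul_sum]; exact Finset.sum_le_sum fun k _ => hdiv k
  -- The map sending `k` to `n / k` permutes the divisors.
  have hsum : ∑ k ∈ n.divisors, (k : ℝ) ≤ n * S := by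
    rw [← Nat.sum_div_divisors n (fun k : ℕ => (k : ℝ))]; exact hnS
  have hcard : (n.divisors.card : ℝ) ≤ n := by exact_mod_cast Nat.card_divisors_le_self n
  have hlogsum : ∑ k ∈ n.divisors, ((n / k : ℕ) : ℝ) * Nat.log 2 k ≤ n * (μ * (B * l)) := by
    calc ∑ k ∈ n.divisors, ((n / k : ℕ) : ℝ) * Nat.log 2 k
        ≤ ∑ k ∈ n.divisors, n * (k : ℝ)⁻¹ * (μ * Real.log k) :=
          Finset.sum_le_sum fun k _ => mul_le_mul (hdiv k) (hlog k) (by positivity) (by positivity)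
      _ = n * (μ * ∑ k ∈ n.divisors, Real.log k / k) := by
          rw [Finset.mul_sum, Finset.mul_sum]
          exact Finset.sum_congr rfl fun k _ => by ring
      _ ≤ _ := by rw [hl]; gcongr
  have hlog2n : (Nat.log 2 (2 * n) : ℝ) ≤ 2 * μ * l := by
    rw [mul_comm 2 n, Nat.log_mul_base one_lt_two (by omega)]
    have := hlog n
    rw [← hl] at this
    push_cast
    linarith
  have hcost : ((∑ k ∈ Finset.range (4 * n + 2), kCost n k : ℕ) : ℝ) ≤
      (4 * n + 2) * 5 + (26 * n + 18 * (n * S) + 1840 * (n * S) + 972 * (n * (μ * (B * l)))) := by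
    rw [sum_kCost_eq hn]
    push_cast
    refine add_le_add_right ?_ _
    calc _ = 26 * (n.divisors.card : ℝ) + 18 * ∑ k ∈ n.divisors, (k : ℝ) +
          1840 * ∑ k ∈ n.divisors, ((n / k : ℕ) : ℝ) +
          972 * ∑ k ∈ n.divisors, ((n / k : ℕ) : ℝ) * Nat.log 2 k := by
          rw [Finset.mul_sum, Finset.mul_sum, Finset.mul_sum, Finset.card_eq_sum_ones]
          push_cast
          rw [Finset.mul_sum, ← Finset.sum_add_distrib, ← Finset.sum_add_distrib,
            ← Finset.sum_add_distrib]
          exact Finset.sum_congr rfl fun k _ => by ring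
      _ ≤ _ := by linarith
  have hSl : S ≤ (μ + 1) * l := by rw [hS']; rw [← hl] at hS; linarith
  have hnl : (n : ℝ) ≤ μ * (n * l) := by
    calc (n : ℝ) = n * 1 := (mul_one _).symm
      _ ≤ n * (μ * l) := by gcongr
      _ = _ := by ring
  have hnSl : n * S ≤ (μ + 1) * (n * l) := by
    calc n * S ≤ n * ((μ + 1) * l) := by gcongr
      _ = _ := by ring
  have hmid : (Nat.log 2 (2 * n) : ℝ) * (41 + n * 64) ≤ 2 * μ * 105 * (n * l) := by
    calc (Nat.log 2 (2 * n) : ℝ) * (41 + n * 64) ≤ 2 * μ * l * (105 * n) :=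
          mul_le_mul hlog2n (by linarith) (by positivity) ((Nat.cast_nonneg _).trans hlog2n)
      _ = _ := by ring
  rw [timeBound, Nat.cast_add, ← hl]
  push_cast at hcost ⊢
  have e : 972 * (n * (μ * (B * l))) = 972 * (μ * B) * (n * l) := by ring
  linarith

/-- Put the array length into register `1`. -/
def lengthProg : Program :=
  .seq (.const 1 2) (.seq (.arith .add 1 0 1) (.seq (.const 3 4) (.arith .mul 1 1 3)))

theorem var_injective : Function.Injective Var.ctorIdx :=
  Function.LeftInverse.injective Var.ofNat_ctorIdx

theorem arr_injective : Function.Injective Arr.ctorIdx :=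
  Function.LeftInverse.injective Arr.ofNat_ctorIdx

/-- Words must hold every address of the 17 arrays of length `4 * (n + 2)`, and every value below
the square of this length. The constant `12` is generous: the base `2 ^ (Nat.log 2 (n + σ) + 1)` is
at least `2` and exceeds `n`. -/
theorem word_size (n σ : ℕ) : 17 * (4 * (n + 2)) ≤ 2 ^ (12 * (Nat.log 2 (n + σ) + 1)) ∧
    4 * (n + 2) * (4 * (n + 2)) ≤ 2 ^ (12 * (Nat.log 2 (n + σ) + 1)) := by
  obtain ⟨b, hb⟩ : ∃ b, b = 2 ^ (Nat.log 2 (n + σ) + 1) := ⟨_, rfl⟩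
  have h1 : n + σ < b := hb ▸ Nat.lt_pow_succ_log_self one_lt_two _
  have h2 : 2 ≤ b := by rw [hb, pow_succ]; have := Nat.one_le_two_pow (n := Nat.log 2 (n + σ)); omega
  have e : 2 ^ (12 * (Nat.log 2 (n + σ) + 1)) = b ^ 12 := by rw [hb, ← pow_mul, mul_comm]
  have h3 : 2 ^ 7 ≤ b ^ 7 := Nat.pow_le_pow_left h2 7
  have h5 : 4 * (n + 2) ≤ 8 * b := by omega
  have h6 : 1 ≤ b ^ 3 := Nat.one_le_pow _ _ (by omega)
  rw [e]
  have h7 : 128 * (b * b) ≤ b ^ 12 := by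
    calc 128 * (b * b) ≤ b ^ 7 * (b * b) := Nat.mul_le_mul_right _ h3
      _ ≤ b ^ 7 * (b * b) * b ^ 3 := Nat.le_mul_of_pos_right _ h6
      _ = b ^ 12 := by ring
  have h8 : 17 * (8 * b) ≤ b ^ 12 := by
    have h9 : 2 ^ 8 ≤ b ^ 8 := Nat.pow_le_pow_left h2 8
    calc 17 * (8 * b) ≤ b ^ 8 * b := by nlinarith
      _ ≤ b ^ 8 * b * b ^ 3 := Nat.le_mul_of_pos_right _ h6
      _ = b ^ 12 := by ring
  exact ⟨by omega, (Nat.mul_le_mul h5 h5).trans (by nlinarith)⟩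

/-- The state of the loop program representing the input. -/
def inputState {σ : ℕ} (x : List (Fin σ)) : St Var Arr where
  v y := if y = vn then x.length else 0
  a b := if b = aX then (initState x).mem else 0
  t := 0
  ok := True

theorem initState_mem_succ {σ : ℕ} (x : List (Fin σ)) (i : ℕ) :
    (initState x).mem (i + 1) = (x.map Fin.val).getD i 0 := rfl

theorem inp_inputState {σ : ℕ} (x : List (Fin σ)) :
    Inp (letters x) x.length (inputState x) := by
  refine ⟨by simp [inputState], fun p hp => ?_⟩
  simp [inputState, initState_mem_succ, letters, hp]

theorem exec_lengthProg {w M n : ℕ} (h : 4 * (n + 2) < 2 ^ w) (m : State) (hm : m.reg 0 = n) :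
    ∃ m', Exec w M lengthProg m m' 4 ∧ m'.mem = m.mem ∧ m'.reg 1 = 4 * (n + 2) ∧
      ∀ r, r % 2 = 0 → m'.reg r = m.reg r := by
  refine ⟨_, .seq (.const _ _ _ (by omega)) (.seq (.arith _ _ _ _ _ ?_) (.seq (.const _ _ _
    (by omega)) (.arith _ _ _ _ _ ?_))), rfl, ?_, fun r hr => ?_⟩
  · simp [setReg_reg, Op.eval, hm]; omega
  · simp [setReg_reg, Op.eval, hm]; omega
  · simp [setReg_reg, Op.eval, hm]; omega
  · simp [setReg_reg, show ¬ r = 1 by omega, show ¬ r = 3 by omega]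

/-- The input ends before address `Z`, so it lies entirely in the block of `aX`, and all other
arrays start out as zero. -/
theorem rel_inputState {σ : ℕ} (x : List (Fin σ)) {Z C : ℕ} (hD : Dim x.length Z C) {m : State}
    (hm : m.mem = (initState x).mem) (h1 : m.reg 1 = Z)
    (hr : ∀ r, r % 2 = 0 → m.reg r = (initState x).reg r) :
    Rel Var.ctorIdx Arr.ctorIdx Z C (inputState x) m := by
  have hZ := hD.len
  have hC := hD.lin
  refine ⟨fun y => ?_, fun y => ?_, fun b i hi => ?_, h1⟩
  · rw [hr _ (by omega)]
    by_cases hy : y = vn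
    · subst hy; rfl
    · have : Var.ctorIdx y ≠ 0 := fun h => hy (var_injective (a₂ := vn) h)
      simp [inputState, initState, hy, this]
  · simp only [inputState]; split_ifs <;> omega
  · rw [hm]
    by_cases hb : b = aX
    · subst hb
      simp [inputState, show Arr.ctorIdx aX = 0 from rfl]
    · have h0 : Arr.ctorIdx b ≠ 0 := fun h => hb (arr_injective (a₂ := aX) h)
      have h2 : Z ≤ Arr.ctorIdx b * Z := Nat.le_mul_of_pos_left _ (Nat.pos_of_ne_zero h0)
      obtain ⟨j, hj⟩ : ∃ j, Arr.ctorIdx b * Z + i = j + 1 := ⟨Arr.ctorIdx b * Z + i - 1, by omega⟩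
      rw [hj, initState_mem_succ, List.getD_eq_default _ _ (by simp; omega)]
      simp [inputState, hb]

end Loops

theorem theorem2 :
    ∃ (P : WordRAM.Program) (c : ℕ) (T S : ℕ → ℕ),
      0 < c ∧
      (fun n : ℕ => (T n : ℝ)) =O[Filter.atTop] (fun n : ℕ => (n : ℝ) * Real.log (n : ℝ)) ∧
      (fun n : ℕ => (S n : ℝ)) =O[Filter.atTop] (fun n : ℕ => (n : ℝ)) ∧
      ∀ (σ : ℕ) (x : List (Fin σ)),
        ∃ (s : WordRAM.State) (t : ℕ),
          WordRAM.Exec (c * (Nat.log 2 (x.length + σ) + 1)) (S x.length) P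
            (WordRAM.initState x) s t ∧
          t ≤ T x.length ∧
          ∀ k : ℕ, 1 ≤ k → k ≤ x.length →
            (IsCyclicPeriodic k x → s.mem k = 1) ∧ (¬ IsCyclicPeriodic k x → s.mem k = 0) := by
  open Loops in
  -- Scratch registers start at `h = 1`, which leaves register `1` to the array length; the summand
  -- `4` is the time of `lengthProg`.
  refine ⟨.seq lengthProg (comp Var.ctorIdx Arr.ctorIdx mainProg 1), 12,
    fun n => slow mainProg * timeBound n + 4, fun n => 17 * (4 * (n + 2)), by norm_num, ?_, ?_, ?_⟩
  · obtain ⟨B, hB⟩ := exists_timeBound_le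
    refine Asymptotics.IsBigO.of_bound (slow mainProg * B + 4 / Real.log 2) ?_
    filter_upwards [Filter.eventually_ge_atTop 2] with n hn
    have hl2 : 0 < Real.log 2 := Real.log_pos one_lt_two
    have hn0 : (2 : ℝ) ≤ n := by exact_mod_cast hn
    have hln : Real.log 2 ≤ Real.log n := Real.log_le_log two_pos hn0
    rw [Real.norm_of_nonneg (by positivity), Real.norm_of_nonneg (by positivity)]
    push_cast
    have h1 : (slow mainProg : ℝ) * timeBound n ≤ slow mainProg * (B * (n * Real.log n)) := by
      gcongr; exact hB n hn
    have h2 : (4 : ℝ) ≤ 4 / Real.log 2 * (n * Real.log n) := by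
      rw [div_mul_eq_mul_div, le_div_iff₀ hl2]
      nlinarith
    linarith
  · refine Asymptotics.IsBigO.of_bound (17 * 12) ?_
    filter_upwards [Filter.eventually_ge_atTop 1] with n hn
    have hn0 : (1 : ℝ) ≤ n := by exact_mod_cast hn
    rw [Real.norm_of_nonneg (by positivity), Real.norm_of_nonneg (by positivity)]
    push_cast
    linarith
  · intro σ x
    obtain ⟨h1, h2⟩ := word_size x.length σ
    obtain ⟨w, hw⟩ : ∃ w, w = 12 * (Nat.log 2 (x.length + σ) + 1) := ⟨_, rfl⟩
    rw [← hw] at h1 h2 ⊢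
    have hD : Dim x.length (4 * (x.length + 2)) (4 * (x.length + 2) * (4 * (x.length + 2))) :=
      ⟨le_rfl, le_rfl⟩
    have hC := hD.lin
    obtain ⟨l, hl, hsafe, hpost⟩ := mainProg_spec hD (isWord_letters x) (inputState x)
      (inp_inputState x) fun b hb => by simp [inputState, hb]
    obtain ⟨hok, ht⟩ := hsafe trivial
    obtain ⟨m, e₁, m₁, m₂, m₃⟩ := exec_lengthProg (w := w) (M := 17 * (4 * (x.length + 2)))
      (n := x.length) (by omega) (WordRAM.initState x) rfl
    obtain ⟨m', t, e₂, r, -, c⟩ := exec_comp (K := 17) (w := w) (M := 17 * (4 * (x.length + 2)))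
      ⟨fun b => by cases b <;> decide, le_rfl, by omega, h1, h2⟩ var_injective arr_injective
      (by omega) mainProg 1 le_rfl (inputState x) m (rel_inputState x hD m₁ m₂ m₃) hok
    refine ⟨m', _, .seq e₁ e₂, ?_, fun k hk hkn => ?_⟩
    -- The summand `2` takes care of `l = 0`, which also covers the empty word.
    · have hb : 2 * 2 ^ l ≤ 4 * x.length + 2 := by
        rcases hl with rfl | hl
        · simp
        · omega
      have hlog : l ≤ Nat.log 2 (2 * x.length) := by
        rcases hl with rfl | hl
        · exact Nat.zero_le _
        · exact Nat.le_log_of_pow_le one_lt_two hl.le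
      have h5 : (run (4 * (x.length + 2)) (4 * (x.length + 2) * (4 * (x.length + 2))) mainProg
          (inputState x)).t ≤ timeBound x.length := by
        refine ht.trans ?_
        simp only [inputState, timeBound, zero_add]
        refine Nat.add_le_add (Nat.add_le_add_left (Nat.mul_le_mul_right _ hlog) _)
          (Finset.sum_le_sum_of_subset (Finset.range_subset_range.2 hb))
      have h6 := Nat.mul_le_mul_left (slow mainProg) h5
      rw [show (inputState x).t = 0 from rfl, mul_zero, add_zero] at c
      change 4 + t ≤ slow mainProg * timeBound x.length + 4
      omega
    · obtain ⟨h5, h6⟩ := hpost k hk hkn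
      have h7 := r.mem .aX k (by omega)
      rw [show Arr.ctorIdx .aX = 0 from rfl, zero_mul, zero_add] at h7
      rw [h7, isCyclicPeriodic_iff x hk hkn]
      exact ⟨h6.2, fun hh => by
        have : ¬ _ = 1 := fun e => hh (h6.1 e)
        omega⟩
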